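/- **Theorem.** For every infinite cardinal $\lambda$, $\mathsf{FA}_{\lambda^+}$ implies that there is a $\lambda^+$-complete $\lambda^{++}$-super-Souslin tree. The notions are the following. *Ordinals.* For a set $x$ of ordinals put $\mathrm{ssup}(x)=\sup\{\alpha+1\mid\alpha\in x\}$, $\mathrm{acc}^+(x)=\{\alpha<\mathrm{ssup}(x)\mid\sup(x\cap\alpha)=\alpha>0\}$, $\mathrm{cl}(x)=x\cup\mathrm{acc}^+(x)$; $x$ is *closed in its supremum* if $\mathrm{acc}^+(x)\subseteq x$. A *coi* is a continuous order-preserving injection $\pi:y\to\mu$ from a set $y$ of ordinals that is closed in its supremum into an ordinal $\mu$; continuity means $\pi(\delta)=\sup\pi[y\cap\delta]$ for all $\delta\in y$ with $\sup(y\cap\delta)=\delta>0$. $\binom{\mu}{\theta}$ is the set of images of cois $\theta\to\mu$. $H_\kappa$ is the collection of sets of hereditary cardinality less than $\kappa$, and $[\kappa^+]^{<\kappa}=\{x\subseteq\kappa^+\mid |x|<\kappa\}$. *The class $\mathcal P_\kappa$* ($\kappa$ regular uncountable) consists of all $(\mathbb P,\le,\mathbb Q)$ where $(\mathbb P,\le)$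 is a forcing notion with largest element $\mathbb 1$, $\mathbb 1\in\mathbb Q\subseteq\mathbb P$, equipped with realms $p\mapsto x_p\in[\kappa^+]^{<\kappa}$ and an action of cois, such that, writing $\mathbb P_y=\{p\in\mathbb P\mid x_p\subseteq y\}$ and $\mathbb Q_y=\mathbb Q\cap\mathbb P_y$: 1. (Realms) $x_{\mathbb 1}=\emptyset$; $q\le p$ implies $x_q\supseteq x_p$; if $x_p\subseteq x\in[\kappa^+]^{<\kappa}$, there is $q\le p$ with $x_q=x$. 2. (Scope) $\mathbb P_\emptyset=\{\mathbb 1\}$ and, up to renaming conditions, $\mathbb P_\kappa\subseteq H_\kappa$. 3. (Actions) Every coi $\pi:y\to\kappa^+$ with $y\subseteq\kappa^+$ acts on $\mathbb P_y$ so that for $p,q\in\mathbb P_y$: $\pi.p\in\mathbb P$ and $x_{\pi.p}=\pi[x_p]$, and $\pi.p\in\mathbb Q$ if $p\in\mathbb Q$; $\pi.q\le\pi.p$ iff $q\le p$; $\pi.p=p$ if $\pi$ is the identity; $\pi'.(\pi.p)=(\pi'\circ\pi).p$ for every coi $\pi':y'\to\kappa^+$ with $\mathrm{im}(\pi)\subseteq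 y'\subseteq\kappa^+$; $\pi.p=\pi'.p$ for every coi $\pi':y'\to\kappa^+$ with $x_p\subseteq y'\subseteq\kappa^+$ and $\pi{\restriction}x_p=\pi'{\restriction}x_p$. 4. (Restrictions) For $p\in\mathbb P$, $\alpha<\kappa^+$ there is a unique least condition $r$ with $x_r=x_p\cap\alpha$ and $p\le r$, denoted $p{\restriction}\alpha$; if $p\in\mathbb Q$ then $p{\restriction}\alpha\in\mathbb Q$; if $q\le p$ then $q{\restriction}\alpha\le p{\restriction}\alpha$. 5. (Vertical limits) If $\xi<\kappa$ and $\langle p_\eta\mid\eta<\xi\rangle$ satisfies $p_\eta=p_{\eta'}{\restriction}\mathrm{ssup}(x_{p_\eta})$ for $\eta<\eta'<\xi$, then there is a unique $p$ with $x_p=\bigcup_{\eta<\xi}x_{p_\eta}$ and $p_\eta=p{\restriction}\mathrm{ssup}(x_{p_\eta})$ for all $\eta<\xi$; if all $p_\eta\in\mathbb Q$, then $p\in\mathbb Q$. 6. (Sharpness) For $q\in\mathbb Q$, $x_q$ is closed in its supremum; for every $p\in\mathbb P$ there is $q\in\mathbb Q$ with $q\le p$ and $x_q=\mathrm{cl}(x_p)$.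 7. (Controlled closure) If $\xi<\kappa$, $\langle q_\eta\mid\eta<\xi\rangle$ is a decreasing sequence from $\mathbb Q$, $x=\bigcup_{\eta<\xi}x_{q_\eta}$, $\alpha<\mathrm{ssup}(x)$, and $r\in\mathbb Q_{\mathrm{ssup}(x\cap\alpha)}$ is a lower bound of $\langle q_\eta{\restriction}\alpha\mid\eta<\xi\rangle$, then there is $q\in\mathbb Q$ with $q{\restriction}\mathrm{ssup}(x\cap\alpha)=r$, $x_q=\mathrm{cl}(x_r\cup x)$ and $q\le q_\eta$ for all $\eta<\xi$. 8. (Amalgamation) If $p\in\mathbb Q$, $\alpha<\mathrm{ssup}(x_p)$, $q\in\mathbb P_\alpha$ and $q\le p{\restriction}\alpha$, then $p,q$ have a unique greatest lower bound $r$, and $x_r=x_q\cup x_p$, $r{\restriction}\alpha=q$. *The axiom.* For nonempty $D\subseteq\mathbb P$ let $x_D=\bigcap\{x_p\mid p\in D\}$; $D$ is *sharply dense* if for every $p\in\mathbb P$ there is $q\in D$ with $q\le p$ and $x_q=\mathrm{cl}(x_p\cup x_D)$. A *sharply dense system* is a family $\mathcal D=\{D_x\mid x\in\binom{\kappa^+}{\theta}\}$,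 for some ordinal $\theta<\kappa$, such that each $D_x$ is sharply dense with $x_{D_x}=x$, and for all $p\in\mathbb P$ and all cois $\pi:y\to\kappa^+$ with $x\subseteq x_p\subseteq y\subseteq\kappa^+$ we have $p\in D_x$ iff $\pi.p\in D_{\pi[x]}$. $\mathsf{FA}_\kappa$ asserts: for every $(\mathbb P,\le,\mathbb Q)\in\mathcal P_\kappa$ and all sharply dense systems $\mathcal D_i$ ($i<\kappa$) there is a filter $G$ on $\mathbb P$ with $G\cap D\ne\emptyset$ for all $i<\kappa$ and all $D\in\mathcal D_i$. *Trees.* A tree is a partial order $(T,<_T)$ in which the set of strict predecessors of every node is well-ordered; the height of a node is the order type of that set, and $T_\alpha$ is the set of nodes of height $\alpha$. It is a *$\lambda^{++}$-tree* if $0<|T_\alpha|<\lambda^{++}$ for all $\alpha<\lambda^{++}$ and $T_{\lambda^{++}}=\emptyset$; *normal* if for all $\alpha<\beta<\lambda^{++}$ every $u\in T_\alpha$ is below some $v\in T_\beta$; *splitting* if every node has at least two immediate successors; *$\lambda^+$-complete* if every chain of size $<\lambda^+$ has an upper bound in $T$. Let $T^\lambda$ be the set of injections $a:\lambda\to T_\alpha$,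 $\alpha<\lambda^{++}$, and write $a<_Tb$ if $a(i)<_Tb(i)$ for all $i<\lambda$. A *$\lambda^{++}$-super-Souslin tree* is a normal, splitting $\lambda^{++}$-tree for which there is a function $F:\{(a,b)\in T^\lambda\times T^\lambda\mid a<_Tb\}\to\lambda^+$ such that for all $a,b,c\in T^\lambda$ with $a<_Tb$ and $a<_Tc$, if $F(a,b)=F(a,c)$, then there is $i<\lambda$ such that $b(i)$ and $c(i)$ are comparable (i.e. $b(i)=c(i)$, $b(i)<_Tc(i)$ or $c(i)<_Tb(i)$). -/

import Mathlib

open Set Cardinal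

universe u v

/-! ### Sets of ordinals -/

/-- The strict supremum `ssup x = sup {α + 1 | α ∈ x}` (used for bounded `x`). -/
noncomputable def ssup (x : Set Ordinal.{u}) : Ordinal.{u} := sSup (Order.succ '' x)

/-- `acc⁺ x`: the nonzero `α < ssup x` with `sup (x ∩ α) = α`. -/
def accPlus (x : Set Ordinal.{u}) : Set Ordinal.{u} :=
  {α | α < ssup x ∧ sSup (x ∩ Iio α) = α ∧ 0 < α}

/-- The closure of `x` below `ssup x`. -/
def ordCl (x : Set Ordinal.{u}) : Set Ordinal.{u} := x ∪ accPlus x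

/-- `x` is closed in its supremum. -/
def ClosedInSup (x : Set Ordinal.{u}) : Prop := accPlus x ⊆ x

/-- The restriction of `π` to `y` is a continuous order-preserving injection from `y ⊆ μ` into
the ordinal `μ`, and `y` is closed in its supremum. The values of `π` outside of `y` are
irrelevant. -/
structure IsCoi (μ : Ordinal.{u}) (y : Set Ordinal.{u}) (π : Ordinal.{u} → Ordinal.{u}) :
    Prop where
  subset : y ⊆ Iio μ
  closed : ClosedInSup y
  mapsTo : MapsTo π y (Iio μ)
  strictMonoOn : StrictMonoOn π y
  continuous : ∀ δ ∈ y, 0 < δ → sSup (y ∩ Iio δ) = δ → π δ = sSup (π '' (y ∩ Iio δ))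

/-- The set `(μ choose θ)` of all closed copies of `θ` in `μ`. -/
def closedCopies (μ θ : Ordinal.{u}) : Set (Set Ordinal.{u}) :=
  {x | ∃ π, IsCoi μ (Iio θ) π ∧ x = π '' Iio θ}

/-- The ordinal `κ⁺`. -/
noncomputable def succOrd (κ : Cardinal.{u}) : Ordinal.{u} := (Order.succ κ).ord

/-- The family `[κ⁺]^{<κ}`. -/
def smallSets (κ : Cardinal.{u}) : Set (Set Ordinal.{u}) :=
  {x | x ⊆ Iio (succOrd κ) ∧ #x < Cardinal.lift.{u + 1} κ}

/-- `H_κ`: the sets whose transitive closure has cardinality less than `κ`. -/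
def hereditarilyLT (κ : Cardinal.{u}) : Set ZFSet.{u} :=
  {x | ∃ y : ZFSet.{u}, y.IsTransitive ∧ x ⊆ y ∧ y.card < κ}

/-! ### The class of forcing notions -/

/-- The structure that makes a forcing notion `P` a member of the class `𝒫_κ`. -/
structure SharpForcing (κ : Cardinal.{u}) (P : Type v) [Preorder P] where
  /-- The largest condition. -/
  one : P
  /-- The distinguished subset of `P`. -/
  Q : Set P
  /-- The realm `x_p` of `p`. -/
  realm : P → Set Ordinal.{u}
  /-- The action `π.p` of a continuous order-preserving injection `π : y → κ⁺` on the conditions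
  whose realm is included in `y` (only these values are relevant). -/
  act : Set Ordinal.{u} → (Ordinal.{u} → Ordinal.{u}) → P → P
  /-- The restriction of `p` to `α`, for `α < κ⁺`. -/
  restr : P → Ordinal.{u} → P
  le_one : ∀ p, p ≤ one
  one_mem : one ∈ Q
  -- Realms
  realm_mem : ∀ p, realm p ∈ smallSets κ
  realm_one : realm one = ∅
  realm_mono : ∀ p q, q ≤ p → realm p ⊆ realm q
  exists_realm_eq : ∀ p, ∀ x ∈ smallSets κ, realm p ⊆ x → ∃ q, q ≤ p ∧ realm q = x
  -- Scope: `P_∅ = {1}`, and, up to renaming conditions, `P_κ ⊆ H_κ`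
  scope_empty : {p | realm p ⊆ ∅} = {one}
  scope_card : ∃ code : P → ZFSet.{u}, InjOn code {p | realm p ⊆ Iio κ.ord} ∧
    MapsTo code {p | realm p ⊆ Iio κ.ord} (hereditarilyLT κ)
  -- Actions
  realm_act : ∀ y π p, IsCoi (succOrd κ) y π → realm p ⊆ y → realm (act y π p) = π '' realm p
  act_mem : ∀ y π p, IsCoi (succOrd κ) y π → realm p ⊆ y → p ∈ Q → act y π p ∈ Q
  act_le_iff : ∀ y π p q, IsCoi (succOrd κ) y π → realm p ⊆ y → realm q ⊆ y →
    (act y π q ≤ act y π p ↔ q ≤ p)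
  act_id : ∀ y π p, IsCoi (succOrd κ) y π → realm p ⊆ y → (∀ α ∈ y, π α = α) → act y π p = p
  act_comp : ∀ y π y' π' p, IsCoi (succOrd κ) y π → IsCoi (succOrd κ) y' π' → realm p ⊆ y →
    π '' y ⊆ y' → act y' π' (act y π p) = act y (π' ∘ π) p
  act_congr : ∀ y π y' π' p, IsCoi (succOrd κ) y π → IsCoi (succOrd κ) y' π' → realm p ⊆ y →
    realm p ⊆ y' → (∀ α ∈ realm p, π α = π' α) → act y π p = act y' π' p
  -- Restrictions
  restr_spec : ∀ p, ∀ α < succOrd κ, realm (restr p α) = realm p ∩ Iio α ∧ p ≤ restr p α ∧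
    ∀ r, realm r = realm p ∩ Iio α → p ≤ r → restr p α ≤ r
  restr_unique : ∀ p, ∀ α < succOrd κ, ∀ s, realm s = realm p ∩ Iio α → p ≤ s →
    (∀ r, realm r = realm p ∩ Iio α → p ≤ r → s ≤ r) → s = restr p α
  restr_mem : ∀ p ∈ Q, ∀ α < succOrd κ, restr p α ∈ Q
  restr_mono : ∀ p q, q ≤ p → ∀ α < succOrd κ, restr q α ≤ restr p α
  -- Vertical limits
  vertical_limit : ∀ ξ < κ.ord, ∀ p : Ordinal.{u} → P,
    (∀ η η', η < η' → η' < ξ → p η = restr (p η') (ssup (realm (p η)))) →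
    ∃! q, (realm q = ⋃ η ∈ Iio ξ, realm (p η)) ∧
      ∀ η < ξ, p η = restr q (ssup (realm (p η)))
  vertical_limit_mem : ∀ ξ < κ.ord, ∀ p : Ordinal.{u} → P,
    (∀ η η', η < η' → η' < ξ → p η = restr (p η') (ssup (realm (p η)))) →
    (∀ η < ξ, p η ∈ Q) →
    ∀ q, (realm q = ⋃ η ∈ Iio ξ, realm (p η)) →
      (∀ η < ξ, p η = restr q (ssup (realm (p η)))) → q ∈ Q
  -- Sharpness
  closed_of_mem : ∀ q ∈ Q, ClosedInSup (realm q)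
  sharpness : ∀ p, ∃ q ∈ Q, q ≤ p ∧ realm q = ordCl (realm p)
  -- Controlled closure
  controlled_closure : ∀ ξ < κ.ord, ∀ q : Ordinal.{u} → P, (∀ η < ξ, q η ∈ Q) →
    (∀ η η', η < η' → η' < ξ → q η' ≤ q η) →
    ∀ x : Set Ordinal.{u}, (x = ⋃ η ∈ Iio ξ, realm (q η)) →
    ∀ α < ssup x, ∀ r ∈ Q, realm r ⊆ Iio (ssup (x ∩ Iio α)) →
    (∀ η < ξ, r ≤ restr (q η) α) →
    ∃ s ∈ Q, restr s (ssup (x ∩ Iio α)) = r ∧ realm s = ordCl (realm r ∪ x) ∧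
      ∀ η < ξ, s ≤ q η
  -- Amalgamation
  amalgamation : ∀ p ∈ Q, ∀ α < ssup (realm p), ∀ q, realm q ⊆ Iio α → q ≤ restr p α →
    ∃ r, IsGLB {p, q} r ∧ (∀ r', IsGLB {p, q} r' → r' = r) ∧
      realm r = realm q ∪ realm p ∧ restr r α = q

namespace SharpForcing

variable {κ : Cardinal.{u}} {P : Type v} [Preorder P] (S : SharpForcing κ P)

/-- `x_D`, the intersection of the realms of the members of `D`. -/
def realmOf (D : Set P) : Set Ordinal.{u} := {α | ∀ p ∈ D, α ∈ S.realm p}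

/-- Sharply dense sets. -/
def IsSharplyDense (D : Set P) : Prop :=
  D.Nonempty ∧ ∀ p, ∃ q ∈ D, q ≤ p ∧ S.realm q = ordCl (S.realm p ∪ S.realmOf D)

/-- Sharply dense systems. -/
def IsSharplyDenseSystem (𝒟 : Set (Set P)) : Prop :=
  ∃ θ < κ.ord, ∃ D : Set Ordinal.{u} → Set P,
    𝒟 = D '' closedCopies (succOrd κ) θ ∧
    ∀ x ∈ closedCopies (succOrd κ) θ,
      S.IsSharplyDense (D x) ∧ S.realmOf (D x) = x ∧
      ∀ p y π, IsCoi (succOrd κ) y π → x ⊆ S.realm p → S.realm p ⊆ y →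
        (p ∈ D x ↔ S.act y π p ∈ D (π '' x))

end SharpForcing

/-- The forcing axiom `FA_κ`: for every member of `𝒫_κ` and every family of `κ` many sharply dense
systems, some filter meets every member of every system of the family. -/
def ForcingAxiom (κ : Cardinal.{u}) : Prop :=
  ∀ (P : Type u) [Preorder P] (S : SharpForcing κ P) (𝒟 : Ordinal.{u} → Set (Set P)),
    (∀ i < κ.ord, S.IsSharplyDenseSystem (𝒟 i)) →
    ∃ G : Order.PFilter P, ∀ i < κ.ord, ∀ D ∈ 𝒟 i, ((G : Set P) ∩ D).Nonempty

/-! ### Trees -/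

/-- A partial order is a tree if the strict predecessors of each element are well-ordered. -/
class IsTreeOrder (T : Type v) [PartialOrder T] : Prop where
  wo : ∀ x : T, IsWellOrder (Iio x) (fun a b => a < b)

section Trees

variable (T : Type u) [PartialOrder T] [IsTreeOrder T]

variable {T} in
/-- The height of `x`: the order type of the set of its strict predecessors. -/
noncomputable def treeHeight (x : T) : Ordinal.{u} :=
  haveI := IsTreeOrder.wo x
  Ordinal.type (fun a b : Iio x => a < b)

/-- The `α`-th level of a tree. -/
def treeLevel (α : Ordinal.{u}) : Set T := {x | treeHeight x = α}

/-- `κ`-trees. -/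
def IsKTree (κ : Cardinal.{u}) : Prop :=
  (∀ α < κ.ord, (treeLevel T α).Nonempty ∧ #(treeLevel T α) < κ) ∧ treeLevel T κ.ord = ∅

/-- Normal `κ`-trees. -/
def IsNormalTree (κ : Cardinal.{u}) : Prop :=
  ∀ α β : Ordinal.{u}, α < β → β < κ.ord →
    ∀ a ∈ treeLevel T α, ∃ b ∈ treeLevel T β, a < b

/-- Splitting trees: each node has at least two immediate successors. -/
def IsSplittingTree : Prop := ∀ a : T, ∃ b c : T, b ≠ c ∧ a ⋖ b ∧ a ⋖ c

/-- `χ`-complete trees: each chain of size less than `χ` has an upper bound. -/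
def IsCompleteTree (χ : Cardinal.{u}) : Prop :=
  ∀ C : Set T, IsChain (fun a b => a ≤ b) C → #C < χ → BddAbove C

/-- `θ`-level sequences of a `κ`-tree: injections of `θ` into a single level. -/
def LevelSeq (κ θ : Cardinal.{u}) : Set (Iio θ.ord → T) :=
  {a | Function.Injective a ∧ ∃ α < κ.ord, ∀ i, a i ∈ treeLevel T α}

/-- `λ⁺⁺`-super-Souslin trees. -/
def IsSuperSouslin (lam : Cardinal.{u}) : Prop :=
  IsKTree T (Order.succ (Order.succ lam)) ∧
  IsNormalTree T (Order.succ (Order.succ lam)) ∧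
  IsSplittingTree T ∧
  ∃ F : (Iio lam.ord → T) → (Iio lam.ord → T) → Ordinal.{u},
    (∀ a ∈ LevelSeq T (Order.succ (Order.succ lam)) lam,
      ∀ b ∈ LevelSeq T (Order.succ (Order.succ lam)) lam,
        (∀ i, a i < b i) → F a b < (Order.succ lam).ord) ∧
    ∀ a ∈ LevelSeq T (Order.succ (Order.succ lam)) lam,
      ∀ b ∈ LevelSeq T (Order.succ (Order.succ lam)) lam,
        ∀ c ∈ LevelSeq T (Order.succ (Order.succ lam)) lam,
          (∀ i, a i < b i) → (∀ i, a i < c i) → F a b = F a c →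
            ∃ i, b i ≤ c i ∨ c i ≤ b i

end Trees

-- Write λ for `#L` and κ = λ⁺. The tree is obtained from approximations of size at most λ. Each
-- consists of a tree order on nodes (γ, ξ), where the level γ < κ⁺ is taken from the realm and ξ
-- from a set `K` of size κ, and of colours (ε, γ, s, t, ζ): the colour ζ is given to the pair of an
-- injective sequence s on level ε and a sequence t weakly above it on level γ. If ζ is given to (s,
-- t) and to (s, t'), then t(i) and t'(i) must be comparable for λ many i. The theorem needs only
-- one i; having λ many leaves room for amalgamation. Colours are closed downward, so that two
-- sequences can be compared on lower levels.
--
-- The forcing is built for an abstract `FullClass` of complete approximations. Since 𝒫_κ also asks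
-- for restrictions, vertical limits and amalgamations of conditions that are not sharp, a condition
-- (`Cond`) is a set of facts such that the image of each of its initial parts can be completed over
-- any complete approximation that extends a lower part of this image, without new ordinals. This
-- property survives cuts, actions, vertical limits (`Cond.sup_vertical`) and amalgamation with a
-- sharp condition (`Cond.union`); sharp conditions are the complete ones with closed realm. Hence
-- `sharpForcing` belongs to 𝒫_κ, and `exists_generic` turns the axiom into a directed set that
-- meets the given dense systems.
--
-- The combinatorial core is the amalgamation of coloured trees. By `IsColouredTree.splice` it
-- reduces to putting a single level β of p on top of a tree q (`exists_top_level`). Each node of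
-- this level needs a branch of q below it, and each coloured sequence on level β must become
-- comparable, in λ many places, with each sequence of q that has the same colour over the same s.
-- These are at most λ demands with λ many suitable indices each, so they can be met at distinct
-- nodes (`exists_injective_choice`).
--
-- Sequences L → K occur both in the data and in the indices of the dense systems, and only κ many
-- of either are allowed, so 2^λ ≤ κ is needed. It follows from the axiom as well: a simpler forcing
-- names closed copies of λ + 1 by elements of a set of size κ, and copies with the same top and the
-- same name are equal (`two_power_le_of_forcingAxiom`).
--
-- Finally, dense systems for two-element copies yield normality, splitting and the colouring, and
-- those for longer copies yield upper bounds of chains (`exists_generic_tree`,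
-- `exists_isCoi_cover`).

universe w

/-! ### Sets of size at most that of a fixed infinite type -/

/-- `s` injects into `L`. -/
def Few (L : Type u) {α : Type*} (s : Set α) : Prop := Nonempty (s ↪ L)

namespace Few

variable {L : Type u} {α β : Type*} {s t : Set α}

theorem mono (hs : Few L s) (h : t ⊆ s) : Few L t :=
  hs.map fun e => (embeddingOfSubset t s h).trans e

theorem of_subsingleton [Nonempty L] (hs : s.Subsingleton) : Few L s :=
  ⟨⟨fun _ => Classical.arbitrary L, fun a b _ => Subtype.ext (hs a.2 b.2)⟩⟩

theorem empty [Nonempty L] : Few L (∅ : Set α) := of_subsingleton subsingleton_empty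

theorem singleton [Nonempty L] (a : α) : Few L {a} := of_subsingleton subsingleton_singleton

theorem image (hs : Few L s) (f : α → β) : Few L (f '' s) := by
  obtain ⟨e⟩ := hs
  choose g hg hfg using fun b : f '' s => b.2
  refine ⟨⟨fun b => e ⟨g b, hg b⟩, fun a b h => ?_⟩⟩
  have := congrArg Subtype.val (e.injective h)
  exact Subtype.ext (by rw [← hfg a, ← hfg b]; exact congrArg f this)

theorem preimage (hs : Few L s) {f : β → α} (hf : InjOn f (f ⁻¹' s)) : Few L (f ⁻¹' s) := by
  obtain ⟨e⟩ := hs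
  refine ⟨⟨fun b => e ⟨f b, b.2⟩, fun a b h => ?_⟩⟩
  exact Subtype.ext (hf a.2 b.2 (congrArg Subtype.val (e.injective h)))

theorem range (f : L → β) : Few L (Set.range f) := by
  choose g hg using fun b : Set.range f => b.2
  exact ⟨⟨g, fun a b h => Subtype.ext (by rw [← hg a, ← hg b, h])⟩⟩

theorem exists_embedding_prod (L : Type u) [Infinite L] : Nonempty (L × L ↪ L) := by
  have h : #(L × L) = #L := by simp [Cardinal.mul_eq_self (Cardinal.aleph0_le_mk L)]
  obtain ⟨e⟩ := Cardinal.eq.1 h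
  exact ⟨e.toEmbedding⟩

theorem biUnion [Infinite L] {ι : Type*} {I : Set ι} {f : ι → Set α} (hI : Few L I)
    (hf : ∀ i ∈ I, Few L (f i)) : Few L (⋃ i ∈ I, f i) := by
  obtain ⟨e⟩ := hI
  obtain ⟨p⟩ := exists_embedding_prod L
  have h : ∀ a : ↥(⋃ i ∈ I, f i), ∃ i, i ∈ I ∧ a.1 ∈ f i := fun a => by
    obtain ⟨i, hi, h⟩ := mem_iUnion₂.1 a.2
    exact ⟨i, hi, h⟩
  choose g hg hga using h
  have k : ∀ i ∈ I, f i ↪ L := fun i hi => (hf i hi).some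
  refine ⟨⟨fun a => p (e ⟨g a, hg a⟩, k (g a) (hg a) ⟨a, hga a⟩), fun a b hab => ?_⟩⟩
  have h1 := p.injective hab
  rw [Prod.mk.injEq] at h1
  have h2 : g a = g b := congrArg Subtype.val (e.injective h1.1)
  have h3 := h1.2
  have key : ∀ i j (hi : i ∈ I) (hj : j ∈ I) (x y : α) (hx : x ∈ f i) (hy : y ∈ f j), i = j →
      k i hi ⟨x, hx⟩ = k j hj ⟨y, hy⟩ → x = y := by
    rintro i j hi hj x y hx hy rfl h
    exact congrArg Subtype.val ((k i hi).injective h)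
  exact Subtype.ext (key _ _ _ _ _ _ _ _ h2 h3)

theorem union [Infinite L] (hs : Few L s) (ht : Few L t) : Few L (s ∪ t) := by
  obtain ⟨p⟩ := exists_embedding_prod L
  obtain ⟨a, b, hab⟩ := exists_pair_ne L
  have h : Few L ({a, b} : Set L) := ⟨Function.Embedding.subtype _⟩
  have := h.biUnion (f := fun i : L => {x | (i = a ∧ x ∈ s) ∨ (i = b ∧ x ∈ t)}) (by
    rintro i (rfl | rfl)
    · exact hs.mono (by rintro x (⟨_, h⟩ | ⟨h, _⟩); exacts [h, absurd h hab])
    · exact ht.mono (by rintro x (⟨h, _⟩ | ⟨_, h⟩); exacts [absurd h.symm hab, h]))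
  refine this.mono ?_
  rintro x (hx | hx)
  · exact mem_biUnion (x := a) (by simp) (Or.inl ⟨rfl, hx⟩)
  · exact mem_biUnion (x := b) (by simp) (Or.inr ⟨rfl, hx⟩)

theorem prod [Infinite L] {t : Set β} (hs : Few L s) (ht : Few L t) : Few L (s ×ˢ t) := by
  obtain ⟨e⟩ := hs
  obtain ⟨f⟩ := ht
  obtain ⟨p⟩ := exists_embedding_prod L
  refine ⟨⟨fun x => p (e ⟨x.1.1, x.2.1⟩, f ⟨x.1.2, x.2.2⟩), fun a b h => ?_⟩⟩
  have h1 := p.injective h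
  rw [Prod.mk.injEq] at h1
  exact Subtype.ext (Prod.ext (congrArg Subtype.val (e.injective h1.1))
    (congrArg Subtype.val (f.injective h1.2)))

theorem iff_lift_mk_le {L : Type u} {α : Type v} {s : Set α} :
    Few L s ↔ Cardinal.lift.{u} #s ≤ Cardinal.lift.{v} #L :=
  Cardinal.lift_mk_le'.symm

theorem iff_lt_succ {L : Type u} {α : Type (u + 1)} {s : Set α} :
    Few L s ↔ #s < Cardinal.lift.{u + 1} (Order.succ #L) := by
  rw [iff_lift_mk_le, Cardinal.lift_succ, Order.lt_succ_iff, Cardinal.lift_id'.{u, u+1}]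

theorem iff_lt_succ' {L : Type u} {α : Type u} {s : Set α} :
    Few L s ↔ #s < Order.succ #L := by
  rw [iff_lift_mk_le, Order.lt_succ_iff, Cardinal.lift_id, Cardinal.lift_id]

/-- A set injecting into `L` does not exhaust a type of larger size. -/
theorem exists_notMem {K : Type u} (hK : #L < #K) {s : Set K} (hs : Few L s) : ∃ k, k ∉ s := by
  by_contra! h
  have : s = Set.univ := eq_univ_of_forall h
  rw [iff_lift_mk_le, this] at hs
  simp at hs
  exact absurd hs (not_le.2 hK)

/-- A set injecting into `L` can be re-indexed injectively outside of another such set, in a type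
of larger size. -/
theorem exists_fresh [Infinite L] {K : Type u} (hK : #L < #K) {s : Set K} (hs : Few L s)
    {t : Set α} (ht : Few L t) : ∃ f : α → K, InjOn f t ∧ ∀ a, f a ∉ s := by
  -- A complement of smaller size would also inject into `L`, and `K` would be covered by two such
  -- sets.
  have h1 : #L ≤ #(sᶜ : Set K) := by
    by_contra! h
    have h2 : Few L sᶜ := by
      rw [iff_lift_mk_le]; simpa using h.le
    obtain ⟨k, hk⟩ := exists_notMem hK (hs.union h2)
    simp at hk
  obtain ⟨e⟩ := Cardinal.le_def _ _ |>.1 h1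
  obtain ⟨i⟩ := ht
  classical
  refine ⟨fun a => if h : a ∈ t then (e (i ⟨a, h⟩)).1 else (e (Classical.arbitrary L)).1, ?_, ?_⟩
  · intro a ha b hb hab
    simp only [ha, hb, dif_pos] at hab
    exact congrArg Subtype.val (i.injective (e.injective (Subtype.ext hab)))
  · intro a
    dsimp only
    split_ifs
    exacts [(e _).2, (e _).2]

end Few

/-- A family of at most `#L` sets, each of size at least `#L`, has an injective choice function. -/
theorem exists_injective_choice {L : Type u} [Infinite L] {J W : Type*}
    (hJ : Few L (Set.univ : Set J)) (A : J → Set W) (hA : ∀ j, Nonempty (L ↪ A j)) :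
    ∃ f : J → W, Function.Injective f ∧ ∀ j, f j ∈ A j := by
  classical
  obtain ⟨e⟩ := hJ
  -- Recursion along a well-order of the least possible type: fewer than `#L` values are taken
  -- before stage j, so `A j` is not exhausted.
  let o := (#L).ord.ToType
  have ho : #o = #L := Cardinal.mk_ord_toType _
  obtain ⟨eo⟩ := Cardinal.eq.1 ho
  let r : J → o := fun j => eo.symm (e ⟨j, mem_univ j⟩)
  have hr : Function.Injective r := fun a b h =>
    congrArg Subtype.val (e.injective (eo.symm.injective h))
  have wf : WellFounded fun a b : J => r a < r b := InvImage.wf r wellFounded_lt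
  have hne : ∀ j (ih : ∀ k, r k < r j → W), ∃ w ∈ A j, ∀ k hk, ih k hk ≠ w := by
    intro j ih
    by_contra! hcon
    obtain ⟨a⟩ := hA j
    choose g hg hgw using fun l : L => hcon (a l) (a l).2
    have hinj : Function.Injective g := fun l l' h => by
      have h1 := hgw l
      have h2 := hgw l'
      have : (a l).1 = (a l').1 := by
        rw [← h1, ← h2]
        congr 1
      exact a.injective (Subtype.ext this)
    have h1 : #L ≤ #(Iio (r j)) :=
      ⟨⟨fun l => ⟨r (g l), hg l⟩, fun l l' h => hinj (hr (congrArg Subtype.val h))⟩⟩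
    have h2 : #(Iio (r j)) < #o := Cardinal.mk_Iio_lt (r j) (by rw [ho]; simp [o])
    exact absurd (h2.trans_eq ho) (not_lt.2 h1)
  choose! w hwA hw using hne
  let F : J → W := wf.fix w
  have hF : ∀ j, F j = w j fun k _ => F k := fun j => wf.fix_eq w j
  refine ⟨F, fun a b hab => ?_, fun j => by rw [hF]; exact hwA _ _⟩
  rcases lt_trichotomy (r a) (r b) with h | h | h
  · have := hw b (fun k _ => F k) a h
    rw [← hF b] at this
    exact absurd hab this
  · exact hr h
  · have := hw a (fun k _ => F k) b h
    rw [← hF a] at this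
    exact absurd hab.symm this

/-! ### Sets of ordinals -/

theorem bddAbove_of_subset_Iio {x : Set Ordinal.{u}} {μ : Ordinal.{u}} (h : x ⊆ Iio μ) :
    BddAbove x := ⟨μ, fun _ hα => (h hα).le⟩

theorem lt_ssup_iff {x : Set Ordinal.{u}} (hx : BddAbove x) {α : Ordinal.{u}} :
    α < ssup x ↔ ∃ γ ∈ x, α ≤ γ := by
  have hb : BddAbove (Order.succ '' x) := by
    obtain ⟨b, hb⟩ := hx
    refine ⟨Order.succ b, ?_⟩
    rintro _ ⟨γ, hγ, rfl⟩
    exact Order.succ_le_succ (hb hγ)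
  constructor
  · intro h
    rcases x.eq_empty_or_nonempty with rfl | hne
    · simp [ssup] at h
    obtain ⟨_, ⟨γ, hγ, rfl⟩, h⟩ := exists_lt_of_lt_csSup (hne.image _) h
    exact ⟨γ, hγ, Order.lt_succ_iff.1 h⟩
  · rintro ⟨γ, hγ, h⟩
    exact (Order.lt_succ_iff.2 h).trans_le (le_csSup hb ⟨γ, hγ, rfl⟩)

theorem subset_Iio_ssup {x : Set Ordinal.{u}} (hx : BddAbove x) : x ⊆ Iio (ssup x) :=
  fun γ hγ => (lt_ssup_iff hx).2 ⟨γ, hγ, le_rfl⟩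

theorem ssup_empty : ssup (∅ : Set Ordinal.{u}) = 0 := by simp [ssup]

theorem sSup_inter_eq_iff {x : Set Ordinal.{u}} {α : Ordinal.{u}} (h0 : 0 < α) :
    sSup (x ∩ Iio α) = α ↔ ∀ β < α, ∃ γ ∈ x, β < γ ∧ γ < α := by
  have hb : BddAbove (x ∩ Iio α) := bddAbove_of_subset_Iio inter_subset_right
  constructor
  · intro h β hβ
    rcases (x ∩ Iio α).eq_empty_or_nonempty with he | hne
    · rw [he] at h
      simp at h
      exact absurd h0 (by simp [← h])
    obtain ⟨γ, hγ, hlt⟩ := exists_lt_of_lt_csSup hne (h.symm ▸ hβ)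
    exact ⟨γ, hγ.1, hlt, hγ.2⟩
  · intro h
    refine le_antisymm (csSup_le' fun γ hγ => hγ.2.le) (le_of_not_gt fun hlt => ?_)
    obtain ⟨γ, hγ, h1, h2⟩ := h _ hlt
    exact absurd (le_csSup hb ⟨hγ, h2⟩) (not_le.2 h1)

theorem mem_accPlus_iff {x : Set Ordinal.{u}} (hx : BddAbove x) {α : Ordinal.{u}} :
    α ∈ accPlus x ↔ 0 < α ∧ (∃ γ ∈ x, α ≤ γ) ∧ ∀ β < α, ∃ γ ∈ x, β < γ ∧ γ < α := by
  rw [accPlus, mem_ofPred_eq, lt_ssup_iff hx]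
  constructor
  · rintro ⟨h1, h2, h3⟩
    exact ⟨h3, h1, (sSup_inter_eq_iff h3).1 h2⟩
  · rintro ⟨h1, h2, h3⟩
    exact ⟨h2, (sSup_inter_eq_iff h1).2 h3, h1⟩

theorem closedInSup_iff {x : Set Ordinal.{u}} (hx : BddAbove x) :
    ClosedInSup x ↔ ∀ α, 0 < α → (∃ γ ∈ x, α ≤ γ) → (∀ β < α, ∃ γ ∈ x, β < γ ∧ γ < α) → α ∈ x := by
  constructor
  · intro h α h1 h2 h3
    exact h ((mem_accPlus_iff hx).2 ⟨h1, h2, h3⟩)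
  · intro h α hα
    obtain ⟨h1, h2, h3⟩ := (mem_accPlus_iff hx).1 hα
    exact h α h1 h2 h3

theorem subset_ordCl (x : Set Ordinal.{u}) : x ⊆ ordCl x := subset_union_left

theorem exists_ge_of_mem_ordCl {x : Set Ordinal.{u}} (hx : BddAbove x) {α : Ordinal.{u}}
    (h : α ∈ ordCl x) : ∃ γ ∈ x, α ≤ γ := by
  rcases h with h | h
  · exact ⟨α, h, le_rfl⟩
  · exact ((mem_accPlus_iff hx).1 h).2.1

theorem ordCl_subset_Iio {x : Set Ordinal.{u}} {μ : Ordinal.{u}} (h : x ⊆ Iio μ) :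
    ordCl x ⊆ Iio μ := fun _ hα =>
  have ⟨_, hγ, hle⟩ := exists_ge_of_mem_ordCl (bddAbove_of_subset_Iio h) hα
  lt_of_le_of_lt hle (h hγ)

theorem bddAbove_ordCl {x : Set Ordinal.{u}} (hx : BddAbove x) : BddAbove (ordCl x) := by
  obtain ⟨b, hb⟩ := hx
  exact bddAbove_of_subset_Iio (ordCl_subset_Iio (μ := Order.succ b)
    fun γ hγ => Order.lt_succ_iff.2 (hb hγ))

theorem exists_mem_of_lt_mem_ordCl {x : Set Ordinal.{u}} (hx : BddAbove x) {α β : Ordinal.{u}}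
    (h : α ∈ ordCl x) (hβ : β < α) : ∃ γ ∈ x, β < γ ∧ γ ≤ α := by
  rcases h with h | h
  · exact ⟨α, h, hβ, le_rfl⟩
  · obtain ⟨γ, h1, h2, h3⟩ := ((mem_accPlus_iff hx).1 h).2.2 β hβ
    exact ⟨γ, h1, h2, h3.le⟩

theorem closedInSup_ordCl {x : Set Ordinal.{u}} (hx : BddAbove x) : ClosedInSup (ordCl x) := by
  rw [closedInSup_iff (bddAbove_ordCl hx)]
  rintro α h1 ⟨γ, hγ, hle⟩ h3
  obtain ⟨γ', hγ', hle'⟩ := exists_ge_of_mem_ordCl hx hγ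
  refine Or.inr ((mem_accPlus_iff hx).2 ⟨h1, ⟨γ', hγ', hle.trans hle'⟩, fun β hβ => ?_⟩)
  obtain ⟨δ, hδ, h4, h5⟩ := h3 β hβ
  obtain ⟨ε, hε, h6, h7⟩ := exists_mem_of_lt_mem_ordCl hx hδ h4
  exact ⟨ε, hε, h6, h7.trans_lt h5⟩

theorem ClosedInSup.ordCl_eq {x : Set Ordinal.{u}} (h : ClosedInSup x) : ordCl x = x :=
  union_eq_left.2 h

theorem ClosedInSup.inter_Iio {x : Set Ordinal.{u}} (hx : BddAbove x) (h : ClosedInSup x)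
    (α : Ordinal.{u}) : ClosedInSup (x ∩ Iio α) := by
  rw [closedInSup_iff (hx.mono inter_subset_left)]
  rintro δ h1 ⟨γ, hγ, h2⟩ h3
  refine ⟨(closedInSup_iff hx).1 h δ h1 ⟨γ, hγ.1, h2⟩ fun β hβ => ?_, h2.trans_lt hγ.2⟩
  obtain ⟨ε, hε, h4⟩ := h3 β hβ
  exact ⟨ε, hε.1, h4⟩

theorem closedInSup_empty : ClosedInSup (∅ : Set Ordinal.{u}) := by
  rw [closedInSup_iff bddAbove_empty]; simp

theorem closedInSup_Iio (μ : Ordinal.{u}) : ClosedInSup (Iio μ) := by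
  rw [closedInSup_iff bddAbove_Iio]
  rintro α - ⟨γ, hγ, h⟩ -
  exact h.trans_lt hγ

/-- Sending an accumulation point to the least element of x at or above it is injective, because
between two accumulation points there is an element of x. -/
theorem Few.ordCl {L : Type u} [Infinite L] {x : Set Ordinal.{u}} (hx : BddAbove x)
    (h : Few L x) : Few L (ordCl x) := by
  refine h.union ?_
  have hne : ∀ α ∈ accPlus x, ∃ γ ∈ x, α ≤ γ ∧ ∀ δ ∈ x, α ≤ δ → γ ≤ δ := by
    intro α hα
    obtain ⟨-, ⟨γ, hγ, h2⟩, -⟩ := (mem_accPlus_iff hx).1 hα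
    refine ⟨sInf (x ∩ Ici α), ?_, ?_, ?_⟩
    · exact (csInf_mem (s := x ∩ Ici α) ⟨γ, hγ, h2⟩).1
    · exact (csInf_mem (s := x ∩ Ici α) ⟨γ, hγ, h2⟩).2
    · intro δ hδ h
      exact csInf_le' ⟨hδ, h⟩
  choose! g hg hle hmin using hne
  obtain ⟨e⟩ := h
  refine ⟨⟨fun α => e ⟨g α, hg α α.2⟩, fun a b hab => ?_⟩⟩
  have hab' : g a = g b := congrArg Subtype.val (e.injective hab)
  have key : ∀ a ∈ accPlus x, ∀ b ∈ accPlus x, g a = g b → a ≤ b := by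
    intro a ha b hb hgab
    by_contra! hlt
    obtain ⟨γ, hγ, h1, h2⟩ := ((mem_accPlus_iff hx).1 ha).2.2 b hlt
    have h3 := hmin b hb γ hγ h1.le
    have h4 := hle a ha
    rw [hgab] at h4
    exact absurd (h4.trans h3) (not_le.2 h2)
  exact Subtype.ext (le_antisymm (key _ a.2 _ b.2 hab') (key _ b.2 _ a.2 hab'.symm))

/-- Let α be an accumulation point of the image and let δ be the supremum of the points of z that
are mapped below α. Closedness puts δ into z, and continuity at δ forces π δ = α. -/
theorem IsCoi.closedInSup_image {μ : Ordinal.{u}} {y : Set Ordinal.{u}}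
    {π : Ordinal.{u} → Ordinal.{u}} (h : IsCoi μ y π) {z : Set Ordinal.{u}} (hz : z ⊆ y)
    (hc : ClosedInSup z) : ClosedInSup (π '' z) := by
  have hbz : BddAbove z := bddAbove_of_subset_Iio (hz.trans h.subset)
  have hb : BddAbove (π '' z) :=
    bddAbove_of_subset_Iio (μ := μ) (image_subset_iff.2 fun γ hγ => h.mapsTo (hz hγ))
  have hlt : ∀ {a b}, a ∈ z → b ∈ z → (π a < π b ↔ a < b) := fun ha hb =>
    h.strictMonoOn.lt_iff_lt (hz ha) (hz hb)
  rw [closedInSup_iff hb]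
  rintro α h1 ⟨_, ⟨γ₁, hγ₁, rfl⟩, h2⟩ h3
  set B : Set Ordinal.{u} := {γ ∈ z | π γ < α} with hB
  have hBlt : ∀ b ∈ B, b < γ₁ := fun b hb => (hlt hb.1 hγ₁).1 (hb.2.trans_le h2)
  have hBb : BddAbove B := ⟨γ₁, fun b hb => (hBlt b hb).le⟩
  have hnomax : ∀ b ∈ B, ∃ c ∈ B, b < c := by
    intro b hb
    obtain ⟨_, ⟨c, hc, rfl⟩, h4, h5⟩ := h3 _ hb.2
    exact ⟨c, ⟨hc, h5⟩, (hlt hb.1 hc).1 h4⟩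
  obtain ⟨_, ⟨b₀, hb₀, rfl⟩, -, hb₀'⟩ := h3 0 h1
  have hBne : B.Nonempty := ⟨b₀, hb₀, hb₀'⟩
  set δ := sSup B with hδ
  have hltδ : ∀ b ∈ B, b < δ := fun b hb => by
    obtain ⟨c, hc, hbc⟩ := hnomax b hb
    exact hbc.trans_le (le_csSup hBb hc)
  have hex : ∀ β < δ, ∃ γ ∈ B, β < γ := fun β hβ => exists_lt_of_lt_csSup hBne hβ
  have hδ0 : 0 < δ := zero_le.trans_lt (hltδ _ hBne.choose_spec)
  have hδz : δ ∈ z := by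
    refine (closedInSup_iff hbz).1 hc δ hδ0 ⟨γ₁, hγ₁, csSup_le' fun b hb => (hBlt b hb).le⟩ ?_
    intro β hβ
    obtain ⟨γ, hγ, h4⟩ := hex β hβ
    exact ⟨γ, hγ.1, h4, hltδ γ hγ⟩
  have hcont := h.continuous δ (hz hδz) hδ0 ((sSup_inter_eq_iff hδ0).2 fun β hβ => by
    obtain ⟨γ, hγ, h4⟩ := hex β hβ
    exact ⟨γ, hz hγ.1, h4, hltδ γ hγ⟩)
  refine ⟨δ, hδz, le_antisymm ?_ (le_of_not_gt fun hlt' => ?_)⟩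
  · rw [hcont]
    refine csSup_le' ?_
    rintro _ ⟨γ, ⟨hγ, hγδ⟩, rfl⟩
    obtain ⟨b, hb, h4⟩ := hex γ hγδ
    exact ((h.strictMonoOn.lt_iff_lt hγ (hz hb.1)).2 h4).le.trans hb.2.le
  · exact absurd (hltδ δ ⟨hδz, hlt'⟩) (lt_irrefl _)

theorem isCoi_id (μ : Ordinal.{u}) : IsCoi μ (Iio μ) id where
  subset := subset_rfl
  closed := closedInSup_Iio μ
  mapsTo := fun _ h => h
  strictMonoOn := strictMonoOn_id
  continuous := fun δ hδ _ h => by simpa using h.symm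

/-! ### Preconditions -/

/-- A precondition: a set of ordinals together with a set of facts. A fact is a datum attached to a
pair of ordinals. -/
@[ext]
structure Pre (D : Type u) where
  /-- The realm. -/
  dom : Set Ordinal.{u}
  /-- The facts. -/
  facts : Set (Ordinal.{u} × Ordinal.{u} × D)

namespace Pre

variable {L D : Type u} {p q r s t : Pre D} {α β : Ordinal.{u}} {π π' : Ordinal.{u} → Ordinal.{u}}

instance : PartialOrder (Pre D) where
  le q p := p.dom ⊆ q.dom ∧ p.facts ⊆ q.facts
  le_refl _ := ⟨subset_rfl, subset_rfl⟩
  le_trans _ _ _ h h' := ⟨h'.1.trans h.1, h'.2.trans h.2⟩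
  le_antisymm _ _ h h' := Pre.ext (h'.1.antisymm h.1) (h'.2.antisymm h.2)

instance : Nonempty (Pre D) := ⟨⟨∅, ∅⟩⟩

theorem le_def : q ≤ p ↔ p.dom ⊆ q.dom ∧ p.facts ⊆ q.facts := Iff.rfl

/-- The part of `p` below `α`. -/
def cut (p : Pre D) (α : Ordinal.{u}) : Pre D := ⟨p.dom ∩ Iio α, {f | f ∈ p.facts ∧ f.2.1 < α}⟩

/-- The image of a fact under a function on ordinals. -/
def moveFact (π : Ordinal.{u} → Ordinal.{u}) (f : Ordinal.{u} × Ordinal.{u} × D) :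
    Ordinal.{u} × Ordinal.{u} × D := (π f.1, π f.2.1, f.2.2)

/-- The image of `p` under a function on ordinals. -/
def move (π : Ordinal.{u} → Ordinal.{u}) (p : Pre D) : Pre D := ⟨π '' p.dom, moveFact π '' p.facts⟩

/-- The union of a set of preconditions. -/
def sup (S : Set (Pre D)) : Pre D := ⟨⋃ p ∈ S, p.dom, ⋃ p ∈ S, p.facts⟩

/-- The union of two preconditions. -/
def union (p q : Pre D) : Pre D := ⟨p.dom ∪ q.dom, p.facts ∪ q.facts⟩

/-- Well-formed preconditions: few facts, each attached to ordinals `α ≤ β` of the realm. -/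
structure Wf (L : Type u) (p : Pre D) : Prop where
  dom_few : Few L p.dom
  dom_lt : p.dom ⊆ Iio (succOrd (Order.succ #L))
  facts_few : Few L p.facts
  fst_le : ∀ f ∈ p.facts, f.1 ≤ f.2.1
  fst_mem : ∀ f ∈ p.facts, f.1 ∈ p.dom
  snd_mem : ∀ f ∈ p.facts, f.2.1 ∈ p.dom

theorem Wf.bdd (h : p.Wf L) : BddAbove p.dom := bddAbove_of_subset_Iio h.dom_lt

theorem cut_dom : (p.cut α).dom = p.dom ∩ Iio α := rfl

theorem mem_cut_facts {f} : f ∈ (p.cut α).facts ↔ f ∈ p.facts ∧ f.2.1 < α := Iff.rfl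

theorem mem_sup_dom {S : Set (Pre D)} : α ∈ (sup S).dom ↔ ∃ p ∈ S, α ∈ p.dom := by
  simp [sup]

theorem mem_sup_facts {S : Set (Pre D)} {f} : f ∈ (sup S).facts ↔ ∃ p ∈ S, f ∈ p.facts := by
  simp [sup]

theorem sup_le {S : Set (Pre D)} (h : p ∈ S) : sup S ≤ p :=
  ⟨fun _ hα => mem_sup_dom.2 ⟨p, h, hα⟩, fun _ hf => mem_sup_facts.2 ⟨p, h, hf⟩⟩

theorem le_cut : p ≤ p.cut α := ⟨inter_subset_left, fun _ h => h.1⟩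

theorem cut_mono (h : q ≤ p) : q.cut α ≤ p.cut α :=
  ⟨inter_subset_inter_left _ h.1, fun _ hf => ⟨h.2 hf.1, hf.2⟩⟩

theorem move_mono (h : q ≤ p) : q.move π ≤ p.move π := ⟨image_mono h.1, image_mono h.2⟩

theorem cut_cut : (p.cut α).cut β = p.cut (min α β) := by
  ext a
  · simp [cut, and_assoc]
  · simp only [mem_cut_facts, lt_min_iff, and_assoc]

theorem cut_eq_self (hp : p.Wf L) (h : p.dom ⊆ Iio α) : p.cut α = p := by
  ext a
  · exact ⟨fun h => h.1, fun ha => ⟨ha, h ha⟩⟩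
  · exact ⟨fun h => h.1, fun ha => ⟨ha, h (hp.snd_mem _ ha)⟩⟩

theorem move_move : (p.move π).move π' = p.move (π' ∘ π) :=
  Pre.ext (image_image _ _ _) (image_image _ _ _)

theorem move_congr (hp : p.Wf L) (h : EqOn π π' p.dom) : p.move π = p.move π' := by
  have hf : ∀ f ∈ p.facts, moveFact π f = moveFact π' f := fun f hf => by
    simp [moveFact, h (hp.fst_mem f hf), h (hp.snd_mem f hf)]
  exact Pre.ext (image_congr h) (image_congr hf)

theorem move_id (hp : p.Wf L) (h : ∀ α ∈ p.dom, π α = α) : p.move π = p := by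
  rw [move_congr (π' := id) hp h]
  ext a
  · simp [move]
  · simp [move, moveFact]

theorem Wf.cut (hp : p.Wf L) (α : Ordinal.{u}) : (p.cut α).Wf L where
  dom_few := hp.dom_few.mono inter_subset_left
  dom_lt := inter_subset_left.trans hp.dom_lt
  facts_few := hp.facts_few.mono fun _ h => h.1
  fst_le f hf := hp.fst_le f hf.1
  fst_mem f hf := ⟨hp.fst_mem f hf.1, (hp.fst_le f hf.1).trans_lt hf.2⟩
  snd_mem f hf := ⟨hp.snd_mem f hf.1, hf.2⟩

theorem Wf.move (hp : p.Wf L) (hπ : StrictMonoOn π p.dom)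
    (hm : MapsTo π p.dom (Iio (succOrd (Order.succ #L)))) : (p.move π).Wf L where
  dom_few := hp.dom_few.image _
  dom_lt := hm.image_subset
  facts_few := hp.facts_few.image _
  fst_le := by
    rintro _ ⟨f, hf, rfl⟩
    exact hπ.monotoneOn (hp.fst_mem f hf) (hp.snd_mem f hf) (hp.fst_le f hf)
  fst_mem := by
    rintro _ ⟨f, hf, rfl⟩
    exact ⟨_, hp.fst_mem f hf, rfl⟩
  snd_mem := by
    rintro _ ⟨f, hf, rfl⟩
    exact ⟨_, hp.snd_mem f hf, rfl⟩

theorem Wf.sup [Infinite L] {S : Set (Pre D)} (hS : Few L S) (h : ∀ p ∈ S, p.Wf L) :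
    (sup S).Wf L where
  dom_few := hS.biUnion fun p hp => (h p hp).dom_few
  dom_lt := iUnion₂_subset fun p hp => (h p hp).dom_lt
  facts_few := hS.biUnion fun p hp => (h p hp).facts_few
  fst_le f hf := by
    obtain ⟨p, hp, hf⟩ := mem_sup_facts.1 hf
    exact (h p hp).fst_le f hf
  fst_mem f hf := by
    obtain ⟨p, hp, hf⟩ := mem_sup_facts.1 hf
    exact mem_sup_dom.2 ⟨p, hp, (h p hp).fst_mem f hf⟩
  snd_mem f hf := by
    obtain ⟨p, hp, hf⟩ := mem_sup_facts.1 hf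
    exact mem_sup_dom.2 ⟨p, hp, (h p hp).snd_mem f hf⟩

theorem Wf.union [Infinite L] (hp : p.Wf L) (hq : q.Wf L) : (p.union q).Wf L where
  dom_few := hp.dom_few.union hq.dom_few
  dom_lt := union_subset hp.dom_lt hq.dom_lt
  facts_few := hp.facts_few.union hq.facts_few
  fst_le f hf := hf.elim (hp.fst_le f) (hq.fst_le f)
  fst_mem f hf := hf.imp (hp.fst_mem f) (hq.fst_mem f)
  snd_mem f hf := hf.imp (hp.snd_mem f) (hq.snd_mem f)

/-- Cutting an image amounts to cutting the original at the strict supremum of the points mapped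
below β. This lets cuts be moved inside actions. -/
theorem exists_cut_move (hp : p.Wf L) (hπ : StrictMonoOn π p.dom) (β : Ordinal.{u}) :
    ∃ β', (∀ γ ∈ p.dom, π γ < β ↔ γ < β') ∧ (p.move π).cut β = (p.cut β').move π := by
  have hb : BddAbove {γ | γ ∈ p.dom ∧ π γ < β} := hp.bdd.mono fun _ h => h.1
  have h : ∀ γ ∈ p.dom, π γ < β ↔ γ < ssup {γ | γ ∈ p.dom ∧ π γ < β} := by
    intro γ hγ
    rw [lt_ssup_iff hb]
    exact ⟨fun h => ⟨γ, ⟨hγ, h⟩, le_rfl⟩,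
      fun ⟨δ, hδ, hle⟩ => (hπ.monotoneOn hγ hδ.1 hle).trans_lt hδ.2⟩
  refine ⟨_, h, Pre.ext ?_ ?_⟩
  · ext a
    constructor
    · rintro ⟨⟨γ, hγ, rfl⟩, hlt⟩
      exact ⟨γ, ⟨hγ, (h γ hγ).1 hlt⟩, rfl⟩
    · rintro ⟨γ, ⟨hγ, hlt⟩, rfl⟩
      exact ⟨⟨γ, hγ, rfl⟩, (h γ hγ).2 hlt⟩
  · ext a
    constructor
    · rintro ⟨⟨f, hf, rfl⟩, hlt⟩
      exact ⟨f, ⟨hf, (h _ (hp.snd_mem f hf)).1 hlt⟩, rfl⟩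
    · rintro ⟨f, ⟨hf, hlt⟩, rfl⟩
      exact ⟨⟨f, hf, rfl⟩, (h _ (hp.snd_mem f hf)).2 hlt⟩

theorem move_le_move_iff {y : Set Ordinal.{u}} (hp : p.Wf L) (hq : q.Wf L) (hπ : InjOn π y)
    (hpy : p.dom ⊆ y) (hqy : q.dom ⊆ y) : q.move π ≤ p.move π ↔ q ≤ p := by
  refine ⟨fun h => ⟨?_, ?_⟩, move_mono⟩
  · intro a ha
    obtain ⟨b, hb, hab⟩ := h.1 ⟨a, ha, rfl⟩
    rwa [← hπ (hqy hb) (hpy ha) hab]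
  · intro f hf
    obtain ⟨g, hg, hfg⟩ := h.2 ⟨f, hf, rfl⟩
    simp only [moveFact, Prod.mk.injEq] at hfg
    have h1 := hπ (hqy (hq.fst_mem g hg)) (hpy (hp.fst_mem f hf)) hfg.1
    have h2 := hπ (hqy (hq.snd_mem g hg)) (hpy (hp.snd_mem f hf)) hfg.2.1
    have : g = f := Prod.ext h1 (Prod.ext h2 hfg.2.2)
    rwa [← this]

end Pre

/-! ### Good maps and abstract classes of complete preconditions -/

/-- Functions that are strictly increasing on `x`, with values below `(#L)⁺⁺`, and that map closed
sets to closed sets. -/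
structure GoodMap (L : Type u) (x : Set Ordinal.{u}) (π : Ordinal.{u} → Ordinal.{u}) : Prop where
  strictMonoOn : StrictMonoOn π x
  mapsTo : MapsTo π x (Iio (succOrd (Order.succ #L)))
  closed : ∀ z ⊆ x, ClosedInSup z → ClosedInSup (π '' z)

theorem GoodMap.mono {L : Type u} {x y : Set Ordinal.{u}} {π : Ordinal.{u} → Ordinal.{u}}
    (h : GoodMap L y π) (hxy : x ⊆ y) : GoodMap L x π :=
  ⟨h.strictMonoOn.mono hxy, h.mapsTo.mono_left hxy, fun z hz => h.closed z (hz.trans hxy)⟩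

/-- This is the form in which continuity enters completions: unlike being a coi, it passes to
arbitrary subsets, hence to realms that are not closed. -/
theorem IsCoi.goodMap {L : Type u} {y : Set Ordinal.{u}} {π : Ordinal.{u} → Ordinal.{u}}
    (h : IsCoi (succOrd (Order.succ #L)) y π) : GoodMap L y π :=
  ⟨h.strictMonoOn, h.mapsTo, fun _ hz hc => h.closedInSup_image hz hc⟩

theorem GoodMap.comp {L : Type u} {x y : Set Ordinal.{u}} {π π' : Ordinal.{u} → Ordinal.{u}}
    (h : GoodMap L x π) (h' : GoodMap L y π') (hm : MapsTo π x y) : GoodMap L x (π' ∘ π) where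
  strictMonoOn := h'.strictMonoOn.comp h.strictMonoOn hm
  mapsTo := h'.mapsTo.comp hm
  closed z hz hc := by
    rw [image_comp]
    exact h'.closed _ (image_subset_iff.2 fun a ha => hm (hz ha)) (h.closed z hz hc)

/-- A class of complete preconditions from which a forcing notion can be built. -/
structure FullClass (L D : Type u) where
  /-- The complete preconditions. -/
  Full : Pre D → Prop
  wf : ∀ {p}, Full p → p.Wf L
  trivial : Full ⟨∅, ∅⟩
  cut : ∀ {p}, Full p → ∀ α, Full (p.cut α)
  move : ∀ {p}, Full p → ∀ π : Ordinal.{u} → Ordinal.{u}, StrictMonoOn π p.dom →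
    MapsTo π p.dom (Iio (succOrd (Order.succ #L))) → Full (p.move π)
  sup : ∀ S : Set (Pre D), S.Nonempty → Few L S → IsChain (· ≤ ·) S → (∀ p ∈ S, Full p) →
    Full (Pre.sup S)
  extend : ∀ {p}, Full p → ∀ x : Set Ordinal.{u}, p.dom ⊆ x → Few L x →
    x ⊆ Iio (succOrd (Order.succ #L)) → ∃ s, Full s ∧ s ≤ p ∧ s.dom = x ∧
      ∀ α, x ∩ Iio α ⊆ p.dom → s.cut α = p.cut α
  amalg : ∀ {p q}, Full p → ClosedInSup p.dom → Full q → ∀ α, q ≤ p.cut α → q.dom ⊆ Iio α →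
    ∃ s, Full s ∧ s ≤ p ∧ s ≤ q ∧ s.dom = p.dom ∪ q.dom
  splice : ∀ {u r}, Full u → Full r → ∀ α, r.dom ⊆ Iio α → r ≤ u.cut α →
    (∀ γ ∈ r.dom, ∃ δ ∈ u.dom, γ ≤ δ ∧ δ < α) →
    ∃ s, Full s ∧ s ≤ u ∧ s.dom = u.dom ∪ r.dom ∧ s.cut α = r

/-! ### Conditions and their closure properties -/

namespace FullClass

variable {L D : Type u} (C : FullClass L D) {p q r s t : Pre D} {α β : Ordinal.{u}}
  {π π' : Ordinal.{u} → Ordinal.{u}}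

/-- The conditions: preconditions that can be completed in every possible way, together with any
complete condition extending an initial part of them, without adding ordinals to the realm. -/
structure Cond (p : Pre D) : Prop where
  wf : p.Wf L
  ext : ∀ β π, GoodMap L (p.dom ∩ Iio β) π → ∀ α s, C.Full s → s.dom ⊆ Iio α →
    s ≤ ((p.cut β).move π).cut α →
    ∃ t, C.Full t ∧ t ≤ (p.cut β).move π ∧ t ≤ s ∧ t.dom = π '' (p.dom ∩ Iio β) ∪ s.dom

/-- Amalgamation requires a closed realm, and closedness survives cuts and good maps. -/
theorem cond_of_full (hp : C.Full p) (hc : ClosedInSup p.dom) : C.Cond p where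
  wf := C.wf hp
  ext β π hπ α s hs hsα hle := by
    obtain ⟨t, ht, h1, h2, h3⟩ := C.amalg
      (C.move (C.cut hp β) π hπ.strictMonoOn hπ.mapsTo)
      (hπ.closed _ subset_rfl (hc.inter_Iio (C.wf hp).bdd β)) hs α hle hsα
    exact ⟨t, ht, h1, h2, h3⟩

variable {C}

/-- The quantifier over β in the definition of `Cond` serves this purpose, as the one over π serves
the closure under actions. -/
theorem Cond.cut (hp : C.Cond p) (γ : Ordinal.{u}) : C.Cond (p.cut γ) where
  wf := hp.wf.cut γ
  ext β π hπ α s hs hsα hle := by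
    have : (p.cut γ).dom ∩ Iio β = p.dom ∩ Iio (min γ β) := by
      ext; simp [Pre.cut, and_assoc]
    rw [this] at hπ ⊢
    rw [Pre.cut_cut] at hle ⊢
    exact hp.ext _ π hπ α s hs hsα hle

theorem Cond.move {y : Set Ordinal.{u}} (hp : C.Cond p)
    (hπ : IsCoi (succOrd (Order.succ #L)) y π) (hy : p.dom ⊆ y) : C.Cond (p.move π) where
  wf := hp.wf.move (hπ.strictMonoOn.mono hy) (hπ.mapsTo.mono_left hy)
  ext β π' hπ' α s hs hsα hle := by
    obtain ⟨β', h1, h2⟩ := Pre.exists_cut_move hp.wf (hπ.strictMonoOn.mono hy) β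
    have h3 : (p.move π).dom ∩ Iio β = π '' (p.dom ∩ Iio β') := congrArg Pre.dom h2
    rw [h3] at hπ' ⊢
    rw [h2, Pre.move_move] at hle ⊢
    have := hp.ext β' (π' ∘ π)
      ((hπ.goodMap.mono (inter_subset_left.trans hy)).comp hπ' (mapsTo_image _ _)) α s hs hsα hle
    rwa [image_comp] at this

/-- The instance of the definition with the identity, a cut that removes nothing, and the empty
complete precondition below 0. -/
theorem Cond.exists_full (hp : C.Cond p) : ∃ t, C.Full t ∧ t ≤ p ∧ t.dom = p.dom := by
  have h1 : p.dom ∩ Iio (succOrd (Order.succ #L)) = p.dom := inter_eq_left.2 hp.wf.dom_lt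
  have h2 : p.cut (succOrd (Order.succ #L)) = p := Pre.cut_eq_self hp.wf hp.wf.dom_lt
  have := hp.ext (succOrd (Order.succ #L)) id
    ((isCoi_id _).goodMap.mono inter_subset_right) 0 ⟨∅, ∅⟩ C.trivial
    (empty_subset _) ⟨by simp [Pre.cut], by simp [Pre.cut]⟩
  rw [h1, h2, Pre.move_id (π := id) hp.wf fun _ _ => rfl] at this
  obtain ⟨t, h3, h4, -, h5⟩ := this
  exact ⟨t, h3, h4, by simpa using h5⟩

/-- Complete over the old realm first; the remaining ordinals are then added by `C.extend`. -/
theorem Cond.extend [Infinite L] (hp : C.Cond p) {x : Set Ordinal.{u}} (hx : p.dom ⊆ x)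
    (hf : Few L x) (hlt : x ⊆ Iio (succOrd (Order.succ #L))) : C.Cond ⟨x, p.facts⟩ where
  wf := ⟨hf, hlt, hp.wf.facts_few, hp.wf.fst_le, fun f h => hx (hp.wf.fst_mem f h),
    fun f h => hx (hp.wf.snd_mem f h)⟩
  ext β π hπ α s hs hsα hle := by
    have hle' : Pre.move π (Pre.cut ⟨x, p.facts⟩ β) ≤ (p.cut β).move π :=
      Pre.move_mono (Pre.cut_mono ⟨hx, subset_rfl⟩)
    obtain ⟨t, h1, h2, h3, h4⟩ := hp.ext β π (hπ.mono (inter_subset_inter_left _ hx)) α s hs hsα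
      (hle.trans (Pre.cut_mono hle'))
    have h5 : t.dom ⊆ π '' (x ∩ Iio β) ∪ s.dom := by
      rw [h4]; exact union_subset_union_left _ (image_mono (inter_subset_inter_left _ hx))
    obtain ⟨t', h6, h7, h8, -⟩ := C.extend h1 (π '' (x ∩ Iio β) ∪ s.dom) h5
      (((hf.mono inter_subset_left).image _).union (C.wf hs).dom_few)
      (union_subset hπ.mapsTo.image_subset (C.wf hs).dom_lt)
    refine ⟨t', h6, ⟨?_, (h2.2).trans h7.2⟩, h7.trans h3, h8⟩
    rw [h8]
    exact subset_union_left

/-- This is the amalgamation axiom: the union of the facts is a condition although q need not be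
complete. -/
theorem Cond.union [Infinite L] (hp : C.Full p) (hc : ClosedInSup p.dom) (hq : C.Cond q)
    (hle : q ≤ p.cut α) (hqα : q.dom ⊆ Iio α) : C.Cond (q.union p) where
  wf := hq.wf.union (C.wf hp)
  ext β π hπ α₁ s hs hsα hsle := by
    have hpw := C.wf hp
    -- If the cut keeps nothing of p at or above α, then it only sees q.
    by_cases hβ : ∃ γ, γ ∈ p.dom ∧ α ≤ γ ∧ γ < β
    swap
    · push Not at hβ
      have hlt : ∀ γ ∈ p.dom, γ < β → γ < α := fun γ h h' => by
        by_contra! h''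
        exact absurd h' (not_lt.2 (hβ γ h h''))
      have : (q.union p).cut β = q.cut β := by
        ext a
        · constructor
          · rintro ⟨h | h, h'⟩
            exacts [⟨h, h'⟩, ⟨hle.1 ⟨h, hlt a h h'⟩, h'⟩]
          · exact fun h => ⟨Or.inl h.1, h.2⟩
        · constructor
          · rintro ⟨h | h, h'⟩
            exacts [⟨h, h'⟩, ⟨hle.2 ⟨h, hlt _ (hpw.snd_mem _ h) h'⟩, h'⟩]
          · exact fun h => ⟨Or.inl h.1, h.2⟩
      have hd : (q.union p).dom ∩ Iio β = q.dom ∩ Iio β := congrArg Pre.dom this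
      rw [hd] at hπ ⊢
      rw [this] at hsle ⊢
      exact hq.ext β π hπ α₁ s hs hsα hsle
    -- The least ordinal of p at or above α; all of q lies below it, and so does the part of p that
    -- q extends.
    obtain ⟨β₀, ⟨hβ₀, hβ₀α, hβ₀β⟩, hmin⟩ : ∃ β₀, (β₀ ∈ p.dom ∧ α ≤ β₀ ∧ β₀ < β) ∧
        ∀ γ ∈ p.dom, α ≤ γ → β₀ ≤ γ := by
      obtain ⟨γ, hγ⟩ := hβ
      have h := csInf_mem (s := {γ | γ ∈ p.dom ∧ α ≤ γ}) ⟨γ, hγ.1, hγ.2.1⟩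
      have h' : ∀ γ ∈ p.dom, α ≤ γ → sInf {γ | γ ∈ p.dom ∧ α ≤ γ} ≤ γ :=
        fun γ h1 h2 => csInf_le' ⟨h1, h2⟩
      exact ⟨_, ⟨h.1, h.2, (h' γ hγ.1 hγ.2.1).trans_lt hγ.2.2⟩, h'⟩
    have hqβ : ∀ γ ∈ q.dom, γ < β := fun γ hγ => (lt_of_lt_of_le (hqα hγ) hβ₀α).trans hβ₀β
    have hqc : q.cut β = q := Pre.cut_eq_self hq.wf hqβ
    have hqd : q.dom ∩ Iio β = q.dom := inter_eq_left.2 hqβ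
    have hπp : GoodMap L (p.dom ∩ Iio β) π :=
      hπ.mono (inter_subset_inter_left _ subset_union_right)
    have hπq : GoodMap L (q.dom ∩ Iio β) π :=
      hπ.mono (inter_subset_inter_left _ subset_union_left)
    have hp' : C.Full ((p.cut β).move π) := C.move (C.cut hp β) π hπp.strictMonoOn hπp.mapsTo
    have hc' : ClosedInSup ((p.cut β).move π).dom :=
      hπp.closed _ subset_rfl (hc.inter_Iio (C.wf hp).bdd β)
    have hmβ₀ : β₀ ∈ (q.union p).dom ∩ Iio β := ⟨Or.inr hβ₀, hβ₀β⟩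
    have hdom : π '' ((q.union p).dom ∩ Iio β) = π '' q.dom ∪ π '' (p.dom ∩ Iio β) := by
      rw [← image_union, show (q.union p).dom = q.dom ∪ p.dom from rfl, union_inter_distrib_right,
        hqd]
    have hql : ∀ γ ∈ q.dom, π γ < π β₀ := fun γ hγ =>
      hπ.strictMonoOn ⟨Or.inl hγ, hqβ γ hγ⟩ hmβ₀ (lt_of_lt_of_le (hqα hγ) hβ₀α)
    -- If s ends below the image of β₀, complete q over s and put p on top of the result. Otherwise
    -- s already contains the whole image of q, and p is amalgamated with s directly.
    rcases le_or_gt α₁ (π β₀) with hα | hα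
    · obtain ⟨t, h1, h2, h3, h4⟩ := hq.ext β π hπq α₁ s hs hsα
        (hsle.trans (Pre.cut_mono (Pre.move_mono (Pre.cut_mono
          ⟨subset_union_left, subset_union_left⟩))))
      rw [hqc] at h2
      rw [hqd] at h4
      have hpl : ∀ γ ∈ p.dom, γ < β → π γ < π β₀ → γ < α := fun γ h h' h'' => by
        by_contra! hcon
        exact absurd h'' (not_lt.2 (hπ.strictMonoOn.monotoneOn hmβ₀ ⟨Or.inr h, h'⟩
          (hmin γ h hcon)))
      obtain ⟨t', h5, h6, h7, h8⟩ := C.amalg hp' hc' h1 (π β₀) (by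
        refine h2.trans ⟨?_, ?_⟩
        · rintro _ ⟨⟨γ, ⟨hγ, hγβ⟩, rfl⟩, hlt⟩
          exact ⟨γ, hle.1 ⟨hγ, hpl γ hγ hγβ hlt⟩, rfl⟩
        · rintro _ ⟨⟨f, ⟨hf, hfβ⟩, rfl⟩, hlt⟩
          exact ⟨f, hle.2 ⟨hf, hpl _ (hpw.snd_mem f hf) hfβ hlt⟩, rfl⟩) (by
        rw [h4]
        rintro _ (⟨γ, hγ, rfl⟩ | h)
        exacts [hql γ hγ, lt_of_lt_of_le (hsα h) hα])
      refine ⟨t', h5, ⟨?_, ?_⟩, h7.trans h3, ?_⟩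
      · rintro _ ⟨γ, ⟨hγ | hγ, hγβ⟩, rfl⟩
        · exact (h7.trans h2).1 ⟨γ, hγ, rfl⟩
        · exact h6.1 ⟨γ, ⟨hγ, hγβ⟩, rfl⟩
      · rintro _ ⟨f, ⟨hf | hf, hfβ⟩, rfl⟩
        · exact (h7.trans h2).2 ⟨f, hf, rfl⟩
        · exact h6.2 ⟨f, ⟨hf, hfβ⟩, rfl⟩
      · rw [h8, h4, hdom, ← union_assoc, union_comm _ (π '' q.dom)]; rfl
    · obtain ⟨t, h1, h2, h3, h4⟩ := C.amalg hp' hc' hs α₁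
        (hsle.trans (Pre.cut_mono (Pre.move_mono (Pre.cut_mono
          ⟨subset_union_right, subset_union_right⟩)))) hsα
      have hq1 : ∀ γ ∈ q.dom, π γ ∈ s.dom := fun γ hγ =>
        hsle.1 ⟨⟨γ, ⟨Or.inl hγ, hqβ γ hγ⟩, rfl⟩, (hql γ hγ).trans hα⟩
      refine ⟨t, h1, ⟨?_, ?_⟩, h3, ?_⟩
      · rintro _ ⟨γ, ⟨hγ | hγ, hγβ⟩, rfl⟩
        · exact h3.1 (hq1 γ hγ)
        · exact h2.1 ⟨γ, ⟨hγ, hγβ⟩, rfl⟩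
      · rintro _ ⟨f, ⟨hf | hf, hfβ⟩, rfl⟩
        · exact h3.2 (hsle.2 ⟨⟨f, ⟨Or.inl hf, hfβ⟩, rfl⟩,
            (hql _ (hq.wf.snd_mem f hf)).trans hα⟩)
        · exact h2.2 ⟨f, ⟨hf, hfβ⟩, rfl⟩
      · rw [h4, hdom]
        refine Subset.antisymm (union_subset_union_left _ subset_union_right) ?_
        rintro _ ((⟨γ, hγ, rfl⟩ | h) | h)
        exacts [Or.inr (hq1 γ hγ), Or.inl h, Or.inr h]

/-- The coherent sequence of completions used to bound a vertical sequence. -/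
theorem Cond.sup_vertical [Infinite L] {ξ : Ordinal.{u}} (hξ : Few L (Iio ξ))
    (p : Ordinal.{u} → Pre D) (hp : ∀ η < ξ, C.Cond (p η))
    (hcoh : ∀ η η', η < η' → η' < ξ → p η = (p η').cut (ssup (p η).dom)) :
    C.Cond (Pre.sup (p '' Iio ξ)) := by
  have hwf : (Pre.sup (p '' Iio ξ)).Wf L :=
    Pre.Wf.sup (hξ.image p) (by rintro _ ⟨η, hη, rfl⟩; exact (hp η hη).wf)
  have hdom : ∀ {a}, a ∈ (Pre.sup (p '' Iio ξ)).dom ↔ ∃ η < ξ, a ∈ (p η).dom := fun {a} => by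
    rw [Pre.mem_sup_dom, exists_mem_image]; rfl
  have hfacts : ∀ {a}, a ∈ (Pre.sup (p '' Iio ξ)).facts ↔ ∃ η < ξ, a ∈ (p η).facts := fun {a} => by
    rw [Pre.mem_sup_facts, exists_mem_image]; rfl
  have hanti : ∀ η η', η ≤ η' → η' < ξ → p η' ≤ p η := by
    intro η η' h h'
    rcases h.eq_or_lt with rfl | h
    · exact le_rfl
    · rw [hcoh η η' h h']; exact Pre.le_cut
  refine ⟨hwf, fun β π hπ α s hs hsα hsle => ?_⟩
  -- Either the cut is a cut of a single p η, or nothing is cut off and a completion is built in ξ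
  -- steps.
  by_cases hβ : ∃ η < ξ, β ≤ ssup (p η).dom
  · obtain ⟨η, hη, hβ⟩ := hβ
    have hcut : (Pre.sup (p '' Iio ξ)).cut β = (p η).cut β := by
      refine le_antisymm (Pre.cut_mono (Pre.sup_le ⟨η, hη, rfl⟩)) ⟨?_, ?_⟩
      · rintro a ⟨ha, haβ⟩
        obtain ⟨i, hi, ha⟩ := hdom.1 ha
        refine ⟨?_, haβ⟩
        rcases le_or_gt i η with h | h
        · exact (hanti i η h hη).1 ha
        · rw [hcoh η i h hi]; exact ⟨ha, lt_of_lt_of_le haβ hβ⟩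
      · rintro a ⟨ha, haβ⟩
        obtain ⟨i, hi, ha⟩ := hfacts.1 ha
        refine ⟨?_, haβ⟩
        rcases le_or_gt i η with h | h
        · exact (hanti i η h hη).2 ha
        · rw [hcoh η i h hi]; exact ⟨ha, lt_of_lt_of_le haβ hβ⟩
    have hd := congrArg Pre.dom hcut
    rw [Pre.cut_dom, Pre.cut_dom] at hd
    rw [hd] at hπ ⊢
    rw [hcut] at hsle ⊢
    exact (hp η hη).ext β π hπ α s hs hsα hsle
  push Not at hβ
  have hsub : ∀ η < ξ, (p η).dom ⊆ Iio β := fun η hη a ha =>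
    (subset_Iio_ssup (hp η hη).wf.bdd ha).trans (hβ η hη)
  have hsub' : (Pre.sup (p '' Iio ξ)).dom ⊆ Iio β := fun a ha => by
    obtain ⟨η, hη, ha⟩ := hdom.1 ha
    exact hsub η hη ha
  have hi1 := inter_eq_left.2 hsub'
  rw [hi1] at hπ ⊢
  rw [Pre.cut_eq_self hwf hsub'] at hsle ⊢
  -- Stage η completes the image of p η over `U η`, the union of s and all earlier stages.
  let T : Ordinal.{u} → Pre D → Pre D → Prop := fun η U t => C.Full t ∧ t ≤ (p η).move π ∧ t ≤ U ∧
    t.dom = π '' (p η).dom ∪ U.dom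
  let step : ∀ η, (∀ i, i < η → Pre D) → Pre D := fun η ih =>
    Classical.epsilon (T η (Pre.sup ({s} ∪ {q | ∃ i, ∃ h : i < η, q = ih i h})))
  let S : Ordinal.{u} → Pre D := (wellFounded_lt (α := Ordinal.{u})).fix step
  let U : Ordinal.{u} → Pre D := fun η => Pre.sup ({s} ∪ S '' Iio η)
  have hS : ∀ η, S η = Classical.epsilon (T η (U η)) := by
    intro η
    have h1 : S η = step η fun i _ => S i := (wellFounded_lt (α := Ordinal.{u})).fix_eq step η
    rw [h1]
    have : {q | ∃ i, ∃ _ : i < η, q = S i} = S '' Iio η := by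
      ext q
      constructor
      · rintro ⟨i, hi, rfl⟩; exact ⟨i, hi, rfl⟩
      · rintro ⟨i, hi, rfl⟩; exact ⟨i, hi, rfl⟩
    simp only [step, this, U]
  have hU : ∀ η ≤ ξ, (∀ i < η, T i (U i) (S i)) → C.Full (U η) ∧
      (U η).dom = (⋃ i ∈ Iio η, π '' (p i).dom) ∪ s.dom := by
    intro η hη hT
    have hSs : ∀ i < η, S i ≤ s := fun i hi => (hT i hi).2.2.1.trans (Pre.sup_le (Or.inl rfl))
    have hSS : ∀ i j, i < j → j < η → S j ≤ S i := fun i j hij hj =>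
      (hT j hj).2.2.1.trans (Pre.sup_le (Or.inr ⟨i, hij, rfl⟩))
    have hfew : Few L (Iio η) := hξ.mono (Iio_subset_Iio hη)
    have : Nonempty L := inferInstance
    constructor
    · refine C.sup _ ⟨s, Or.inl rfl⟩ ((Few.singleton s).union (hfew.image S)) ?_ ?_
      · rintro a (rfl | ⟨i, hi, rfl⟩) b (rfl | ⟨j, hj, rfl⟩) hab
        · exact absurd rfl hab
        · exact Or.inr (hSs j hj)
        · exact Or.inl (hSs i hi)
        · rcases lt_trichotomy i j with h | rfl | h
          · exact Or.inr (hSS i j h hj)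
          · exact absurd rfl hab
          · exact Or.inl (hSS j i h hi)
      · rintro a (rfl | ⟨i, hi, rfl⟩)
        exacts [hs, (hT i hi).1]
    · have hSdom : ∀ i, i < η → (S i).dom ⊆ (⋃ i ∈ Iio η, π '' (p i).dom) ∪ s.dom := by
        intro i
        induction i using WellFoundedLT.induction with
        | ind i ih =>
        intro hi
        rw [(hT i hi).2.2.2]
        refine union_subset ?_ ?_
        · exact subset_union_of_subset_left (subset_biUnion_of_mem (u := fun i => π '' (p i).dom) hi)
            _
        · intro a ha
          obtain ⟨q, hq | ⟨j, hj, rfl⟩, ha⟩ := Pre.mem_sup_dom.1 ha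
          · exact Or.inr (by rwa [mem_singleton_iff.1 hq] at ha)
          · exact ih j hj (lt_trans hj hi) ha
      refine Subset.antisymm ?_ ?_
      · intro a ha
        obtain ⟨q, hq | ⟨j, hj, rfl⟩, ha⟩ := Pre.mem_sup_dom.1 ha
        · exact Or.inr (by rwa [mem_singleton_iff.1 hq] at ha)
        · exact hSdom j hj ha
      · rintro a (ha | ha)
        · obtain ⟨i, hi, ha⟩ := mem_iUnion₂.1 ha
          refine Pre.mem_sup_dom.2 ⟨S i, Or.inr ⟨i, hi, rfl⟩, ?_⟩
          rw [(hT i hi).2.2.2]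
          exact Or.inl ha
        · exact Pre.mem_sup_dom.2 ⟨s, Or.inl rfl, ha⟩
  have hmono : StrictMonoOn π (Pre.sup (p '' Iio ξ)).dom := hπ.strictMonoOn
  have hT : ∀ η, η < ξ → T η (U η) (S η) := by
    intro η
    induction η using WellFoundedLT.induction with
    | ind η ih =>
    intro hη
    have ih' : ∀ i < η, T i (U i) (S i) := fun i hi => ih i hi (lt_trans hi hη)
    obtain ⟨hUf, hUd⟩ := hU η hη.le ih'
    have hsubη : (p η).dom ⊆ (Pre.sup (p '' Iio ξ)).dom := fun a ha => hdom.2 ⟨η, hη, ha⟩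
    have hi2 : (p η).dom ∩ Iio β = (p η).dom := inter_eq_left.2 (hsub η hη)
    have hUb : BddAbove (U η).dom := (C.wf hUf).bdd
    -- What p η has below the bound of `U η` is covered by s, if it lies below α, or else by
    -- coherence belongs to an earlier p i. So `U η` is a legitimate lower part for completing p η.
    have key : ∀ γ ∈ (p η).dom, π γ < max α (ssup (U η).dom) →
        π γ < α ∨ ∃ i < η, γ < ssup (p i).dom := by
      intro γ hγ hlt
      rcases lt_max_iff.1 hlt with h | h
      · exact Or.inl h
      obtain ⟨δ, hδ, hle⟩ := (lt_ssup_iff hUb).1 h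
      rw [hUd] at hδ
      rcases hδ with hδ | hδ
      · obtain ⟨i, hi, γ', hγ', rfl⟩ := mem_iUnion₂.1 hδ
        refine Or.inr ⟨i, hi, (lt_ssup_iff (hp i (lt_trans hi hη)).wf.bdd).2 ⟨γ', hγ', ?_⟩⟩
        exact (hmono.le_iff_le (hsubη hγ) (hdom.2 ⟨i, lt_trans hi hη, hγ'⟩)).1 hle
      · exact Or.inl (hle.trans_lt (hsα hδ))
    have hUs : U η ≤ s := Pre.sup_le (Or.inl rfl)
    have hUi : ∀ i < η, U η ≤ (p i).move π := fun i hi =>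
      (Pre.sup_le (Or.inr ⟨i, hi, rfl⟩)).trans (ih' i hi).2.1
    have hex := (hp η hη).ext β π (hi2.symm ▸ hπ.mono hsubη) (max α (ssup (U η).dom)) (U η) hUf
      (fun a ha => lt_max_of_lt_right (mem_Iio.1 (subset_Iio_ssup hUb ha))) (by
        rw [Pre.cut_eq_self (hp η hη).wf (hsub η hη)]
        constructor
        · rintro _ ⟨⟨γ, hγ, rfl⟩, hlt⟩
          rcases key γ hγ hlt with h | ⟨i, hi, h⟩
          · exact hUs.1 (hsle.1 ⟨⟨γ, hsubη hγ, rfl⟩, h⟩)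
          · refine (hUi i hi).1 ⟨γ, ?_, rfl⟩
            rw [hcoh i η hi hη]; exact ⟨hγ, h⟩
        · rintro _ ⟨⟨f, hf, rfl⟩, hlt⟩
          rcases key _ ((hp η hη).wf.snd_mem f hf) hlt with h | ⟨i, hi, h⟩
          · exact hUs.2 (hsle.2 ⟨⟨f, hfacts.2 ⟨η, hη, hf⟩, rfl⟩, h⟩)
          · refine (hUi i hi).2 ⟨f, ?_, rfl⟩
            rw [hcoh i η hi hη]; exact ⟨hf, h⟩)
    rw [hi2, Pre.cut_eq_self (hp η hη).wf (hsub η hη)] at hex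
    rw [hS]
    exact Classical.epsilon_spec (p := T η (U η)) hex
  obtain ⟨h1, h2⟩ := hU ξ le_rfl hT
  refine ⟨U ξ, h1, ⟨?_, ?_⟩, Pre.sup_le (Or.inl rfl), ?_⟩
  · rintro _ ⟨γ, hγ, rfl⟩
    obtain ⟨η, hη, hγ⟩ := hdom.1 hγ
    exact ((Pre.sup_le (Or.inr ⟨η, hη, rfl⟩)).trans (hT η hη).2.1).1 ⟨γ, hγ, rfl⟩
  · rintro _ ⟨f, hf, rfl⟩
    obtain ⟨η, hη, hf⟩ := hfacts.1 hf
    exact ((Pre.sup_le (Or.inr ⟨η, hη, rfl⟩)).trans (hT η hη).2.1).2 ⟨f, hf, rfl⟩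
  · rw [h2]
    congr 1
    ext a
    constructor
    · intro ha
      obtain ⟨i, hi, γ, hγ, rfl⟩ := mem_iUnion₂.1 ha
      exact ⟨γ, hdom.2 ⟨i, hi, hγ⟩, rfl⟩
    · rintro ⟨γ, hγ, rfl⟩
      obtain ⟨i, hi, hγ⟩ := hdom.1 hγ
      exact mem_iUnion₂.2 ⟨i, hi, γ, hγ, rfl⟩

end FullClass

/-! ### Smallness, and codes in H_κ -/

theorem few_Iio_iff {L : Type u} {μ : Ordinal.{u}} :
    Few L (Iio μ) ↔ μ < (Order.succ #L).ord := by
  rw [Few.iff_lt_succ, Cardinal.mk_Iio_ordinal, Cardinal.lift_lt, Cardinal.lt_ord]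

theorem mem_smallSets_iff {L : Type u} {x : Set Ordinal.{u}} :
    x ∈ smallSets (Order.succ #L) ↔ x ⊆ Iio (succOrd (Order.succ #L)) ∧ Few L x := by
  rw [Few.iff_lt_succ]; rfl

/-- Regularity of the successor cardinal: the initial segment is a small union of small ones. -/
theorem few_Iio_ssup {L : Type u} [Infinite L] {x : Set Ordinal.{u}} (hx : Few L x)
    (h : x ⊆ Iio (Order.succ #L).ord) : Few L (Iio (ssup x)) := by
  have hsucc : Order.IsSuccLimit (Order.succ #L).ord :=
    Cardinal.isSuccLimit_ord ((Cardinal.aleph0_le_mk L).trans (Order.le_succ _))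
  refine (hx.biUnion (f := fun γ => Iio (Order.succ γ)) fun γ hγ => few_Iio_iff.2
    (hsucc.succ_lt (h hγ))).mono fun α hα => ?_
  obtain ⟨γ, hγ, hle⟩ := (lt_ssup_iff (bddAbove_of_subset_Iio h)).1 hα
  exact mem_biUnion hγ (Order.lt_succ_iff.2 hle)

/-- As there are at most κ data, realm and facts below κ amount to a subset of a set of size κ,
hence to a set of ordinals below κ. It has size less than κ, so it is bounded. -/
theorem Pre.exists_code {L D : Type u} [Infinite L] (hD : #D ≤ Order.succ #L) :
    ∃ code : Pre D → ZFSet.{u},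
      InjOn code {p | p.Wf L ∧ p.dom ⊆ Iio (Order.succ #L).ord} ∧
      MapsTo code {p | p.Wf L ∧ p.dom ⊆ Iio (Order.succ #L).ord}
        (hereditarilyLT (Order.succ #L)) := by
  set κ := Order.succ #L with hκ
  have hκ0 : ℵ₀ ≤ κ := (Cardinal.aleph0_le_mk L).trans (Order.le_succ _)
  let I := Iio κ.ord
  have hI : #I = Cardinal.lift.{u + 1} κ := by
    rw [Cardinal.mk_Iio_ordinal, Cardinal.card_ord]
  have hI0 : ℵ₀ ≤ #I := by rw [hI]; simpa using hκ0
  have hA : #(I ⊕ (I × I × D)) ≤ #I := by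
    have hD' : Cardinal.lift.{u + 1} #D ≤ #I := by rw [hI]; exact Cardinal.lift_le.2 hD
    simp only [Cardinal.mk_sum, Cardinal.mk_prod, Cardinal.lift_id]
    refine Cardinal.add_le_of_le hI0 le_rfl ?_
    refine (mul_le_mul' le_rfl (mul_le_mul' le_rfl hD')).trans ?_
    rw [Cardinal.lift_id'.{u, u + 1}, Cardinal.mul_eq_self hI0, Cardinal.mul_eq_self hI0]
  obtain ⟨e⟩ := Cardinal.le_def _ _ |>.1 hA
  let incl : I × I × D → Ordinal.{u} × Ordinal.{u} × D := fun f => (f.1.1, f.2.1.1, f.2.2)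
  have hincl : Function.Injective incl := by
    rintro ⟨a, b, c⟩ ⟨a', b', c'⟩ h
    simp only [incl, Prod.mk.injEq] at h
    exact Prod.ext (Subtype.ext h.1) (Prod.ext (Subtype.ext h.2.1) h.2.2)
  let y : Pre D → Set Ordinal.{u} := fun p =>
    (fun a => (e (Sum.inl a)).1) '' ((Subtype.val : I → _) ⁻¹' p.dom) ∪
      (fun f => (e (Sum.inr f)).1) '' (incl ⁻¹' p.facts)
  have hyI : ∀ p, y p ⊆ Iio κ.ord := by
    rintro p _ (⟨a, -, rfl⟩ | ⟨a, -, rfl⟩)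
    exacts [(e _).2, (e _).2]
  -- The von Neumann ordinal that bounds the code is the transitive superset required by H_κ.
  let code : Pre D → ZFSet.{u} := fun p =>
    ZFSet.sep (fun z => ∃ α ∈ y p, α.toZFSet = z) (ssup (y p)).toZFSet
  have hcode : ∀ p α, α.toZFSet ∈ code p ↔ α ∈ y p := by
    intro p α
    simp only [code, ZFSet.mem_sep, Ordinal.toZFSet_mem_toZFSet_iff]
    constructor
    · rintro ⟨-, β, hβ, h⟩
      rwa [← Ordinal.toZFSet_injective h]
    · intro h
      exact ⟨subset_Iio_ssup (bddAbove_of_subset_Iio (hyI p)) h, α, h, rfl⟩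
  refine ⟨code, ?_, ?_⟩
  · rintro p ⟨hp, hpd⟩ q ⟨hq, hqd⟩ hpq
    have hy : ∀ α, α ∈ y p ↔ α ∈ y q := fun α => by rw [← hcode, hpq, hcode]
    have h1 : ∀ {p q : Pre D}, (∀ α, α ∈ y p ↔ α ∈ y q) → p.dom ⊆ Iio κ.ord → p.Wf L → q ≤ p := by
      intro p q hy hpd hp
      constructor
      · intro a ha
        have := (hy (e (Sum.inl ⟨a, hpd ha⟩)).1).1 (Or.inl ⟨⟨a, hpd ha⟩, ha, rfl⟩)
        rcases this with ⟨b, hb, h⟩ | ⟨b, hb, h⟩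
        · have := Sum.inl.inj (e.injective (Subtype.ext h))
          rw [this] at hb; exact hb
        · exact absurd (e.injective (Subtype.ext h)) (by simp)
      · intro f hf
        let f' : I × I × D := (⟨f.1, hpd (hp.fst_mem f hf)⟩, ⟨f.2.1, hpd (hp.snd_mem f hf)⟩, f.2.2)
        have := (hy (e (Sum.inr f')).1).1 (Or.inr ⟨f', hf, rfl⟩)
        rcases this with ⟨b, hb, h⟩ | ⟨b, hb, h⟩
        · exact absurd (e.injective (Subtype.ext h)) (by simp)
        · have := Sum.inr.inj (e.injective (Subtype.ext h))
          rw [this] at hb; exact hb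
    exact le_antisymm (h1 (fun α => (hy α).symm) hqd hq) (h1 hy hpd hp)
  · rintro p ⟨hp, hpd⟩
    have hfew : Few L (y p) :=
      ((hp.dom_few.preimage Subtype.val_injective.injOn).image _).union
        ((hp.facts_few.preimage hincl.injOn).image _)
    refine ⟨(ssup (y p)).toZFSet, (ZFSet.isOrdinal_toZFSet _).isTransitive, ?_, ?_⟩
    · intro z hz
      exact (ZFSet.mem_sep.1 hz).1
    · rw [Ordinal.card_toZFSet, ← Cardinal.lt_ord]
      exact few_Iio_iff.1 (few_Iio_ssup hfew (hyI p))

/-! ### The conditions form a member of 𝒫_κ -/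

namespace FullClass

variable {L D : Type u} (C : FullClass L D)

theorem cond_trivial : C.Cond ⟨∅, ∅⟩ := C.cond_of_full C.trivial closedInSup_empty

/-- The type of conditions. -/
abbrev Conditions : Type (u + 1) := {p : Pre D // C.Cond p}

variable {C} in
-- Uniqueness of vertical limits: the upper ordinal of a fact lies in the realm of some p η, and the
-- corresponding cut then contains the fact.
theorem coherent_mem {ξ : Ordinal.{u}} {p : Ordinal.{u} → Pre D} {q : Pre D} (hq : q.Wf L)
    (hp : ∀ η < ξ, (p η).Wf L)
    (hd : q.dom = ⋃ η ∈ Iio ξ, (p η).dom) (h : ∀ η < ξ, p η = q.cut (ssup (p η).dom)) :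
    q = Pre.sup (p '' Iio ξ) := by
  apply Pre.ext
  · rw [hd]; ext a; simp [Pre.mem_sup_dom]
  · ext f
    rw [Pre.mem_sup_facts, exists_mem_image]
    constructor
    · intro hf
      have h1 := hq.snd_mem f hf
      rw [hd] at h1
      obtain ⟨η, hη, h1⟩ := mem_iUnion₂.1 h1
      refine ⟨η, hη, ?_⟩
      rw [h η hη]
      exact ⟨hf, subset_Iio_ssup (hp η hη).bdd h1⟩
    · rintro ⟨η, hη, hf⟩
      rw [h η hη] at hf
      exact hf.1

variable {C} in
theorem sup_cut_eq {ξ : Ordinal.{u}} {p : Ordinal.{u} → Pre D} (hp : ∀ η < ξ, (p η).Wf L)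
    (hcoh : ∀ η η', η < η' → η' < ξ → p η = (p η').cut (ssup (p η).dom)) {η} (hη : η < ξ) :
    p η = (Pre.sup (p '' Iio ξ)).cut (ssup (p η).dom) := by
  refine le_antisymm (Pre.le_def.2 ⟨?_, ?_⟩) (Pre.le_def.2 ⟨?_, ?_⟩)
  · rintro a ⟨ha, hlt⟩
    rw [Pre.mem_sup_dom, exists_mem_image] at ha
    obtain ⟨i, hi, ha⟩ := ha
    rcases lt_trichotomy i η with h | rfl | h
    · rw [hcoh i η h hη] at ha; exact ha.1
    · exact ha
    · rw [hcoh η i h hi]; exact ⟨ha, hlt⟩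
  · rintro a ⟨ha, hlt⟩
    rw [Pre.mem_sup_facts, exists_mem_image] at ha
    obtain ⟨i, hi, ha⟩ := ha
    rcases lt_trichotomy i η with h | rfl | h
    · rw [hcoh i η h hη] at ha; exact ha.1
    · exact ha
    · rw [hcoh η i h hi]; exact ⟨ha, hlt⟩
  · intro a ha
    exact ⟨Pre.mem_sup_dom.2 ⟨_, ⟨η, hη, rfl⟩, ha⟩, subset_Iio_ssup (hp η hη).bdd ha⟩
  · intro f hf
    exact ⟨Pre.mem_sup_facts.2 ⟨_, ⟨η, hη, rfl⟩, hf⟩,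
      subset_Iio_ssup (hp η hη).bdd ((hp η hη).snd_mem f hf)⟩

/-- By coherence, the union agrees with p η below any point of the realm of p η, so an accumulation
point below such a point is already one for p η. -/
theorem closed_sup {ξ : Ordinal.{u}} {p : Ordinal.{u} → Pre D} (hp : ∀ η < ξ, (p η).Wf L)
    (hb : BddAbove (Pre.sup (p '' Iio ξ)).dom)
    (hcoh : ∀ η η', η < η' → η' < ξ → p η = (p η').cut (ssup (p η).dom))
    (hc : ∀ η < ξ, ClosedInSup (p η).dom) : ClosedInSup (Pre.sup (p '' Iio ξ)).dom := by
  rw [closedInSup_iff hb]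
  rintro α h0 ⟨γ, hγ, hle⟩ h
  have hγ' := hγ
  rw [Pre.mem_sup_dom, exists_mem_image] at hγ
  obtain ⟨η, hη, hγ⟩ := hγ
  have hs : Pre.sup (p '' Iio ξ) ≤ p η := Pre.sup_le ⟨η, hη, rfl⟩
  refine hs.1 ((closedInSup_iff (hp η hη).bdd).1 (hc η hη) α h0 ⟨γ, hγ, hle⟩ fun β hβ => ?_)
  obtain ⟨δ, hδ, h1, h2⟩ := h β hβ
  refine ⟨δ, ?_, h1, h2⟩
  rw [sup_cut_eq hp hcoh hη]
  exact ⟨hδ, (h2.trans_le hle).trans (subset_Iio_ssup (hp η hη).bdd hγ)⟩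

theorem chain_of_decreasing {ξ : Ordinal.{u}} {q : Ordinal.{u} → Pre D}
    (h : ∀ η η', η < η' → η' < ξ → q η' ≤ q η) : IsChain (· ≤ ·) (q '' Iio ξ) := by
  rintro _ ⟨i, hi, rfl⟩ _ ⟨j, hj, rfl⟩ hij
  rcases lt_trichotomy i j with h' | rfl | h'
  · exact Or.inr (h i j h' hj)
  · exact absurd rfl hij
  · exact Or.inl (h j i h' hi)

variable {C} in
-- Take the union of the sequence, splice r into it, and fill up the realm to its closure.
theorem exists_controlled [Infinite L] {ξ : Ordinal.{u}} (hξ : Few L (Iio ξ)) {q : Ordinal.{u} → Pre D}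
    (hq : ∀ η < ξ, C.Full (q η)) (hdec : ∀ η η', η < η' → η' < ξ → q η' ≤ q η)
    {x : Set Ordinal.{u}} (hx : x = ⋃ η ∈ Iio ξ, (q η).dom) {α : Ordinal.{u}} (hα : α < ssup x)
    {r : Pre D} (hr : C.Full r) (hrc : ClosedInSup r.dom) (hrα : r.dom ⊆ Iio (ssup (x ∩ Iio α)))
    (hle : ∀ η < ξ, r ≤ (q η).cut α) :
    ∃ s, C.Full s ∧ ClosedInSup s.dom ∧ s.cut (ssup (x ∩ Iio α)) = r ∧
      s.dom = ordCl (r.dom ∪ x) ∧ ∀ η < ξ, s ≤ q η := by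
  have hne : x.Nonempty := by
    by_contra! h
    rw [h, ssup_empty] at hα
    exact absurd hα not_lt_zero
  have hξ0 : (q '' Iio ξ).Nonempty := by
    obtain ⟨a, ha⟩ := hne
    rw [hx] at ha
    obtain ⟨η, hη, -⟩ := mem_iUnion₂.1 ha
    exact ⟨_, η, hη, rfl⟩
  have hu : C.Full (Pre.sup (q '' Iio ξ)) := C.sup _ hξ0 (hξ.image q)
    (chain_of_decreasing hdec) (by rintro _ ⟨η, hη, rfl⟩; exact hq η hη)
  have hux : (Pre.sup (q '' Iio ξ)).dom = x := by
    rw [hx]; ext a; simp [Pre.mem_sup_dom]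
  have hbx : BddAbove x := hux ▸ (C.wf hu).bdd
  have hbα : BddAbove (x ∩ Iio α) := hbx.mono inter_subset_left
  have hlt : ∀ a, a < ssup (x ∩ Iio α) → a < α := fun a ha => by
    obtain ⟨γ, hγ, h⟩ := (lt_ssup_iff hbα).1 ha
    exact h.trans_lt hγ.2
  -- Splicing takes place at the strict supremum of x ∩ α and not at α itself: thus every ordinal of
  -- r has an ordinal of x above it and below the splitting point.
  obtain ⟨s, hs, hsu, hsd, hsc⟩ := C.splice hu hr (ssup (x ∩ Iio α)) hrα (by
    constructor
    · rintro a ⟨ha, hlt'⟩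
      rw [Pre.mem_sup_dom, exists_mem_image] at ha
      obtain ⟨η, hη, ha⟩ := ha
      exact (hle η hη).1 ⟨ha, hlt a hlt'⟩
    · rintro a ⟨ha, hlt'⟩
      rw [Pre.mem_sup_facts, exists_mem_image] at ha
      obtain ⟨η, hη, ha⟩ := ha
      exact (hle η hη).2 ⟨ha, hlt _ hlt'⟩) (by
    intro γ hγ
    obtain ⟨δ, hδ, h⟩ := (lt_ssup_iff hbα).1 (hrα hγ)
    exact ⟨δ, hux ▸ hδ.1, h, subset_Iio_ssup hbα hδ⟩)
  rw [hux] at hsd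
  have hbd : BddAbove (r.dom ∪ x) := by
    rw [union_comm, ← hsd]; exact (C.wf hs).bdd
  obtain ⟨t, ht, hts, htd, htc⟩ := C.extend hs (ordCl (r.dom ∪ x))
    (by rw [hsd, union_comm]; exact subset_ordCl _)
    (((C.wf hr).dom_few.union (hux ▸ (C.wf hu).dom_few)).ordCl hbd)
    (ordCl_subset_Iio (union_subset (C.wf hr).dom_lt (hux ▸ (C.wf hu).dom_lt)))
  refine ⟨t, ht, htd ▸ closedInSup_ordCl hbd, ?_, htd, fun η hη =>
    (hts.trans hsu).trans (Pre.sup_le ⟨η, hη, rfl⟩)⟩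
  -- Filling up does not disturb r: a new ordinal below the splitting point would be an accumulation
  -- point of the realm of r, which is closed and contains x ∩ α.
  rw [htc, hsc]
  rintro γ ⟨hγ | hγ, hγα⟩
  · rw [hsd]; exact hγ.symm
  obtain ⟨h1, -, h3⟩ := (mem_accPlus_iff hbd).1 hγ
  have hxr : ∀ a ∈ x, a < α → a ∈ r.dom := fun a ha haα => by
    rw [hx] at ha
    obtain ⟨η, hη, ha⟩ := mem_iUnion₂.1 ha
    exact (hle η hη).1 ⟨ha, haα⟩
  rw [hsd]
  refine Or.inr ((closedInSup_iff (C.wf hr).bdd).1 hrc γ h1 ?_ fun β hβ => ?_)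
  · obtain ⟨δ, hδ, h⟩ := (lt_ssup_iff hbα).1 hγα
    exact ⟨δ, hxr δ hδ.1 hδ.2, h⟩
  · obtain ⟨δ, hδ | hδ, h4, h5⟩ := h3 β hβ
    · exact ⟨δ, hδ, h4, h5⟩
    · exact ⟨δ, hxr δ hδ (h5.trans (hlt γ hγα)), h4, h5⟩

variable {C} in
-- With x empty this is sharpness; with x a closed copy it is the first step towards sharp density.
theorem Cond.exists_sharp [Infinite L] {p : Pre D} (hp : C.Cond p) {x : Set Ordinal.{u}} (hx : Few L x)
    (hlt : x ⊆ Iio (succOrd (Order.succ #L))) :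
    ∃ q, C.Full q ∧ ClosedInSup q.dom ∧ q ≤ p ∧ q.dom = ordCl (p.dom ∪ x) := by
  obtain ⟨t, ht, htp, htd⟩ := hp.exists_full
  have hU : p.dom ∪ x ⊆ Iio (succOrd (Order.succ #L)) := union_subset hp.wf.dom_lt hlt
  have hb := bddAbove_of_subset_Iio hU
  obtain ⟨s, hs, hst, hsd, -⟩ := C.extend ht (ordCl (p.dom ∪ x))
    (by rw [htd]; exact subset_union_left.trans (subset_ordCl _))
    ((hp.wf.dom_few.union hx).ordCl hb) (ordCl_subset_Iio hU)
  exact ⟨s, hs, hsd ▸ closedInSup_ordCl hb, hst.trans htp, hsd⟩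

open Classical in
/-- The action of functions on conditions. -/
noncomputable def act (y : Set Ordinal.{u}) (π : Ordinal.{u} → Ordinal.{u}) (p : C.Conditions) :
    C.Conditions :=
  if h : IsCoi (succOrd (Order.succ #L)) y π ∧ p.1.dom ⊆ y then ⟨p.1.move π, p.2.move h.1 h.2⟩
  else p

variable {C} in
theorem act_val {y : Set Ordinal.{u}} {π : Ordinal.{u} → Ordinal.{u}} {p : C.Conditions}
    (h : IsCoi (succOrd (Order.succ #L)) y π) (hp : p.1.dom ⊆ y) :
    (C.act y π p).1 = p.1.move π := by
  rw [act, dif_pos ⟨h, hp⟩]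

/-- A limit point of y is mapped by π to a limit point of y', where continuity of π' applies; the
two suprema agree by cofinality. -/
theorem isCoi_comp {μ : Ordinal.{u}} {y y' : Set Ordinal.{u}} {π π' : Ordinal.{u} → Ordinal.{u}}
    (h : IsCoi μ y π) (h' : IsCoi μ y' π') (hy : π '' y ⊆ y') : IsCoi μ y (π' ∘ π) := by
  refine ⟨h.subset, h.closed, fun a ha => h'.mapsTo (hy ⟨a, ha, rfl⟩),
    h'.strictMonoOn.comp h.strictMonoOn (image_subset_iff.1 hy), fun δ hδ h0 hs => ?_⟩
  have hb : BddAbove (π '' y) := bddAbove_of_subset_Iio h.mapsTo.image_subset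
  have hmono : ∀ {a b}, a ∈ y → b ∈ y → a < b → π' (π a) < π' (π b) := fun ha hb hab =>
    h'.strictMonoOn (hy ⟨_, ha, rfl⟩) (hy ⟨_, hb, rfl⟩) (h.strictMonoOn ha hb hab)
  have h1 := h.continuous δ hδ h0 hs
  have hbd : BddAbove (π '' (y ∩ Iio δ)) := hb.mono (image_mono inter_subset_left)
  have hcof : ∀ β < π δ, ∃ γ ∈ y ∩ Iio δ, β < π γ := fun β hβ => by
    rw [h1] at hβ
    by_contra! hcon
    refine absurd hβ (not_lt.2 (csSup_le' ?_))
    rintro _ ⟨γ, hγ, rfl⟩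
    exact hcon γ hγ
  have hlt : ∀ γ ∈ y ∩ Iio δ, π γ < π δ := fun γ hγ => h.strictMonoOn hγ.1 hδ hγ.2
  have h0' : 0 < π δ := by
    obtain ⟨γ, hγ, -, h2⟩ := (sSup_inter_eq_iff h0).1 hs 0 h0
    exact zero_le.trans_lt (hlt γ ⟨hγ, h2⟩)
  have h2 := h'.continuous (π δ) (hy ⟨δ, hδ, rfl⟩) h0' ((sSup_inter_eq_iff h0').2
    fun β hβ => by
      obtain ⟨γ, hγ, h3⟩ := hcof β hβ
      exact ⟨π γ, hy ⟨γ, hγ.1, rfl⟩, h3, hlt γ hγ⟩)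
  refine h2.trans (le_antisymm (csSup_le' ?_) (csSup_le' ?_))
  · rintro _ ⟨ε, ⟨hε, hεδ⟩, rfl⟩
    obtain ⟨γ, hγ, h3⟩ := hcof ε hεδ
    refine le_csSup_of_le ?_ ⟨γ, hγ, rfl⟩
      (h'.strictMonoOn.monotoneOn hε (hy ⟨γ, hγ.1, rfl⟩) h3.le)
    refine ⟨π' (π δ), ?_⟩
    rintro _ ⟨γ, hγ, rfl⟩
    exact (hmono hγ.1 hδ hγ.2).le
  · rintro _ ⟨γ, hγ, rfl⟩
    refine le_csSup ?_ ⟨π γ, ⟨hy ⟨γ, hγ.1, rfl⟩, hlt γ hγ⟩, rfl⟩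
    refine ⟨π' (π δ), ?_⟩
    rintro _ ⟨ε, hε, rfl⟩
    exact (h'.strictMonoOn hε.1 (hy ⟨δ, hδ, rfl⟩) hε.2).le

/-- The forcing notion of conditions. -/
noncomputable def sharpForcing [Infinite L] (hD : #D ≤ Order.succ #L) :
    SharpForcing (Order.succ #L) C.Conditions where
  one := ⟨⟨∅, ∅⟩, C.cond_trivial⟩
  Q := {p | C.Full p.1 ∧ ClosedInSup p.1.dom}
  realm p := p.1.dom
  act := C.act
  restr p α := ⟨p.1.cut α, p.2.cut α⟩
  le_one p := ⟨empty_subset _, empty_subset _⟩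
  one_mem := ⟨C.trivial, closedInSup_empty⟩
  realm_mem p := mem_smallSets_iff.2 ⟨p.2.wf.dom_lt, p.2.wf.dom_few⟩
  realm_one := rfl
  realm_mono p q h := h.1
  exists_realm_eq p x hx h := by
    obtain ⟨h1, h2⟩ := mem_smallSets_iff.1 hx
    exact ⟨⟨⟨x, p.1.facts⟩, p.2.extend h h2 h1⟩, ⟨h, subset_rfl⟩, rfl⟩
  scope_empty := by
    ext p
    constructor
    · intro h
      have h : p.1.dom ⊆ ∅ := h
      refine Subtype.ext (Pre.ext (subset_empty_iff.1 h) (eq_empty_of_forall_notMem fun f hf => ?_))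
      exact h (p.2.wf.fst_mem f hf)
    · rintro rfl
      exact subset_refl (∅ : Set Ordinal.{u})
  scope_card := by
    obtain ⟨code, h1, h2⟩ := Pre.exists_code (L := L) hD
    refine ⟨fun p => code p.1, fun p hp q hq h => Subtype.ext (h1 ⟨p.2.wf, hp⟩ ⟨q.2.wf, hq⟩ h),
      fun p hp => h2 ⟨p.2.wf, hp⟩⟩
  realm_act y π p h h' := congrArg Pre.dom (act_val h h')
  act_mem y π p h h' hp := by
    rw [mem_ofPred_eq, act_val h h']
    exact ⟨C.move hp.1 π (h.strictMonoOn.mono h') (h.mapsTo.mono_left h'),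
      h.closedInSup_image h' hp.2⟩
  act_le_iff y π p q h hp hq := by
    rw [← Subtype.coe_le_coe, act_val h hp, act_val h hq]
    exact Pre.move_le_move_iff p.2.wf q.2.wf h.strictMonoOn.injOn hp hq
  act_id y π p h hp hid := Subtype.ext (by
    rw [act_val h hp]; exact Pre.move_id p.2.wf fun α hα => hid α (hp hα))
  act_comp y π y' π' p h h' hp hy := by
    have hc := isCoi_comp h h' hy
    have h3 : (C.act y π p).1.dom ⊆ y' := by
      rw [act_val h hp]; exact (image_mono hp).trans hy
    exact Subtype.ext (by rw [act_val h' h3, act_val h hp, act_val hc hp, Pre.move_move])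
  act_congr y π y' π' p h h' hp hp' heq :=
    Subtype.ext (by rw [act_val h hp, act_val h' hp', Pre.move_congr p.2.wf heq])
  restr_spec p α _ := ⟨rfl, Pre.le_cut, fun r hr h => ⟨hr.subset, fun f hf =>
    ⟨h.2 hf, (hr.subset (r.2.wf.snd_mem f hf)).2⟩⟩⟩
  restr_unique p α _ s hs hps h := by
    refine (le_antisymm (h ⟨p.1.cut α, p.2.cut α⟩ rfl Pre.le_cut) ⟨hs.subset, fun f hf =>
      ⟨hps.2 hf, (hs.subset (s.2.wf.snd_mem f hf)).2⟩⟩ : s = _)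
  restr_mem p hp α _ := ⟨C.cut hp.1 α, hp.2.inter_Iio p.2.wf.bdd α⟩
  restr_mono p q h α _ := Pre.cut_mono h
  vertical_limit ξ hξ p hp := by
    have hcoh : ∀ η η', η < η' → η' < ξ → (p η).1 = (p η').1.cut (ssup (p η).1.dom) :=
      fun η η' h h' => congrArg Subtype.val (hp η η' h h')
    have hwf : ∀ η < ξ, (p η).1.Wf L := fun η _ => (p η).2.wf
    refine ⟨⟨Pre.sup ((fun η => (p η).1) '' Iio ξ), Cond.sup_vertical (few_Iio_iff.2 hξ)
      (fun η => (p η).1) (fun η _ => (p η).2) hcoh⟩, ⟨?_, ?_⟩, ?_⟩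
    · ext a; simp [Pre.mem_sup_dom]
    · intro η hη
      exact Subtype.ext (sup_cut_eq (p := fun η => (p η).1) hwf hcoh hη)
    · rintro q ⟨h1, h2⟩
      exact Subtype.ext (coherent_mem (p := fun η => (p η).1) q.2.wf hwf h1
        fun η hη => congrArg Subtype.val (h2 η hη))
  vertical_limit_mem ξ hξ p hp hQ q hq h := by
    have hcoh : ∀ η η', η < η' → η' < ξ → (p η).1 = (p η').1.cut (ssup (p η).1.dom) :=
      fun η η' h h' => congrArg Subtype.val (hp η η' h h')
    have hwf : ∀ η < ξ, (p η).1.Wf L := fun η _ => (p η).2.wf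
    have h1 := coherent_mem (p := fun η => (p η).1) q.2.wf hwf hq
        fun η hη => congrArg Subtype.val (h η hη)
    refine ⟨?_, ?_⟩
    · rcases eq_empty_or_nonempty ((fun η => (p η).1) '' Iio ξ) with he | hne
      · rw [h1, he]
        have : Pre.sup (∅ : Set (Pre D)) = ⟨∅, ∅⟩ := Pre.ext (by simp [Pre.sup]) (by simp [Pre.sup])
        rw [this]
        exact C.trivial
      · rw [h1]
        refine C.sup _ hne ((few_Iio_iff.2 hξ).image _) (chain_of_decreasing ?_) ?_
        · intro η η' h3 h4
          rw [hcoh η η' h3 h4]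
          exact Pre.le_cut
        · rintro _ ⟨η, hη, rfl⟩
          exact (hQ η hη).1
    · have hb := q.2.wf.bdd
      rw [h1] at hb ⊢
      exact closed_sup hwf hb hcoh fun η hη => (hQ η hη).2
  closed_of_mem q hq := hq.2
  sharpness p := by
    have : Nonempty L := inferInstance
    obtain ⟨q, h1, h2, h3, h4⟩ := p.2.exists_sharp (x := ∅) Few.empty (empty_subset _)
    exact ⟨⟨q, C.cond_of_full h1 h2⟩, ⟨h1, h2⟩, h3, by simpa using h4⟩
  controlled_closure ξ hξ q hq hdec x hx α hα r hr hrα hle := by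
    obtain ⟨s, h1, h2, h3, h4, h5⟩ := exists_controlled (C := C) (few_Iio_iff.2 hξ)
      (q := fun η => (q η).1) (fun η hη => (hq η hη).1) hdec hx hα hr.1 hr.2 hrα hle
    exact ⟨⟨s, C.cond_of_full h1 h2⟩, ⟨h1, h2⟩, Subtype.ext h3, h4, h5⟩
  amalgamation p hp α _ q hqα hle := by
    have hr := Cond.union (C := C) hp.1 hp.2 q.2 hle hqα
    -- Lower bounds of the pair are the conditions below the union of its facts, so the union is the
    -- greatest lower bound as soon as it is a condition.
    have hlb : ∀ r : C.Conditions, r ∈ lowerBounds {p, q} ↔ r.1 ≤ q.1.union p.1 := by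
      intro r
      simp only [lowerBounds_insert, lowerBounds_singleton, mem_inter_iff, mem_Iic]
      constructor
      · rintro ⟨h1, h2⟩
        exact ⟨union_subset h2.1 h1.1, union_subset h2.2 h1.2⟩
      · intro h
        exact ⟨h.trans ⟨subset_union_right, subset_union_right⟩,
          h.trans ⟨subset_union_left, subset_union_left⟩⟩
    have hglb : IsGLB {p, q} (⟨_, hr⟩ : C.Conditions) :=
      ⟨(hlb _).2 le_rfl, fun r hr' => (hlb r).1 hr'⟩
    refine ⟨⟨_, hr⟩, hglb, fun r' hr' => hr'.unique hglb, rfl, Subtype.ext (le_antisymm ?_ ?_)⟩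
    · constructor
      · exact fun a ha => ⟨Or.inl ha, hqα ha⟩
      · exact fun f hf => ⟨Or.inl hf, hqα (q.2.wf.snd_mem f hf)⟩
    · constructor
      · rintro a ⟨ha | ha, hlt⟩
        exacts [ha, hle.1 ⟨ha, hlt⟩]
      · rintro a ⟨ha | ha, hlt⟩
        exacts [ha, hle.2 ⟨ha, hlt⟩]

end FullClass

/-! ### Transport along isomorphisms, and uniqueness of enumerations -/

theorem isGLB_pair_iff {P : Type v} [Preorder P] {p q r : P} :
    IsGLB {p, q} r ↔ ∀ z, z ≤ r ↔ z ≤ p ∧ z ≤ q := by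
  rw [isGLB_iff_le_iff]
  simp

/-- Transport of the structure along an order isomorphism. -/
def SharpForcing.congr {κ : Cardinal.{u}} {P : Type v} {P' : Type w} [Preorder P] [Preorder P']
    (S : SharpForcing κ P) (e : P' ≃o P) : SharpForcing κ P' where
  one := e.symm S.one
  Q := e ⁻¹' S.Q
  realm p := S.realm (e p)
  act y π p := e.symm (S.act y π (e p))
  restr p α := e.symm (S.restr (e p) α)
  le_one p := e.le_symm_apply.2 (S.le_one _)
  one_mem := by simpa using S.one_mem
  realm_mem p := S.realm_mem _
  realm_one := by simpa using S.realm_one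
  realm_mono p q h := S.realm_mono _ _ (e.monotone h)
  exists_realm_eq p x hx h := by
    obtain ⟨q, h1, h2⟩ := S.exists_realm_eq (e p) x hx h
    exact ⟨e.symm q, e.symm_apply_le.2 h1, by simpa using h2⟩
  scope_empty := by
    have h := S.scope_empty
    ext p
    have := Set.ext_iff.1 h (e p)
    simp only [mem_ofPred_eq, mem_singleton_iff] at this ⊢
    rw [this]
    exact ⟨fun h => by rw [← h, e.symm_apply_apply], fun h => by rw [h, e.apply_symm_apply]⟩
  scope_card := by
    obtain ⟨code, h1, h2⟩ := S.scope_card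
    exact ⟨fun p => code (e p), fun p hp q hq h => e.injective (h1 hp hq h), fun p hp => h2 hp⟩
  realm_act y π p h h' := by simpa using S.realm_act y π _ h h'
  act_mem y π p h h' hp := by simpa using S.act_mem y π _ h h' hp
  act_le_iff y π p q h hp hq := by
    rw [e.symm.le_iff_le, S.act_le_iff y π _ _ h hp hq, e.le_iff_le]
  act_id y π p h hp hid := by rw [S.act_id y π _ h hp hid, e.symm_apply_apply]
  act_comp y π y' π' p h h' hp hy := by
    rw [e.apply_symm_apply, S.act_comp y π y' π' _ h h' hp hy]
  act_congr y π y' π' p h h' hp hp' heq := by rw [S.act_congr y π y' π' _ h h' hp hp' heq]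
  restr_spec p α hα := by
    obtain ⟨h1, h2, h3⟩ := S.restr_spec (e p) α hα
    exact ⟨by simpa using h1, e.le_symm_apply.2 h2, fun r hr h =>
      e.symm_apply_le.2 (h3 _ hr (e.monotone h))⟩
  restr_unique p α hα s hs hps h := by
    rw [← e.symm_apply_apply s]
    congr 1
    refine S.restr_unique (e p) α hα (e s) hs (e.monotone hps) fun r hr hpr => ?_
    rw [← e.le_symm_apply]
    exact h _ (by simpa using hr) (e.le_symm_apply.2 hpr)
  restr_mem p hp α hα := by simpa using S.restr_mem _ hp α hα
  restr_mono p q h α hα := e.symm.monotone (S.restr_mono _ _ (e.monotone h) α hα)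
  vertical_limit ξ hξ p hp := by
    obtain ⟨q, ⟨h1, h2⟩, h3⟩ := S.vertical_limit ξ hξ (fun η => e (p η)) fun η η' h h' => by
      have h3 := congrArg e (hp η η' h h')
      rwa [e.apply_symm_apply] at h3
    refine ⟨e.symm q, ⟨by simpa using h1, fun η hη => ?_⟩, fun r hr => ?_⟩
    · rw [e.apply_symm_apply, ← h2 η hη, e.symm_apply_apply]
    · rw [← h3 (e r) ⟨hr.1, fun η hη => ?_⟩, e.symm_apply_apply]
      have h4 := congrArg e (hr.2 η hη)
      rwa [e.apply_symm_apply] at h4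
  vertical_limit_mem ξ hξ p hp hQ q hq h := by
    refine S.vertical_limit_mem ξ hξ (fun η => e (p η)) (fun η η' h h' => ?_) hQ (e q) hq
      fun η hη => ?_
    · have h3 := congrArg e (hp η η' h h')
      rwa [e.apply_symm_apply] at h3
    · have h3 := congrArg e (h η hη)
      rwa [e.apply_symm_apply] at h3
  closed_of_mem q hq := S.closed_of_mem _ hq
  sharpness p := by
    obtain ⟨q, h1, h2, h3⟩ := S.sharpness (e p)
    exact ⟨e.symm q, by simpa using h1, e.symm_apply_le.2 h2, by simpa using h3⟩
  controlled_closure ξ hξ q hq hdec x hx α hα r hr hrα hle := by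
    obtain ⟨s, h1, h2, h3, h4⟩ := S.controlled_closure ξ hξ (fun η => e (q η)) hq
      (fun η η' h h' => e.monotone (hdec η η' h h')) x hx α hα (e r) hr hrα
      (fun η hη => e.le_symm_apply.1 (hle η hη))
    exact ⟨e.symm s, by simpa using h1, by rw [e.apply_symm_apply, h2, e.symm_apply_apply],
      by simpa using h3, fun η hη => e.symm_apply_le.2 (h4 η hη)⟩
  amalgamation p hp α hα q hq hle := by
    obtain ⟨r, h1, h2, h3, h4⟩ := S.amalgamation (e p) hp α hα (e q) hq (e.le_symm_apply.1 hle)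
    have h5 : IsGLB {p, q} (e.symm r) := by
      rw [isGLB_pair_iff] at h1 ⊢
      intro z
      rw [e.le_symm_apply, h1, e.le_iff_le, e.le_iff_le]
    refine ⟨e.symm r, h5, fun r' hr' => ?_, by simpa using h3,
      by rw [e.apply_symm_apply, h4, e.symm_apply_apply]⟩
    rw [← h2 (e r'), e.symm_apply_apply]
    rw [isGLB_pair_iff] at hr' ⊢
    intro z
    rw [← e.symm_apply_le, hr', e.symm_apply_le, e.symm_apply_le]

/-- Allows properties of a closed copy to be stated through its increasing enumeration, whichever
way this is given. -/
theorem StrictMonoOn.eqOn_of_image_eq {θ : Ordinal.{u}} {e e' : Ordinal.{u} → Ordinal.{u}}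
    (he : StrictMonoOn e (Iio θ)) (he' : StrictMonoOn e' (Iio θ))
    (h : e '' Iio θ = e' '' Iio θ) : EqOn e e' (Iio θ) := by
  have key : ∀ {e e' : Ordinal.{u} → Ordinal.{u}}, StrictMonoOn e (Iio θ) →
      StrictMonoOn e' (Iio θ) → e '' Iio θ = e' '' Iio θ → ∀ a < θ, (∀ c < a, e c = e' c) →
      e' a ≤ e a := by
    intro e e' he he' h a ha ih
    obtain ⟨b, hb, hba⟩ : e a ∈ e' '' Iio θ := h ▸ ⟨a, ha, rfl⟩
    rcases le_or_gt a b with hab | hab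
    · rw [← hba]; exact he'.monotoneOn ha hb hab
    · rw [← ih b hab] at hba
      exact absurd (he.injOn hb ha hba) hab.ne
  intro a
  induction a using WellFoundedLT.induction with
  | ind a ih =>
  intro ha
  exact le_antisymm (key he' he h.symm a ha fun c hc => (ih c hc (lt_trans hc ha)).symm)
    (key he he' h a ha fun c hc => ih c hc (lt_trans hc ha))

/-! ### Dense systems and generic sets for a class of complete preconditions -/

namespace FullClass

variable {L D : Type u} (C : FullClass L D)

/-- The axiom speaks of types in `Type u`, one universe below the conditions. A condition is given
by subsets of sets built from κ⁺ and the data, so an equivalent copy exists there. -/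
theorem small_conditions : Small.{u} C.Conditions := by
  let S := (succOrd (Order.succ #L)).ToType
  let v : S → Ordinal.{u} := fun s => (Ordinal.ToType.mk.symm s).1
  have hv : ∀ a < succOrd (Order.succ #L), ∃ s, v s = a := fun a ha =>
    ⟨Ordinal.ToType.mk ⟨a, ha⟩, by simp [v]⟩
  let f : C.Conditions → Set S × Set (S × S × D) := fun p =>
    (v ⁻¹' p.1.dom, (fun x => (v x.1, v x.2.1, x.2.2)) ⁻¹' p.1.facts)
  refine small_of_injective (f := f) fun p q h => ?_
  have key : ∀ {p q : C.Conditions}, f p = f q → q.1 ≤ p.1 := by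
    intro p q h
    simp only [f, Prod.mk.injEq] at h
    constructor
    · intro a ha
      obtain ⟨s, rfl⟩ := hv a (p.2.wf.dom_lt ha)
      exact (Set.ext_iff.1 h.1 s).1 ha
    · rintro ⟨a, b, d⟩ hf
      obtain ⟨s, rfl⟩ := hv a (p.2.wf.dom_lt (p.2.wf.fst_mem _ hf))
      obtain ⟨t, rfl⟩ := hv b (p.2.wf.dom_lt (p.2.wf.snd_mem _ hf))
      exact (Set.ext_iff.1 h.2 (s, t, d)).1 hf
  exact Subtype.ext (le_antisymm (key h.symm) (key h))

/-- The dense systems of a class of complete preconditions: properties of preconditions and closed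
copies of `θ` in their realms that are invariant and dense. -/
structure DenseSystem where
  /-- The order type. -/
  θ : Ordinal.{u}
  /-- The property of a precondition and of the increasing enumeration of a closed set. -/
  Φ : (Ordinal.{u} → Ordinal.{u}) → Pre D → Prop
  θ_lt : θ < (Order.succ #L).ord
  congr : ∀ e e' p, EqOn e e' (Iio θ) → Φ e p → Φ e' p
  move : ∀ e p π, p.Wf L → MapsTo e (Iio θ) p.dom → StrictMonoOn π p.dom →
    (Φ (π ∘ e) (p.move π) ↔ Φ e p)
  dense : ∀ e q, C.Full q → ClosedInSup q.dom → StrictMonoOn e (Iio θ) → MapsTo e (Iio θ) q.dom →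
    ∃ s, C.Full s ∧ s ≤ q ∧ s.dom = q.dom ∧ Φ e s

variable {C} in
-- The dense set of a copy x consists of the conditions whose realm contains x and that satisfy Φ
-- for the enumeration of x. Sharp extensions have exactly the prescribed realm, since Φ can be
-- achieved without new ordinals.
theorem DenseSystem.isSharplyDenseSystem [Infinite L] (hD : #D ≤ Order.succ #L)
    (E : C.DenseSystem) {P : Type v} [Preorder P] (f : P ≃o C.Conditions) :
    ((C.sharpForcing hD).congr f).IsSharplyDenseSystem
      ((fun x => {p | x ⊆ (f p).1.dom ∧ ∃ e, StrictMonoOn e (Iio E.θ) ∧ e '' Iio E.θ = x ∧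
        E.Φ e (f p).1}) '' closedCopies (succOrd (Order.succ #L)) E.θ) := by
  refine ⟨E.θ, E.θ_lt, _, rfl, ?_⟩
  rintro x ⟨e, he, hx⟩
  set A : Set P := {p | x ⊆ (f p).1.dom ∧ ∃ e, StrictMonoOn e (Iio E.θ) ∧ e '' Iio E.θ = x ∧
        E.Φ e (f p).1} with hA
  have hxc : ClosedInSup x := by
    rw [hx]; exact he.closedInSup_image subset_rfl he.closed
  have hxlt : x ⊆ Iio (succOrd (Order.succ #L)) := by
    rw [hx]; exact he.mapsTo.image_subset
  have hxf : Few L x := by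
    rw [hx]; exact (few_Iio_iff.2 E.θ_lt).image e
  have hdense : ∀ p : P, ∃ q ∈ A, q ≤ p ∧ (f q).1.dom = ordCl ((f p).1.dom ∪ x) := by
    intro p
    obtain ⟨q, h1, h2, h3, h4⟩ := (f p).2.exists_sharp hxf hxlt
    have hxq : x ⊆ q.dom := by
      rw [h4]; exact subset_union_right.trans (subset_ordCl _)
    have hme : MapsTo e (Iio E.θ) q.dom := by
      rw [mapsTo_iff_image_subset, ← hx]; exact hxq
    obtain ⟨s, h5, h6, h7, h8⟩ := E.dense e q h1 h2 he.strictMonoOn hme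
    refine ⟨f.symm ⟨s, C.cond_of_full h5 (h7 ▸ h2)⟩, ?_, f.symm_apply_le.2 (h6.trans h3), ?_⟩
    · simp only [hA, mem_ofPred_eq, f.apply_symm_apply]
      exact ⟨h7 ▸ hxq, e, he.strictMonoOn, hx.symm, h8⟩
    · rw [f.apply_symm_apply, ← h4]
      exact h7
  -- Sharpening the empty condition gives a member of `A` with realm x, because x is closed.
  have hrealm : ((C.sharpForcing hD).congr f).realmOf A = x := by
    apply Subset.antisymm
    · intro a ha
      obtain ⟨q, hq, -, hd⟩ := hdense (f.symm ⟨⟨∅, ∅⟩, C.cond_trivial⟩)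
      have h : a ∈ (f q).1.dom := ha q hq
      rw [hd, f.apply_symm_apply] at h
      simp only [empty_union] at h
      rwa [hxc.ordCl_eq] at h
    · intro a ha p hp
      exact hp.1 ha
  refine ⟨⟨?_, fun p => ?_⟩, hrealm, ?_⟩
  · obtain ⟨q, hq, -⟩ := hdense (f.symm ⟨⟨∅, ∅⟩, C.cond_trivial⟩)
    exact ⟨q, hq⟩
  · rw [hrealm]
    exact hdense p
  · intro p y π hπ hxp hpy
    have hpy : (f p).1.dom ⊆ y := hpy
    have hxp : x ⊆ (f p).1.dom := hxp
    have hact : (f (((C.sharpForcing hD).congr f).act y π p)).1 = (f p).1.move π := by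
      change (f (f.symm (C.act y π (f p)))).1 = _
      rw [f.apply_symm_apply, act_val hπ hpy]
    have hme : MapsTo e (Iio E.θ) (f p).1.dom := by
      rw [mapsTo_iff_image_subset, ← hx]; exact hxp
    have hmono : StrictMonoOn (π ∘ e) (Iio E.θ) :=
      (hπ.strictMonoOn.mono hpy).comp he.strictMonoOn hme
    rw [mem_ofPred_eq, mem_ofPred_eq, hact]
    constructor
    · rintro ⟨-, e', h1, h2, h3⟩
      have heq := h1.eqOn_of_image_eq he.strictMonoOn (h2.trans hx)
      refine ⟨image_mono hxp, π ∘ e, hmono, by rw [image_comp, ← hx], ?_⟩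
      rw [E.move e _ π (f p).2.wf hme (hπ.strictMonoOn.mono hpy)]
      exact E.congr _ _ _ heq h3
    · rintro ⟨-, e', h1, h2, h3⟩
      have heq := h1.eqOn_of_image_eq hmono (by rw [h2, image_comp, ← hx])
      refine ⟨hxp, e, he.strictMonoOn, hx.symm, ?_⟩
      rw [← E.move e _ π (f p).2.wf hme (hπ.strictMonoOn.mono hpy)]
      exact E.congr _ _ _ heq h3

/-- The forcing axiom, for classes of complete preconditions. -/
theorem exists_generic [Infinite L] (hFA : ForcingAxiom (Order.succ #L))
    (hD : #D ≤ Order.succ #L) {I : Type u} [Nonempty I] (hI : #I ≤ Order.succ #L)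
    (E : I → C.DenseSystem) :
    ∃ G : Set (Pre D), DirectedOn (· ≥ ·) G ∧ (∀ p ∈ G, ∃ t, C.Full t ∧ t ≤ p) ∧
      ∀ i e, IsCoi (succOrd (Order.succ #L)) (Iio (E i).θ) e →
        ∃ p ∈ G, MapsTo e (Iio (E i).θ) p.dom ∧ (E i).Φ e p := by
  have := C.small_conditions
  let _ : Preorder (Shrink.{u} C.Conditions) := Preorder.lift (equivShrink C.Conditions).symm
  let f : Shrink.{u} C.Conditions ≃o C.Conditions :=
    { toEquiv := (equivShrink C.Conditions).symm, map_rel_iff' := Iff.rfl }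
  have hI' : Cardinal.lift.{u + 1} #I ≤ Cardinal.lift.{u} #(Iio (Order.succ #L).ord) := by
    rw [Cardinal.mk_Iio_ordinal, Cardinal.card_ord]
    rw [Cardinal.lift_id'.{u, u + 1}]
    exact Cardinal.lift_le.2 hI
  obtain ⟨j⟩ := Cardinal.lift_mk_le'.1 hI'
  -- The axiom indexes its systems by the ordinals below κ; g is a left inverse of an injection of
  -- `I` into them.
  let g : Ordinal.{u} → I := Function.invFun fun i => (j i).1
  have hg : ∀ i, g (j i).1 = i :=
    Function.leftInverse_invFun (f := fun i => (j i).1) fun a b h => j.injective (Subtype.ext h)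
  obtain ⟨G, hG⟩ := hFA (Shrink.{u} C.Conditions) ((C.sharpForcing hD).congr f) _
    fun o _ => (E (g o)).isSharplyDenseSystem hD f
  refine ⟨(fun p => (f p).1) '' (G : Set _), ?_, ?_, ?_⟩
  · rintro _ ⟨p, hp, rfl⟩ _ ⟨q, hq, rfl⟩
    obtain ⟨r, hr, h1, h2⟩ := G.directed p hp q hq
    exact ⟨_, ⟨r, hr, rfl⟩, f.monotone h1, f.monotone h2⟩
  · rintro _ ⟨p, hp, rfl⟩
    obtain ⟨t, h1, h2, -⟩ := (f p).2.exists_full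
    exact ⟨t, h1, h2⟩
  · intro i e he
    obtain ⟨p, hp, h⟩ := hG (j i).1 (j i).2 _ ⟨e '' Iio (E i).θ, by
      rw [hg]; exact ⟨e, he, rfl⟩, rfl⟩
    rw [hg] at h
    obtain ⟨h1, e', h2, h3, h4⟩ := h
    exact ⟨_, ⟨p, hp, rfl⟩, mapsTo_iff_image_subset.2 h1, (E i).congr _ _ _
      (h2.eqOn_of_image_eq he.strictMonoOn h3) h4⟩

end FullClass

/-! ### Codings, and 2^λ ≤ λ⁺ -/

theorem Pre.mem_move_facts_iff {L D : Type u} {p : Pre D} {π : Ordinal.{u} → Ordinal.{u}}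
    (hp : p.Wf L) (hπ : InjOn π p.dom) {a b : Ordinal.{u}} (ha : a ∈ p.dom) (hb : b ∈ p.dom)
    {d : D} : (π a, π b, d) ∈ (p.move π).facts ↔ (a, b, d) ∈ p.facts := by
  constructor
  · rintro ⟨f, hf, h⟩
    simp only [Pre.moveFact, Prod.mk.injEq] at h
    have h1 := hπ (hp.fst_mem f hf) ha h.1
    have h2 := hπ (hp.snd_mem f hf) hb h.2.1
    have : f = (a, b, d) := Prod.ext h1 (Prod.ext h2 h.2.2)
    rwa [← this]
  · intro h
    exact ⟨_, h, rfl⟩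

/-- Well-formed preconditions in which the upper ordinal and the datum of a fact determine its lower
ordinal. -/
structure IsCoding (L : Type u) {D : Type u} (p : Pre D) : Prop where
  wf : p.Wf L
  inj : ∀ a b β d, (a, β, d) ∈ p.facts → (b, β, d) ∈ p.facts → a = b

/-- The class of codings. -/
def codingClass (L D : Type u) [Infinite L] : FullClass L D where
  Full := IsCoding L
  wf h := h.wf
  trivial := by
    have : Nonempty L := inferInstance
    refine ⟨⟨Few.empty, empty_subset _, Few.empty, ?_, ?_, ?_⟩, ?_⟩ <;> simp
  cut h α := ⟨h.wf.cut α, fun a b β d h1 h2 => h.inj a b β d h1.1 h2.1⟩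
  move {p} h π hπ hm := by
    refine ⟨h.wf.move hπ hm, ?_⟩
    rintro a b β d ⟨f, hf, h1⟩ ⟨g, hg, h2⟩
    simp only [Pre.moveFact, Prod.mk.injEq] at h1 h2
    obtain ⟨rfl, rfl, rfl⟩ := h1
    obtain ⟨rfl, h3, h4⟩ := h2
    have h5 := hπ.injOn (h.wf.snd_mem g hg) (h.wf.snd_mem f hf) h3
    congr 1
    refine h.inj _ _ f.2.1 f.2.2 hf ?_
    rw [← h5, ← h4]
    exact hg
  sup S hne hS hc h := by
    refine ⟨Pre.Wf.sup hS fun p hp => (h p hp).wf, fun a b β d h1 h2 => ?_⟩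
    obtain ⟨p, hp, h1⟩ := Pre.mem_sup_facts.1 h1
    obtain ⟨q, hq, h2⟩ := Pre.mem_sup_facts.1 h2
    rcases hc.total hp hq with hle | hle
    · exact (h p hp).inj a b β d h1 (hle.2 h2)
    · exact (h q hq).inj a b β d (hle.2 h1) h2
  extend {p} h x hx hf hlt := by
    refine ⟨⟨x, p.facts⟩, ⟨⟨hf, hlt, h.wf.facts_few, h.wf.fst_le, fun f hf => hx (h.wf.fst_mem f hf),
      fun f hf => hx (h.wf.snd_mem f hf)⟩, h.inj⟩, ⟨hx, subset_rfl⟩, rfl, fun α hα => ?_⟩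
    exact Pre.ext (Subset.antisymm (subset_inter hα inter_subset_right)
      (inter_subset_inter_left _ hx)) rfl
  amalg {p q} hp _ hq α hle hqα := by
    refine ⟨p.union q, ⟨hp.wf.union hq.wf, fun a b β d h1 h2 => ?_⟩,
      ⟨subset_union_left, subset_union_left⟩, ⟨subset_union_right, subset_union_right⟩, rfl⟩
    -- Facts of p and q with the same upper ordinal lie below α, where q already contains p. So
    -- injectivity needs no choice in amalgamation.
    have key : ∀ f ∈ p.facts, ∀ g ∈ q.facts, g.2.1 = f.2.1 → f ∈ q.facts := fun f hf g hg h =>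
      hle.2 ⟨hf, h ▸ hqα (hq.wf.snd_mem g hg)⟩
    rcases h1 with h1 | h1 <;> rcases h2 with h2 | h2
    · exact hp.inj _ _ _ _ h1 h2
    · exact hq.inj _ _ _ _ (key _ h1 _ h2 rfl) h2
    · exact hq.inj _ _ _ _ h1 (key _ h2 _ h1 rfl)
    · exact hq.inj _ _ _ _ h1 h2
  splice {u r} hu hr α hrα hle _ := by
    refine ⟨u.union r, ⟨hu.wf.union hr.wf, fun a b β d h1 h2 => ?_⟩,
      ⟨subset_union_left, subset_union_left⟩, rfl, Pre.ext ?_ ?_⟩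
    · have key : ∀ f ∈ u.facts, ∀ g ∈ r.facts, g.2.1 = f.2.1 → f ∈ r.facts := fun f hf g hg h =>
        hle.2 ⟨hf, h ▸ hrα (hr.wf.snd_mem g hg)⟩
      rcases h1 with h1 | h1 <;> rcases h2 with h2 | h2
      · exact hu.inj _ _ _ _ h1 h2
      · exact hr.inj _ _ _ _ (key _ h1 _ h2 rfl) h2
      · exact hr.inj _ _ _ _ h1 (key _ h2 _ h1 rfl)
      · exact hr.inj _ _ _ _ h1 h2
    · ext a
      constructor
      · rintro ⟨h | h, hlt⟩
        exacts [hle.1 ⟨h, hlt⟩, h]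
      · exact fun h => ⟨Or.inr h, hrα h⟩
    · ext f
      constructor
      · rintro ⟨h | h, hlt⟩
        exacts [hle.2 ⟨h, hlt⟩, h]
      · exact fun h => ⟨Or.inr h, hrα (hr.wf.snd_mem f h)⟩

/-- An enumeration of `(#L).ord` by `L`. -/
theorem exists_enum_ord (L : Type u) : ∃ ι : L → Ordinal.{u}, Function.Injective ι ∧
    Set.range ι = Iio (#L).ord := by
  have h : Cardinal.lift.{u + 1} #L = Cardinal.lift.{u} #(Iio (#L).ord) := by
    rw [Cardinal.mk_Iio_ordinal, Cardinal.card_ord, Cardinal.lift_id'.{u, u + 1}]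
  obtain ⟨e⟩ := Cardinal.lift_mk_eq'.1 h
  refine ⟨fun l => (e l).1, fun a b h => e.injective (Subtype.ext h), ?_⟩
  ext a
  exact ⟨by rintro ⟨l, rfl⟩; exact (e l).2, fun ha => ⟨e.symm ⟨a, ha⟩, by simp⟩⟩

open Classical in
/-- The sequence `i ↦ 2 * i`, shifted by one at the successors of the elements of `A`. -/
noncomputable def shiftSeq (A : Set Ordinal.{u}) (i : Ordinal.{u}) : Ordinal.{u} :=
  2 * i + if ∃ j ∈ A, i = Order.succ j then 1 else 0

theorem two_mul_le_shiftSeq (A : Set Ordinal.{u}) (i : Ordinal.{u}) : 2 * i ≤ shiftSeq A i :=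
  le_self_add

theorem shiftSeq_lt (A : Set Ordinal.{u}) (i : Ordinal.{u}) :
    shiftSeq A i < 2 * Order.succ i := by
  rw [Order.succ_eq_add_one, mul_add, mul_one, shiftSeq]
  gcongr
  split_ifs <;> norm_num

theorem shiftSeq_strictMono (A : Set Ordinal.{u}) : StrictMono (shiftSeq A) := fun i j h =>
  (shiftSeq_lt A i).trans_le
    ((mul_le_mul_right (Order.succ_le_of_lt h) 2).trans (two_mul_le_shiftSeq A j))

/-- Limit values cannot carry information, as continuity determines them; this is why a set is coded
at successors only. In particular the value at λ is the same for all sets. -/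
theorem shiftSeq_of_limit (A : Set Ordinal.{u}) {i : Ordinal.{u}} (h : Order.IsSuccPrelimit i) :
    shiftSeq A i = 2 * i := by
  rw [shiftSeq, if_neg, add_zero]
  rintro ⟨j, -, rfl⟩
  exact Order.not_isSuccPrelimit_succ j h

theorem isCoi_shiftSeq (L : Type u) [Infinite L] (A : Set Ordinal.{u}) :
    IsCoi (succOrd (Order.succ #L)) (Iio (Order.succ (#L).ord)) (shiftSeq A) := by
  have h0 := Cardinal.aleph0_le_mk L
  have hlim : Order.IsSuccLimit (#L).ord := Cardinal.isSuccLimit_ord h0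
  have hlt : ∀ i < Order.succ (#L).ord, shiftSeq A i < succOrd (Order.succ #L) := by
    intro i hi
    have h1 : shiftSeq A i ≤ 2 * (#L).ord := by
      rw [← shiftSeq_of_limit A hlim.isSuccPrelimit]
      exact (shiftSeq_strictMono A).monotone (Order.lt_succ_iff.1 hi)
    refine h1.trans_lt ?_
    rw [succOrd, Cardinal.lt_ord, Ordinal.card_mul, Cardinal.card_ord]
    have h2 : Ordinal.card 2 ≤ #L := by
      have : Ordinal.card 2 = 2 := by simp
      rw [this]
      exact (Cardinal.natCast_lt_aleph0 (n := 2)).le.trans h0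
    calc Ordinal.card 2 * #L ≤ #L * #L := mul_le_mul_left h2 _
      _ = #L := Cardinal.mul_eq_self h0
      _ < Order.succ #L := Order.lt_succ _
      _ < Order.succ (Order.succ #L) := Order.lt_succ _
  refine ⟨fun i hi => ?_, closedInSup_Iio _, fun i hi => hlt i hi,
    (shiftSeq_strictMono A).strictMonoOn _, fun δ hδ hδ0 hs => ?_⟩
  · exact ((shiftSeq_strictMono A).le_apply).trans_lt (hlt i hi)
  · rw [sSup_inter_eq_iff hδ0] at hs
    have hl : Order.IsSuccPrelimit δ := by
      intro a ha
      obtain ⟨γ, -, h1, h2⟩ := hs a ha.lt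
      exact ha.2 h1 h2
    have hb : BddAbove (shiftSeq A '' (Iio (Order.succ (#L).ord) ∩ Iio δ)) := by
      refine ⟨shiftSeq A δ, ?_⟩
      rintro _ ⟨γ, hγ, rfl⟩
      exact ((shiftSeq_strictMono A) hγ.2).le
    apply le_antisymm
    · rw [shiftSeq_of_limit A hl]
      refine le_of_forall_lt fun a ha => ?_
      obtain ⟨c, hc, hac⟩ := (Ordinal.lt_mul_iff_of_isSuccLimit
        ((Order.isSuccLimit_iff _).2 ⟨by simpa using hδ0.ne', hl⟩)).1 ha
      exact (hac.trans_le (two_mul_le_shiftSeq A c)).trans_le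
        (le_csSup hb ⟨c, ⟨lt_trans hc hδ, hc⟩, rfl⟩)
    · refine csSup_le' ?_
      rintro _ ⟨γ, hγ, rfl⟩
      exact ((shiftSeq_strictMono A) hγ.2).le

/-- The forcing axiom at a successor cardinal implies an instance of the generalized continuum
hypothesis. -/
theorem two_power_le_of_forcingAxiom {L : Type u} [Infinite L]
    (hFA : ForcingAxiom (Order.succ #L)) : 2 ^ #L ≤ Order.succ #L := by
  obtain ⟨K, hK⟩ : ∃ K : Type u, #K = Order.succ #L := ⟨(Order.succ #L).out, Cardinal.mk_out _⟩
  have hLK : #L < #K := hK ▸ Order.lt_succ _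
  have h0 := Cardinal.aleph0_le_mk L
  obtain ⟨ι, hι, hιr⟩ := exists_enum_ord L
  set o := (#L).ord with ho
  have hlim : Order.IsSuccLimit o := Cardinal.isSuccLimit_ord h0
  have hιlt : ∀ l, ι l < o := fun l => hιr.subset ⟨l, rfl⟩
  have hD : #(K × L) ≤ Order.succ #L := by
    rw [Cardinal.mk_prod, Cardinal.lift_id, Cardinal.lift_id, hK]
    exact Cardinal.mul_le_of_le (h0.trans (Order.le_succ _)) le_rfl (Order.le_succ _)
  have hθ : Order.succ o < (Order.succ #L).ord :=
    (Cardinal.isSuccLimit_ord (h0.trans (Order.le_succ _))).succ_lt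
      (Cardinal.ord_lt_ord.2 (Order.lt_succ _))
  have hιθ : ∀ l, ι l ∈ Iio (Order.succ o) := fun l => (hιlt l).trans (Order.lt_succ _)
  have hoθ : o ∈ Iio (Order.succ o) := Order.lt_succ o
  -- ξ is a name of the copy e of λ + 1: over the top of the copy, the datum (ξ, l) is attached to
  -- its point with index `ι l`.
  let E : (codingClass L (K × L)).DenseSystem :=
    { θ := Order.succ o
      Φ := fun e p => ∃ ξ : K, ∀ l : L, (e (ι l), e o, (ξ, l)) ∈ p.facts
      θ_lt := hθ
      congr := by
        rintro e e' p he ⟨ξ, h⟩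
        exact ⟨ξ, fun l => by rw [← he (hιθ l), ← he hoθ]; exact h l⟩
      move := by
        intro e p π hp he hπ
        refine exists_congr fun ξ => forall_congr' fun l => ?_
        exact Pre.mem_move_facts_iff hp hπ.injOn (he (hιθ l)) (he hoθ)
      dense := by
        rintro e q hq - he hm
        -- A name that q does not use at all, so that the new facts cannot conflict with old ones.
        obtain ⟨ξ, hξ⟩ := Few.exists_notMem hLK (hq.wf.facts_few.image fun f => f.2.2.1)
        have hnew : ∀ a b l, (a, b, (ξ, l)) ∉ q.facts := fun a b l h => hξ ⟨_, h, rfl⟩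
        refine ⟨⟨q.dom, q.facts ∪ Set.range fun l => (e (ι l), e o, (ξ, l))⟩,
          ⟨⟨hq.wf.dom_few, hq.wf.dom_lt, hq.wf.facts_few.union (Few.range _), ?_, ?_, ?_⟩, ?_⟩,
          ⟨subset_rfl, subset_union_left⟩, rfl, ξ, fun l => Or.inr ⟨l, rfl⟩⟩
        · rintro f (hf | ⟨l, rfl⟩)
          exacts [hq.wf.fst_le f hf, (he (hιθ l) hoθ (hιlt l)).le]
        · rintro f (hf | ⟨l, rfl⟩)
          exacts [hq.wf.fst_mem f hf, hm (hιθ l)]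
        · rintro f (hf | ⟨l, rfl⟩)
          exacts [hq.wf.snd_mem f hf, hm hoθ]
        · rintro a b β ⟨ξ', l⟩ (h1 | ⟨l1, h1⟩) (h2 | ⟨l2, h2⟩)
          · exact hq.inj _ _ _ _ h1 h2
          · simp only [Prod.mk.injEq] at h2
            exact absurd (h2.2.2.1 ▸ h1) (hnew _ _ _)
          · simp only [Prod.mk.injEq] at h1
            exact absurd (h1.2.2.1 ▸ h2) (hnew _ _ _)
          · simp only [Prod.mk.injEq] at h1 h2
            rw [← h1.1, ← h2.1, h1.2.2.2, h2.2.2.2] }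
  obtain ⟨G, hdir, hfull, hG⟩ := (codingClass L (K × L)).exists_generic hFA hD (I := PUnit.{u + 1})
    (by simpa using (Cardinal.one_le_aleph0.trans h0).trans (Order.le_succ _)) fun _ => E
  choose p hp _ ξ hξ using fun A : Set L => hG PUnit.unit (shiftSeq (ι '' A)) (isCoi_shiftSeq L _)
  have hinj : Function.Injective ξ := by
    have key : ∀ A B : Set L, ξ A = ξ B → A ⊆ B := by
      intro A B hAB l hl
      obtain ⟨r, hr, hr1, hr2⟩ := hdir _ (hp A) _ (hp B)
      obtain ⟨t, ht, htr⟩ := hfull r hr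
      obtain ⟨l', hl'⟩ : Order.succ (ι l) ∈ Set.range ι := by
        rw [hιr]; exact hlim.succ_lt (hιlt l)
      have h1 := (htr.trans hr1).2 (hξ A l')
      have h2 := (htr.trans hr2).2 (hξ B l')
      -- The two copies have the same top and the same name, so `inj` identifies their points at the
      -- successor of `ι l`, where membership of l is coded.
      rw [shiftSeq_of_limit _ hlim.isSuccPrelimit] at h1 h2
      rw [← hAB] at h2
      have h3 := ht.inj _ _ _ _ h1 h2
      rw [hl', shiftSeq, shiftSeq, if_pos ⟨ι l, ⟨l, hl, rfl⟩, rfl⟩] at h3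
      have h4 := add_left_cancel h3
      by_contra hcon
      rw [if_neg] at h4
      · exact one_ne_zero h4
      · rintro ⟨_, ⟨m, hm, rfl⟩, h5⟩
        rw [hι (Order.succ_injective h5)] at hl hcon
        exact hcon hm
    exact fun A B h => (key A B h).antisymm (key B A h.symm)
  have := Cardinal.mk_le_of_injective hinj
  rwa [Cardinal.mk_set, hK] at this

/-! ### Coloured trees of small size -/

/-- Tree orders with nodes `(γ, ξ)`, where `γ` is the level of the node, taken from `x`. The relation
is reflexive exactly at the nodes of the tree. -/
structure IsTree {K : Type u} (x : Set Ordinal.{u})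
    (le : Ordinal.{u} × K → Ordinal.{u} × K → Prop) : Prop where
  lev_le : ∀ {a b}, le a b → a.1 ≤ b.1
  lev_mem : ∀ {a}, le a a → a.1 ∈ x
  left : ∀ {a b}, le a b → le a a
  right : ∀ {a b}, le a b → le b b
  trans : ∀ {a b c}, le a b → le b c → le a c
  pred : ∀ {a γ}, le a a → γ ∈ x → γ ≤ a.1 → ∃ η, le (γ, η) a
  uniq : ∀ {a γ η η'}, le (γ, η) a → le (γ, η') a → η = η'

namespace IsTree

variable {K : Type u} {x : Set Ordinal.{u}} {le : Ordinal.{u} × K → Ordinal.{u} × K → Prop}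
  {a b c : Ordinal.{u} × K}

theorem le_of_lev_le (h : IsTree x le) (ha : le a c) (hb : le b c) (hab : a.1 ≤ b.1) :
    le a b := by
  obtain ⟨η, hη⟩ := h.pred (h.left hb) (h.lev_mem (h.left ha)) hab
  have : η = a.2 := h.uniq (h.trans hη hb) ha
  rwa [this] at hη

theorem comparable (h : IsTree x le) (ha : le a c) (hb : le b c) : le a b ∨ le b a :=
  (le_total a.1 b.1).imp (h.le_of_lev_le ha hb) (h.le_of_lev_le hb ha)

theorem eq_of_lev_eq (h : IsTree x le) (hab : le a b) (heq : a.1 = b.1) : a = b := by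
  refine Prod.ext heq (h.uniq (a := b) (γ := a.1) hab ?_)
  rw [heq]
  exact h.right hab

theorem le_of_comparable (h : IsTree x le) (hab : le a b ∨ le b a) (hl : a.1 ≤ b.1) : le a b := by
  rcases hab with hab | hab
  · exact hab
  · have e := h.eq_of_lev_eq hab (le_antisymm (h.lev_le hab) hl)
    rwa [e] at hab ⊢

theorem comparable_mono (h : IsTree x le) {a' b' : Ordinal.{u} × K} (hab : le a b ∨ le b a)
    (ha : le a' a) (hb : le b' b) : le a' b' ∨ le b' a' := by
  rcases hab with hab | hab
  · exact h.comparable (h.trans ha hab) hb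
  · exact h.comparable ha (h.trans hb hab)

end IsTree

/-- Colours: `(ε, γ, s, t, ζ)` says that `ζ` is a colour of the pair of the level sequences
`i ↦ (ε, s i)` and `i ↦ (γ, t i)`. -/
abbrev Colour (L K : Type u) := Ordinal.{u} × Ordinal.{u} × (L → K) × (L → K) × K

/-- The data of the facts of coloured trees: pairs of nodes, and colours. -/
abbrev TreeDatum (L K : Type u) := (K × K) ⊕ ((L → K) × (L → K) × K)

section Build

variable {L K : Type u}

/-- The requirements on the colours of a coloured tree. -/
structure IsColoured (le : Ordinal.{u} × K → Ordinal.{u} × K → Prop)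
    (R : Set (Colour L K)) : Prop where
  inj : ∀ {ε γ s t ζ}, (ε, γ, s, t, ζ) ∈ R → Function.Injective s
  above : ∀ {ε γ s t ζ}, (ε, γ, s, t, ζ) ∈ R → ∀ i, le (ε, s i) (γ, t i)
  compat : ∀ {ε γ γ' s t t' ζ}, (ε, γ, s, t, ζ) ∈ R → (ε, γ', s, t', ζ) ∈ R →
    Nonempty (L ↪ {i | le (γ, t i) (γ', t' i) ∨ le (γ', t' i) (γ, t i)})

/-- The downward closure of a set of colours. -/
def downClosure (x : Set Ordinal.{u}) (le : Ordinal.{u} × K → Ordinal.{u} × K → Prop)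
    (R : Set (Colour L K)) : Set (Colour L K) :=
  {c | c.2.1 ∈ x ∧ c.1 ≤ c.2.1 ∧ ∃ γ t, (c.1, γ, c.2.2.1, t, c.2.2.2.2) ∈ R ∧
    ∀ i, le (c.2.1, c.2.2.2.1 i) (γ, t i)}

/-- Predecessors of comparable nodes are comparable, so the indices of compatibility persist on
lower levels. -/
theorem IsColoured.downClosure {x : Set Ordinal.{u}}
    {le : Ordinal.{u} × K → Ordinal.{u} × K → Prop} {R : Set (Colour L K)} (hT : IsTree x le)
    (h : IsColoured le R) : IsColoured le (downClosure x le R) where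
  inj := by
    rintro ε δ s t ζ ⟨-, -, γ, t', hR, -⟩
    exact h.inj hR
  above := by
    rintro ε δ s t ζ ⟨-, hle, γ, t', hR, hlt⟩ i
    exact hT.le_of_lev_le (h.above hR i) (hlt i) hle
  compat := by
    rintro ε δ δ' s t t' ζ ⟨-, -, γ, u, hR, hlt⟩ ⟨-, -, γ', u', hR', hlt'⟩
    obtain ⟨f⟩ := h.compat hR hR'
    exact ⟨f.trans (embeddingOfSubset _ _ fun i hi => hT.comparable_mono hi (hlt i) (hlt' i))⟩

theorem subset_downClosure {x : Set Ordinal.{u}} {le : Ordinal.{u} × K → Ordinal.{u} × K → Prop}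
    {R : Set (Colour L K)} [Nonempty L] (hT : IsTree x le) (h : IsColoured le R) :
    R ⊆ downClosure x le R := by
  rintro ⟨ε, γ, s, t, ζ⟩ hc
  let i := Classical.arbitrary L
  have := h.above hc
  exact ⟨hT.lev_mem (hT.right (this i)), hT.lev_le (this i), γ, t, hc, fun i => hT.right (this i)⟩

/-- A colour and a level below it determine the lower sequence, by uniqueness of predecessors. -/
theorem Few.downClosure {x : Set Ordinal.{u}} {le : Ordinal.{u} × K → Ordinal.{u} × K → Prop}
    {R : Set (Colour L K)} [Infinite L] (hT : IsTree x le) (hx : Few L x) (hR : Few L R) :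
    Few L (downClosure x le R) := by
  have : Nonempty L := inferInstance
  refine (hR.biUnion (f := fun c => ⋃ δ ∈ x, {d | d.1 = c.1 ∧ d.2.1 = δ ∧ d.2.2.1 = c.2.2.1 ∧
    d.2.2.2.2 = c.2.2.2.2 ∧ ∀ i, le (δ, d.2.2.2.1 i) (c.2.1, c.2.2.2.1 i)}) fun c _ =>
    hx.biUnion fun δ _ => Few.of_subsingleton ?_).mono ?_
  · rintro ⟨ε, δ', s, t, ζ⟩ ⟨h1, h2, h3, h4, h5⟩ ⟨ε₁, δ₁, s₁, t₁, ζ₁⟩ ⟨h1', h2', h3', h4', h5'⟩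
    dsimp only at *
    have : t = t₁ := funext fun i => hT.uniq (h5 i) (h5' i)
    subst h1 h2 h3 h4 h1' h2' h3' h4' this
    rfl
  · rintro ⟨ε, δ, s, t, ζ⟩ ⟨hδ, -, γ, t', hc, hlt⟩
    exact mem_biUnion hc (mem_biUnion hδ ⟨rfl, rfl, rfl, rfl, hlt⟩)

namespace Pre

/-- The tree order of a precondition. -/
def Le (p : Pre (TreeDatum L K)) (a b : Ordinal.{u} × K) : Prop :=
  (a.1, b.1, Sum.inl (a.2, b.2)) ∈ p.facts

/-- The colours of a precondition. -/
def col (p : Pre (TreeDatum L K)) : Set (Colour L K) :=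
  {c | (c.1, c.2.1, Sum.inr c.2.2) ∈ p.facts}

theorem mem_col {p : Pre (TreeDatum L K)} {c : Colour L K} :
    c ∈ p.col ↔ (c.1, c.2.1, Sum.inr c.2.2) ∈ p.facts := Iff.rfl

/-- The precondition with a given realm, order and set of colours. -/
def ofTree (x : Set Ordinal.{u}) (le : Ordinal.{u} × K → Ordinal.{u} × K → Prop)
    (R : Set (Colour L K)) : Pre (TreeDatum L K) :=
  ⟨x, {f | Sum.elim (fun d => le (f.1, d.1) (f.2.1, d.2)) (fun d => (f.1, f.2.1, d) ∈ R) f.2.2}⟩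

theorem le_iff {p q : Pre (TreeDatum L K)} : q ≤ p ↔ p.dom ⊆ q.dom ∧
    (∀ a b, p.Le a b → q.Le a b) ∧ p.col ⊆ q.col := by
  refine ⟨fun h => ⟨h.1, fun a b hab => h.2 hab, fun c hc => h.2 hc⟩, fun h => ⟨h.1, ?_⟩⟩
  rintro ⟨a, b, d | d⟩ hf
  · exact h.2.1 (a, d.1) (b, d.2) hf
  · exact h.2.2 (show (a, b, d) ∈ p.col from hf)

theorem Few.col {p : Pre (TreeDatum L K)} (h : p.Wf L) : Few L p.col := by
  refine h.facts_few.preimage (f := fun c : Colour L K => (c.1, c.2.1, Sum.inr c.2.2)) ?_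
  rintro ⟨a, b, c⟩ - ⟨a', b', c'⟩ - heq
  simpa using heq

theorem Few.nodes {p : Pre (TreeDatum L K)} (h : p.Wf L) : Few L {a | p.Le a a} := by
  refine h.facts_few.preimage (f := fun a : Ordinal.{u} × K => (a.1, a.1, Sum.inl (a.2, a.2))) ?_
  rintro ⟨a, b⟩ - ⟨a', b'⟩ - heq
  simp only [Prod.mk.injEq, Sum.inl.injEq] at heq
  exact Prod.ext heq.1 heq.2.2.1

end Pre

/-- The complete preconditions: coloured trees of small size. -/
structure IsColouredTree (L : Type u) {K : Type u} (p : Pre (TreeDatum L K)) : Prop where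
  wf : p.Wf L
  tree : IsTree p.dom p.Le
  coloured : IsColoured p.Le p.col
  down : downClosure p.dom p.Le p.col ⊆ p.col

/-- Reduces every later construction to giving a tree order and colours that need not be closed
downward. -/
theorem isColouredTree_ofTree [Infinite L] {x : Set Ordinal.{u}}
    {le : Ordinal.{u} × K → Ordinal.{u} × K → Prop} {R : Set (Colour L K)} (hx : Few L x)
    (hlt : x ⊆ Iio (succOrd (Order.succ #L))) (hT : IsTree x le) (hn : Few L {a | le a a})
    (hR : Few L R) (h : IsColoured le R) :
    IsColouredTree L (Pre.ofTree x le (downClosure x le R)) where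
  wf := by
    have hmem : ∀ f ∈ (Pre.ofTree x le (downClosure x le R)).facts,
        f.1 ≤ f.2.1 ∧ f.1 ∈ x ∧ f.2.1 ∈ x := by
      rintro ⟨a, b, d | ⟨s, t, ζ⟩⟩ hf
      · have hf : le (a, d.1) (b, d.2) := hf
        exact ⟨hT.lev_le hf, hT.lev_mem (hT.left hf), hT.lev_mem (hT.right hf)⟩
      · have hf : (a, b, s, t, ζ) ∈ downClosure x le R := hf
        have hle := (h.downClosure hT).above hf (Classical.arbitrary L)
        exact ⟨hf.2.1, hT.lev_mem (hT.left hle), hf.1⟩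
    refine ⟨hx, hlt, ?_, fun f hf => (hmem f hf).1, fun f hf => (hmem f hf).2.1,
      fun f hf => (hmem f hf).2.2⟩
    refine (((hn.prod hn).image fun c => (c.1.1, c.2.1, Sum.inl (c.1.2, c.2.2))).union
      ((Few.downClosure hT hx hR).image fun c => (c.1, c.2.1, Sum.inr c.2.2))).mono ?_
    rintro ⟨a, b, d | d⟩ hf
    · have hf : le (a, d.1) (b, d.2) := hf
      exact Or.inl ⟨((a, d.1), (b, d.2)), ⟨hT.left hf, hT.right hf⟩, rfl⟩
    · exact Or.inr ⟨(a, b, d), hf, rfl⟩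
  tree := hT
  coloured := h.downClosure hT
  down := by
    rintro ⟨ε, δ, s, t, ζ⟩ ⟨h1, h2, γ, t', ⟨h3, h4, γ', t'', h5, h6⟩, h7⟩
    exact ⟨h1, h2, γ', t'', h5, fun i => hT.trans (h7 i) (h6 i)⟩

namespace IsColouredTree

variable {p q r u : Pre (TreeDatum L K)} {α : Ordinal.{u}}

theorem down' (h : IsColouredTree L p) {ε γ δ : Ordinal.{u}} {s t t' : L → K} {ζ : K}
    (hc : (ε, γ, s, t, ζ) ∈ p.col) (hδ : δ ∈ p.dom) (hε : ε ≤ δ)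
    (hle : ∀ i, p.Le (δ, t' i) (γ, t i)) : (ε, δ, s, t', ζ) ∈ p.col :=
  h.down ⟨hδ, hε, γ, t, hc, hle⟩

/-- The restriction of a coloured level sequence to a lower level. -/
theorem exists_restrict (h : IsColouredTree L p) {ε γ δ : Ordinal.{u}} {s t : L → K} {ζ : K}
    (hc : (ε, γ, s, t, ζ) ∈ p.col) (hδ : δ ∈ p.dom) (hε : ε ≤ δ) (hγ : δ ≤ γ) :
    ∃ t', (ε, δ, s, t', ζ) ∈ p.col ∧ ∀ i, p.Le (δ, t' i) (γ, t i) := by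
  choose t' ht' using fun i => h.tree.pred (a := (γ, t i)) (γ := δ)
    (h.tree.right (h.coloured.above hc i)) hδ hγ
  exact ⟨t', h.down' hc hδ hε ht', ht'⟩

theorem trivial (L K : Type u) [Infinite L] :
    IsColouredTree L (⟨∅, ∅⟩ : Pre (TreeDatum L K)) := by
  have : Nonempty L := inferInstance
  refine ⟨⟨Few.empty, empty_subset _, Few.empty, ?_, ?_, ?_⟩, ⟨?_, ?_, ?_, ?_, ?_, ?_, ?_⟩,
    ⟨?_, ?_, ?_⟩, ?_⟩ <;> simp [Pre.Le, Pre.col, downClosure]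

theorem cut (h : IsColouredTree L p) (α : Ordinal.{u}) : IsColouredTree L (p.cut α) where
  wf := h.wf.cut α
  tree :=
    { lev_le := fun hab => h.tree.lev_le hab.1
      lev_mem := fun ha => ⟨h.tree.lev_mem ha.1, ha.2⟩
      left := fun hab => ⟨h.tree.left hab.1, (h.tree.lev_le hab.1).trans_lt hab.2⟩
      right := fun hab => ⟨h.tree.right hab.1, hab.2⟩
      trans := fun hab hbc => ⟨h.tree.trans hab.1 hbc.1, hbc.2⟩
      pred := fun ha hγ hle => by
        obtain ⟨η, hη⟩ := h.tree.pred ha.1 hγ.1 hle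
        exact ⟨η, hη, ha.2⟩
      uniq := fun hη hη' => h.tree.uniq hη.1 hη'.1 }
  coloured :=
    { inj := fun hc => h.coloured.inj hc.1
      above := fun hc i => ⟨h.coloured.above hc.1 i, hc.2⟩
      compat := fun hc hc' => by
        obtain ⟨f⟩ := h.coloured.compat hc.1 hc'.1
        exact ⟨f.trans (embeddingOfSubset _ _ fun i hi => hi.imp (⟨·, hc'.2⟩) (⟨·, hc.2⟩))⟩ }
  down := by
    rintro ⟨ε, δ, s, t, ζ⟩ ⟨h1, h2, γ, t', hc, hle⟩
    exact ⟨h.down' hc.1 h1.1 h2 fun i => (hle i).1, h1.2⟩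

theorem Le_move_iff {π : Ordinal.{u} → Ordinal.{u}} {a b : Ordinal.{u} × K} :
    (p.move π).Le a b ↔ ∃ γ δ, π γ = a.1 ∧ π δ = b.1 ∧ p.Le (γ, a.2) (δ, b.2) := by
  constructor
  · rintro ⟨⟨γ, δ, d⟩, hf, heq⟩
    simp only [Pre.moveFact, Prod.mk.injEq] at heq
    refine ⟨γ, δ, heq.1, heq.2.1, ?_⟩
    rw [Pre.Le, ← heq.2.2]
    exact hf
  · rintro ⟨γ, δ, h1, h2, h3⟩
    exact ⟨_, h3, by simp [Pre.moveFact, h1, h2]⟩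

theorem mem_col_move_iff {π : Ordinal.{u} → Ordinal.{u}} {ε γ d} :
    (ε, γ, d) ∈ (p.move π).col ↔ ∃ ε' γ', π ε' = ε ∧ π γ' = γ ∧ (ε', γ', d) ∈ p.col := by
  constructor
  · rintro ⟨⟨γ, δ, d⟩, hf, heq⟩
    simp only [Pre.moveFact, Prod.mk.injEq] at heq
    refine ⟨γ, δ, heq.1, heq.2.1, ?_⟩
    rw [Pre.mem_col, ← heq.2.2]
    exact hf
  · rintro ⟨γ, δ, h1, h2, h3⟩
    exact ⟨_, h3, by simp [Pre.moveFact, h1, h2]⟩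

theorem lev_mem_left (h : IsColouredTree L p) {a b : Ordinal.{u} × K} (hab : p.Le a b) :
    a.1 ∈ p.dom := h.tree.lev_mem (h.tree.left hab)

theorem lev_mem_right (h : IsColouredTree L p) {a b : Ordinal.{u} × K} (hab : p.Le a b) :
    b.1 ∈ p.dom := h.tree.lev_mem (h.tree.right hab)

theorem Le_move_iff' (h : p.Wf L) {π : Ordinal.{u} → Ordinal.{u}}
    (hπ : InjOn π p.dom) {γ δ : Ordinal.{u}} (hγ : γ ∈ p.dom) (hδ : δ ∈ p.dom) {η ξ : K} :
    (p.move π).Le (π γ, η) (π δ, ξ) ↔ p.Le (γ, η) (δ, ξ) :=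
  Pre.mem_move_facts_iff h hπ hγ hδ

theorem mem_col_move_iff' (h : p.Wf L) {π : Ordinal.{u} → Ordinal.{u}}
    (hπ : InjOn π p.dom) {γ δ : Ordinal.{u}} (hγ : γ ∈ p.dom) (hδ : δ ∈ p.dom) {d} :
    (π γ, π δ, d) ∈ (p.move π).col ↔ (γ, δ, d) ∈ p.col :=
  Pre.mem_move_facts_iff h hπ hγ hδ

theorem move (h : IsColouredTree L p) {π : Ordinal.{u} → Ordinal.{u}} (hπ : StrictMonoOn π p.dom)
    (hm : MapsTo π p.dom (Iio (succOrd (Order.succ #L)))) : IsColouredTree L (p.move π) where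
  wf := h.wf.move hπ hm
  tree :=
    { lev_le := by
        rintro ⟨_, η⟩ ⟨_, ξ⟩ hab
        obtain ⟨γ, δ, rfl, rfl, hle⟩ := Le_move_iff.1 hab
        exact hπ.monotoneOn (h.lev_mem_left hle) (h.lev_mem_right hle) (h.tree.lev_le hle)
      lev_mem := by
        rintro ⟨_, η⟩ hab
        obtain ⟨γ, δ, h1, h2, hle⟩ := Le_move_iff.1 hab
        exact ⟨γ, h.lev_mem_left hle, h1⟩
      left := by
        rintro ⟨_, η⟩ ⟨_, ξ⟩ hab
        obtain ⟨γ, δ, rfl, rfl, hle⟩ := Le_move_iff.1 hab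
        exact Le_move_iff.2 ⟨γ, γ, rfl, rfl, h.tree.left hle⟩
      right := by
        rintro ⟨_, η⟩ ⟨_, ξ⟩ hab
        obtain ⟨γ, δ, rfl, rfl, hle⟩ := Le_move_iff.1 hab
        exact Le_move_iff.2 ⟨δ, δ, rfl, rfl, h.tree.right hle⟩
      trans := by
        rintro ⟨_, η⟩ ⟨_, ξ⟩ ⟨_, ζ⟩ hab hbc
        obtain ⟨γ, δ, rfl, rfl, hle⟩ := Le_move_iff.1 hab
        obtain ⟨δ', ε, h1, rfl, hle'⟩ := Le_move_iff.1 hbc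
        have e : δ' = δ := hπ.injOn (h.lev_mem_left hle') (h.lev_mem_right hle) h1
        rw [e] at hle'
        exact Le_move_iff.2 ⟨γ, ε, rfl, rfl, h.tree.trans hle hle'⟩
      pred := by
        rintro ⟨_, η⟩ _ hab ⟨δ, hδ, rfl⟩ hle
        obtain ⟨γ, γ', rfl, h1, h2⟩ := Le_move_iff.1 hab
        have e : γ' = γ := hπ.injOn (h.lev_mem_right h2) (h.lev_mem_left h2) h1
        rw [e] at h2
        obtain ⟨η', hη'⟩ := h.tree.pred h2 hδ ((hπ.le_iff_le hδ (h.lev_mem_left h2)).1 hle)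
        exact ⟨η', Le_move_iff.2 ⟨δ, γ, rfl, rfl, hη'⟩⟩
      uniq := by
        rintro ⟨_, ξ⟩ _ η η' hη hη'
        obtain ⟨γ, δ, rfl, rfl, hle⟩ := Le_move_iff.1 hη
        rw [Le_move_iff' h.wf hπ.injOn (h.lev_mem_left hle) (h.lev_mem_right hle)] at hη'
        exact h.tree.uniq hle hη' }
  coloured :=
    { inj := by
        intro ε γ s t ζ hc
        obtain ⟨ε, γ, -, -, hc⟩ := mem_col_move_iff.1 hc
        exact h.coloured.inj hc
      above := by
        intro ε γ s t ζ hc i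
        obtain ⟨ε, γ, rfl, rfl, hc₀⟩ := mem_col_move_iff.1 hc
        exact Le_move_iff.2 ⟨ε, γ, rfl, rfl, h.coloured.above hc₀ i⟩
      compat := by
        intro ε γ γ' s t t' ζ hc hc'
        obtain ⟨ε, γ, rfl, rfl, hc₀⟩ := mem_col_move_iff.1 hc
        obtain ⟨ε', γ', h1, rfl, hc₁⟩ := mem_col_move_iff.1 hc'
        have e : ε' = ε := hπ.injOn (h.wf.fst_mem _ hc₁) (h.wf.fst_mem _ hc₀) h1
        rw [e] at hc₁
        obtain ⟨f⟩ := h.coloured.compat hc₀ hc₁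
        refine ⟨f.trans (embeddingOfSubset _ _ fun i hi => ?_)⟩
        exact hi.imp (fun hi => Le_move_iff.2 ⟨γ, γ', rfl, rfl, hi⟩)
          (fun hi => Le_move_iff.2 ⟨γ', γ, rfl, rfl, hi⟩) }
  down := by
    rintro ⟨ε, _, s, t, ζ⟩ ⟨⟨δ, hδ, rfl⟩, h2, γ, t', hc, hle⟩
    obtain ⟨ε, γ, rfl, rfl, hc₀⟩ := mem_col_move_iff.1 hc
    have hγ : γ ∈ p.dom := h.wf.snd_mem _ hc₀
    have hε : ε ∈ p.dom := h.wf.fst_mem _ hc₀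
    refine mem_col_move_iff.2 ⟨ε, δ, rfl, rfl, h.down' hc₀ hδ ((hπ.le_iff_le hε hδ).1 h2)
      fun i => ?_⟩
    exact (Le_move_iff' h.wf hπ.injOn hδ hγ).1 (hle i)

theorem sup_Le {S : Set (Pre (TreeDatum L K))} {a b : Ordinal.{u} × K} :
    (Pre.sup S).Le a b ↔ ∃ p ∈ S, p.Le a b := Pre.mem_sup_facts

theorem sup_col {S : Set (Pre (TreeDatum L K))} {c : Colour L K} :
    c ∈ (Pre.sup S).col ↔ ∃ p ∈ S, c ∈ p.col := Pre.mem_sup_facts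

theorem sup [Infinite L] {S : Set (Pre (TreeDatum L K))} (hS : Few L S)
    (hc : IsChain (· ≤ ·) S) (h : ∀ p ∈ S, IsColouredTree L p) : IsColouredTree L (Pre.sup S) := by
  have hdir : ∀ p ∈ S, ∀ q ∈ S, ∃ r ∈ S, r ≤ p ∧ r ≤ q := fun p hp q hq =>
    (hc.total hp hq).elim (fun hle => ⟨p, hp, le_rfl, hle⟩) fun hle => ⟨q, hq, hle, le_rfl⟩
  have hle : ∀ {p q : Pre (TreeDatum L K)}, q ≤ p → ∀ {a b}, p.Le a b → q.Le a b :=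
    fun h _ _ hab => h.2 hab
  have hcol : ∀ {p q : Pre (TreeDatum L K)}, q ≤ p → ∀ {c}, c ∈ p.col → c ∈ q.col :=
    fun h _ hc => h.2 hc
  refine ⟨Pre.Wf.sup hS fun p hp => (h p hp).wf, ⟨?_, ?_, ?_, ?_, ?_, ?_, ?_⟩, ⟨?_, ?_, ?_⟩, ?_⟩
  · intro a b hab
    obtain ⟨p, hp, hab⟩ := sup_Le.1 hab
    exact (h p hp).tree.lev_le hab
  · intro a hab
    obtain ⟨p, hp, hab⟩ := sup_Le.1 hab
    exact Pre.mem_sup_dom.2 ⟨p, hp, (h p hp).tree.lev_mem hab⟩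
  · intro a b hab
    obtain ⟨p, hp, hab⟩ := sup_Le.1 hab
    exact sup_Le.2 ⟨p, hp, (h p hp).tree.left hab⟩
  · intro a b hab
    obtain ⟨p, hp, hab⟩ := sup_Le.1 hab
    exact sup_Le.2 ⟨p, hp, (h p hp).tree.right hab⟩
  · intro a b c hab hbc
    obtain ⟨p, hp, hab⟩ := sup_Le.1 hab
    obtain ⟨q, hq, hbc⟩ := sup_Le.1 hbc
    obtain ⟨r, hr, h1, h2⟩ := hdir p hp q hq
    exact sup_Le.2 ⟨r, hr, (h r hr).tree.trans (hle h1 hab) (hle h2 hbc)⟩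
  · intro a γ hab hγ hγa
    obtain ⟨p, hp, hab⟩ := sup_Le.1 hab
    obtain ⟨q, hq, hγ⟩ := Pre.mem_sup_dom.1 hγ
    obtain ⟨r, hr, h1, h2⟩ := hdir p hp q hq
    obtain ⟨η, hη⟩ := (h r hr).tree.pred (hle h1 hab) (h2.1 hγ) hγa
    exact ⟨η, sup_Le.2 ⟨r, hr, hη⟩⟩
  · intro a γ η η' hη hη'
    obtain ⟨p, hp, hη⟩ := sup_Le.1 hη
    obtain ⟨q, hq, hη'⟩ := sup_Le.1 hη'
    obtain ⟨r, hr, h1, h2⟩ := hdir p hp q hq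
    exact (h r hr).tree.uniq (hle h1 hη) (hle h2 hη')
  · intro ε γ s t ζ hc
    obtain ⟨p, hp, hc⟩ := sup_col.1 hc
    exact (h p hp).coloured.inj hc
  · intro ε γ s t ζ hc i
    obtain ⟨p, hp, hc⟩ := sup_col.1 hc
    exact sup_Le.2 ⟨p, hp, (h p hp).coloured.above hc i⟩
  · intro ε γ γ' s t t' ζ hc hc'
    obtain ⟨p, hp, hc⟩ := sup_col.1 hc
    obtain ⟨q, hq, hc'⟩ := sup_col.1 hc'
    obtain ⟨r, hr, h1, h2⟩ := hdir p hp q hq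
    obtain ⟨f⟩ := (h r hr).coloured.compat (hcol h1 hc) (hcol h2 hc')
    exact ⟨f.trans (embeddingOfSubset _ _ fun i hi =>
      hi.imp (fun hi => sup_Le.2 ⟨r, hr, hi⟩) (fun hi => sup_Le.2 ⟨r, hr, hi⟩))⟩
  · rintro ⟨ε, δ, s, t, ζ⟩ ⟨hδ, hε, γ, t', hc, hlt⟩
    obtain ⟨p, hp, hc⟩ := sup_col.1 hc
    obtain ⟨q, hq, hδ⟩ := Pre.mem_sup_dom.1 hδ
    obtain ⟨r, hr, h1, h2⟩ := hdir p hp q hq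
    -- The relations of the L-indexed sequence may come from different members of the chain.
    -- Predecessors are therefore taken in the single member r, and identified with the given ones
    -- in a common extension.
    refine sup_col.2 ⟨r, hr, (h r hr).down' (hcol h1 hc) (h2.1 hδ) hε fun i => ?_⟩
    obtain ⟨p', hp', hlt⟩ := sup_Le.1 (hlt i)
    obtain ⟨r', hr', h3, h4⟩ := hdir r hr p' hp'
    have h5 := hle h4 hlt
    have hn := (h r hr).tree.right ((h r hr).coloured.above (hcol h1 hc) i)
    obtain ⟨η, hη⟩ := (h r hr).tree.pred (γ := δ) hn (h2.1 hδ) ((h r' hr').tree.lev_le h5)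
    have : η = t i := (h r' hr').tree.uniq (hle h3 hη) h5
    rwa [this] at hη

/-- A new level is a copy of the next old level above it; a level above all old ones stays empty.
This changes nothing below α if no level is added there. -/
theorem extend [Infinite L] (h : IsColouredTree L p) {x : Set Ordinal.{u}} (hx : p.dom ⊆ x)
    (hf : Few L x) (hlt : x ⊆ Iio (succOrd (Order.succ #L))) :
    ∃ s, IsColouredTree L s ∧ s ≤ p ∧ s.dom = x ∧ ∀ α, x ∩ Iio α ⊆ p.dom → s.cut α = p.cut α := by
  -- The next old level. If there is none, the infimum is a junk value, which the clause b.1 ≤ c b.1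
  -- together with the relation of p excludes.
  let c : Ordinal.{u} → Ordinal.{u} := fun γ => sInf (p.dom ∩ Ici γ)
  have hcle : ∀ {γ δ}, δ ∈ p.dom → γ ≤ δ → c γ ≤ δ := fun hδ hle => csInf_le' ⟨hδ, hle⟩
  have hcmem : ∀ {γ δ}, δ ∈ p.dom → γ ≤ δ → c γ ∈ p.dom ∧ γ ≤ c γ := fun {γ δ} hδ hle =>
    csInf_mem (s := p.dom ∩ Ici γ) ⟨δ, hδ, hle⟩
  have hcid : ∀ {γ}, γ ∈ p.dom → c γ = γ := fun hγ =>
    le_antisymm (hcle hγ le_rfl) (hcmem hγ le_rfl).2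
  have hcmono : ∀ {γ δ}, γ ≤ δ → c δ ∈ p.dom → δ ≤ c δ → c γ ≤ c δ := fun h1 h2 h3 =>
    hcle h2 (h1.trans h3)
  let le : Ordinal.{u} × K → Ordinal.{u} × K → Prop := fun a b =>
    a.1 ∈ x ∧ b.1 ∈ x ∧ a.1 ≤ b.1 ∧ b.1 ≤ c b.1 ∧ p.Le (c a.1, a.2) (c b.1, b.2)
  have hold : ∀ {γ δ η ξ}, γ ∈ p.dom → δ ∈ p.dom →
      (le (γ, η) (δ, ξ) ↔ p.Le (γ, η) (δ, ξ)) := by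
    intro γ δ η ξ hγ hδ
    simp only [le, hcid hγ, hcid hδ]
    exact ⟨fun h => h.2.2.2.2, fun hle => ⟨hx hγ, hx hδ, h.tree.lev_le hle, le_rfl, hle⟩⟩
  have hle : ∀ a b, p.Le a b → le a b := fun a b hab =>
    (hold (h.lev_mem_left hab) (h.lev_mem_right hab)).2 hab
  have hT : IsTree x le :=
    { lev_le := fun hab => hab.2.2.1
      lev_mem := fun hab => hab.1
      left := by
        intro a b ⟨h1, h2, h3, h4, h5⟩
        exact ⟨h1, h1, le_rfl, (hcmem (h.lev_mem_right h5) (h3.trans h4)).2, h.tree.left h5⟩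
      right := by
        intro a b ⟨h1, h2, h3, h4, h5⟩
        exact ⟨h2, h2, le_rfl, h4, h.tree.right h5⟩
      trans := by
        intro a b d ⟨h1, h2, h3, h4, h5⟩ ⟨h1', h2', h3', h4', h5'⟩
        exact ⟨h1, h2', h3.trans h3', h4', h.tree.trans h5 h5'⟩
      pred := by
        intro a γ ⟨h1, h2, h3, h4, h5⟩ hγ hγa
        have h6 := h.lev_mem_right h5
        obtain ⟨η, hη⟩ := h.tree.pred h5 (hcmem h6 (hγa.trans h4)).1 (hcmono hγa h6 h4)
        exact ⟨η, hγ, h1, hγa, h4, hη⟩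
      uniq := fun hη hη' => h.tree.uniq hη.2.2.2.2 hη'.2.2.2.2 }
  have hC : IsColoured le p.col :=
    { inj := h.coloured.inj
      above := fun hc i => hle _ _ (h.coloured.above hc i)
      compat := fun hc hc' => by
        obtain ⟨f⟩ := h.coloured.compat hc hc'
        exact ⟨f.trans (embeddingOfSubset _ _ fun i hi => hi.imp (hle _ _) (hle _ _))⟩ }
  have hn : Few L {a | le a a} :=
    (hf.prod ((Pre.Few.nodes h.wf).image Prod.snd)).mono fun a ha =>
      ⟨ha.1, _, ha.2.2.2.2, rfl⟩
  refine ⟨_, isColouredTree_ofTree hf hlt hT hn (Pre.Few.col h.wf) hC,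
    Pre.le_iff.2 ⟨hx, hle, subset_downClosure hT hC⟩, rfl, fun α hα => ?_⟩
  refine le_antisymm (Pre.cut_mono (Pre.le_iff.2 ⟨hx, hle, subset_downClosure hT hC⟩))
    (Pre.le_iff.2 ⟨fun a ha => ⟨hα ha, ha.2⟩, ?_, ?_⟩)
  · rintro ⟨γ, η⟩ ⟨δ, ξ⟩ ⟨hab, hlt'⟩
    have hab : le (γ, η) (δ, ξ) := hab
    have hδ : δ ∈ p.dom := hα ⟨hab.2.1, hlt'⟩
    have hγ : γ ∈ p.dom := hα ⟨hab.1, hab.2.2.1.trans_lt hlt'⟩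
    exact ⟨(hold hγ hδ).1 hab, hlt'⟩
  · rintro ⟨ε, δ, s, t, ζ⟩ ⟨⟨h1, h2, γ, t', hc, hlt'⟩, hδα⟩
    have hδ : δ ∈ p.dom := hα ⟨h1, hδα⟩
    exact ⟨h.down' hc hδ h2 fun i => (hold hδ (h.wf.snd_mem _ hc)).1 (hlt' i), hδα⟩

end IsColouredTree

end Build

/-! ### Splicing a larger lower part into a tree -/

namespace IsColouredTree

variable {L K : Type u} {p q r u : Pre (TreeDatum L K)} {α : Ordinal.{u}}

/-- The new relations go from r to upper nodes of u through nodes of u below α. As each level of r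
lies below such a level of u, every upper node has exactly one predecessor on each level of r. -/
theorem splice [Infinite L] (hu : IsColouredTree L u) (hr : IsColouredTree L r)
    (hrα : r.dom ⊆ Iio α) (hle : r ≤ u.cut α)
    (hcof : ∀ γ ∈ r.dom, ∃ δ ∈ u.dom, γ ≤ δ ∧ δ < α) :
    ∃ s, IsColouredTree L s ∧ s ≤ u ∧ s.dom = u.dom ∪ r.dom ∧ s.cut α = r := by
  let le : Ordinal.{u} × K → Ordinal.{u} × K → Prop := fun a b =>
    r.Le a b ∨ u.Le a b ∨ ∃ w, r.Le a w ∧ u.Le w b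
  have hur : ∀ {a b}, u.Le a b → b.1 < α → r.Le a b := fun h h' => hle.2 ⟨h, h'⟩
  have hurc : ∀ {c}, c ∈ u.col → c.2.1 < α → c ∈ r.col := fun h h' => hle.2 ⟨h, h'⟩
  have hrlt : ∀ {a b}, r.Le a b → b.1 < α := fun h => hrα (hr.lev_mem_right h)
  have hlt : ∀ {a b}, le a b → b.1 < α → r.Le a b := by
    rintro a b (h | h | ⟨w, h, h'⟩) hb
    exacts [h, hur h hb, hr.tree.trans h (hur h' hb)]
  have hcases : ∀ {a b}, le a b → a.1 < α → r.Le a b ∨ ∃ w, r.Le a w ∧ u.Le w b := by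
    rintro a b (h | h | h) ha
    exacts [Or.inl h, Or.inr ⟨a, hur (hu.tree.left h) ha, h⟩, Or.inr h]
  have hdom : ∀ {γ}, γ ∈ u.dom ∪ r.dom → γ < α → γ ∈ r.dom := fun h h' =>
    h.elim (fun h => hle.1 ⟨h, h'⟩) id
  have hT : IsTree (u.dom ∪ r.dom) le :=
    { lev_le := by
        rintro a b (h | h | ⟨w, h, h'⟩)
        exacts [hr.tree.lev_le h, hu.tree.lev_le h, (hr.tree.lev_le h).trans (hu.tree.lev_le h')]
      lev_mem := by
        rintro a (h | h | ⟨w, h, h'⟩)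
        exacts [Or.inr (hr.lev_mem_right h), Or.inl (hu.lev_mem_right h),
          Or.inl (hu.lev_mem_right h')]
      left := by
        rintro a b (h | h | ⟨w, h, h'⟩)
        exacts [Or.inl (hr.tree.left h), Or.inr (Or.inl (hu.tree.left h)),
          Or.inl (hr.tree.left h)]
      right := by
        rintro a b (h | h | ⟨w, h, h'⟩)
        exacts [Or.inl (hr.tree.right h), Or.inr (Or.inl (hu.tree.right h)),
          Or.inr (Or.inl (hu.tree.right h'))]
      trans := by
        rintro a b c hab (h | h | ⟨w, h, h'⟩)
        · exact Or.inl (hr.tree.trans (hlt hab ((hr.tree.lev_le h).trans_lt (hrlt h))) h)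
        · rcases hab with hab | hab | ⟨w, h1, h2⟩
          exacts [Or.inr (Or.inr ⟨b, hab, h⟩), Or.inr (Or.inl (hu.tree.trans hab h)),
            Or.inr (Or.inr ⟨w, h1, hu.tree.trans h2 h⟩)]
        · exact Or.inr (Or.inr ⟨w, hr.tree.trans
            (hlt hab ((hr.tree.lev_le h).trans_lt (hrlt h))) h, h'⟩)
      pred := by
        intro a γ ha hγ hγa
        rcases lt_or_ge a.1 α with haα | haα
        · obtain ⟨η, hη⟩ := hr.tree.pred (hlt ha haα) (hdom hγ (hγa.trans_lt haα)) hγa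
          exact ⟨η, Or.inl hη⟩
        have hua : u.Le a a := by
          rcases ha with h | h | ⟨w, h, h'⟩
          exacts [absurd (hrlt h) (not_lt.2 haα), h, hu.tree.right h']
        rcases hγ with hγ | hγ
        · obtain ⟨η, hη⟩ := hu.tree.pred hua hγ hγa
          exact ⟨η, Or.inr (Or.inl hη)⟩
        · obtain ⟨δ, hδ, hγδ, hδα⟩ := hcof γ hγ
          obtain ⟨ξ, hξ⟩ := hu.tree.pred hua hδ (hδα.le.trans haα)
          obtain ⟨η, hη⟩ := hr.tree.pred (a := (δ, ξ)) (hur (hu.tree.left hξ) hδα) hγ hγδ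
          exact ⟨η, Or.inr (Or.inr ⟨_, hη, hξ⟩)⟩
      uniq := by
        intro a γ η η' h h'
        rcases lt_or_ge a.1 α with haα | haα
        · exact hr.tree.uniq (hlt h haα) (hlt h' haα)
        rcases lt_or_ge γ α with hγ | hγ
        · rcases hcases h hγ with h | ⟨w, h1, h2⟩
          · exact absurd (hrlt h) (not_lt.2 haα)
          rcases hcases h' hγ with h' | ⟨w', h1', h2'⟩
          · exact absurd (hrlt h') (not_lt.2 haα)
          rcases hu.tree.comparable h2 h2' with hw | hw
          · exact hr.tree.uniq (hr.tree.trans h1 (hur hw (hrlt h1'))) h1'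
          · exact hr.tree.uniq h1 (hr.tree.trans h1' (hur hw (hrlt h1)))
        · have : ∀ {η}, le (γ, η) a → u.Le (γ, η) a := by
            rintro η (h | h | ⟨w, h, h'⟩)
            exacts [absurd (hrlt h) (not_lt.2 haα), h,
              absurd (hrα (hr.lev_mem_left h)) (not_lt.2 hγ)]
          exact hu.tree.uniq (this h) (this h') }
  -- A colour of u from above α is first restricted to a level of u below α and at or above γ, where
  -- compatibility inside r applies.
  have hmixed : ∀ {ε γ γ' s t t' ζ}, (ε, γ, s, t, ζ) ∈ r.col → (ε, γ', s, t', ζ) ∈ u.col →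
      Nonempty (L ↪ {i | le (γ, t i) (γ', t' i) ∨ le (γ', t' i) (γ, t i)}) := by
    intro ε γ γ' s t t' ζ hc hc'
    rcases lt_or_ge γ' α with hγ' | hγ'
    · obtain ⟨f⟩ := hr.coloured.compat hc (hurc hc' hγ')
      exact ⟨f.trans (embeddingOfSubset _ _ fun i hi => hi.imp Or.inl Or.inl)⟩
    obtain ⟨δ, hδ, hγδ, hδα⟩ := hcof γ (hr.wf.snd_mem _ hc)
    obtain ⟨t'', hc'', ht''⟩ := hu.exists_restrict hc' hδ ((hr.wf.fst_le _ hc).trans hγδ)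
      (hδα.le.trans hγ')
    obtain ⟨f⟩ := hr.coloured.compat hc (hurc hc'' hδα)
    exact ⟨f.trans (embeddingOfSubset _ _ fun i hi => Or.inl (Or.inr (Or.inr
      ⟨_, hr.tree.le_of_comparable hi hγδ, ht'' i⟩)))⟩
  have hC : IsColoured le (r.col ∪ u.col) :=
    { inj := by
        rintro ε γ s t ζ (h | h)
        exacts [hr.coloured.inj h, hu.coloured.inj h]
      above := by
        rintro ε γ s t ζ (h | h) i
        exacts [Or.inl (hr.coloured.above h i), Or.inr (Or.inl (hu.coloured.above h i))]
      compat := by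
        rintro ε γ γ' s t t' ζ (h | h) (h' | h')
        · obtain ⟨f⟩ := hr.coloured.compat h h'
          exact ⟨f.trans (embeddingOfSubset _ _ fun i hi => hi.imp Or.inl Or.inl)⟩
        · exact hmixed h h'
        · obtain ⟨f⟩ := hmixed h' h
          exact ⟨f.trans (embeddingOfSubset _ _ fun i hi => hi.symm)⟩
        · obtain ⟨f⟩ := hu.coloured.compat h h'
          exact ⟨f.trans (embeddingOfSubset _ _ fun i hi =>
            hi.imp (fun h => Or.inr (Or.inl h)) (fun h => Or.inr (Or.inl h)))⟩ }
  have hn : Few L {a | le a a} := by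
    refine ((Pre.Few.nodes hr.wf).union (Pre.Few.nodes hu.wf)).mono ?_
    rintro a (h | h | ⟨w, h, h'⟩)
    exacts [Or.inl h, Or.inr h, Or.inl (hr.tree.left h)]
  have hsub := subset_downClosure hT hC
  refine ⟨_, isColouredTree_ofTree (hu.wf.dom_few.union hr.wf.dom_few)
    (union_subset hu.wf.dom_lt hr.wf.dom_lt) hT hn
    ((Pre.Few.col hr.wf).union (Pre.Few.col hu.wf)) hC,
    Pre.le_iff.2 ⟨subset_union_left, fun a b h => Or.inr (Or.inl h),
      subset_union_right.trans hsub⟩, rfl, ?_⟩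
  refine le_antisymm (Pre.le_iff.2 ⟨fun γ hγ => ⟨Or.inr hγ, hrα hγ⟩,
    fun a b h => ⟨Or.inl h, hrlt h⟩, fun c hc => ⟨hsub (Or.inl hc), hrα (hr.wf.snd_mem _ hc)⟩⟩)
    (Pre.le_iff.2 ⟨fun γ hγ => hdom hγ.1 hγ.2, fun a b h => hlt h.1 h.2, ?_⟩)
  rintro ⟨ε, δ, s, t, ζ⟩ ⟨⟨h1, h2, γ, t', hc, hlt'⟩, hδα⟩
  have hδ : δ ∈ r.dom := hdom h1 hδα
  have hc : (ε, γ, s, t', ζ) ∈ r.col ∪ u.col := hc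
  have hlt' : ∀ i, le (δ, t i) (γ, t' i) := hlt'
  -- The downward closure adds no colour below α: a colour coming from above α descends through a
  -- level of u below α, where it belongs to r.
  have hin : ∀ {γ t'}, (ε, γ, s, t', ζ) ∈ r.col → (∀ i, le (δ, t i) (γ, t' i)) →
      (ε, δ, s, t, ζ) ∈ r.col := fun hc h =>
    hr.down' hc hδ h2 fun i => hlt (h i) (hrα (hr.wf.snd_mem _ hc))
  rcases hc with hc | hc
  · exact hin hc hlt'
  rcases lt_or_ge γ α with hγ | hγ
  · exact hin (hurc hc hγ) hlt'
  obtain ⟨δ', hδ', hδδ', hδ'α⟩ := hcof δ hδ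
  obtain ⟨t'', hc'', ht''⟩ := hu.exists_restrict hc hδ' (h2.trans hδδ') (hδ'α.le.trans hγ)
  exact hin (hurc hc'' hδ'α) fun i => hT.le_of_lev_le (hlt' i) (Or.inr (Or.inl (ht'' i))) hδδ'

end IsColouredTree

/-! ### Adding branches -/

/-- Data for adding branches to a tree: initial segments `B w` of branches, for `w ∈ W`, together
with names `h w γ` for the new nodes of the levels `γ ∈ x'`. -/
structure BranchData {K : Type u} (x : Set Ordinal.{u})
    (le : Ordinal.{u} × K → Ordinal.{u} × K → Prop) (x' : Set Ordinal.{u}) {ι : Type v}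
    (W : Set ι) (B : ι → Set (Ordinal.{u} × K)) (h : ι → Ordinal.{u} → K) : Prop where
  tree : IsTree x le
  subset : x ⊆ x'
  above : ∀ γ ∈ x', γ ∉ x → ∀ δ ∈ x, δ < γ
  chain : ∀ w ∈ W, ∀ a ∈ B w, ∀ b ∈ B w, le a b ∨ le b a
  down : ∀ w ∈ W, ∀ b ∈ B w, ∀ a, le a b → a ∈ B w
  fresh : ∀ w ∈ W, ∀ γ ∈ x', (∀ η, (γ, η) ∉ B w) → ¬ le (γ, h w γ) (γ, h w γ)
  inj : ∀ w ∈ W, ∀ w' ∈ W, ∀ γ ∈ x', h w γ = h w' γ → w = w'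

/-- The new nodes of a branch. -/
def branchTail {K : Type u} {ι : Type v} (x' : Set Ordinal.{u}) (B : ι → Set (Ordinal.{u} × K))
    (h : ι → Ordinal.{u} → K) (w : ι) : Set (Ordinal.{u} × K) :=
  {v | v.1 ∈ x' ∧ (∀ η, (v.1, η) ∉ B w) ∧ v.2 = h w v.1}

/-- The tree order after adding branches. -/
def branchLe {K : Type u} {ι : Type v} (le : Ordinal.{u} × K → Ordinal.{u} × K → Prop)
    (x' : Set Ordinal.{u}) (W : Set ι) (B : ι → Set (Ordinal.{u} × K))
    (h : ι → Ordinal.{u} → K) (a b : Ordinal.{u} × K) : Prop :=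
  le a b ∨ ∃ w ∈ W, b ∈ branchTail x' B h w ∧ (a ∈ B w ∨ a ∈ branchTail x' B h w ∧ a.1 ≤ b.1)

namespace BranchData

variable {K : Type u} {ι : Type v} {x x' : Set Ordinal.{u}} {le : Ordinal.{u} × K → Ordinal.{u} × K → Prop}
  {W : Set ι} {B : ι → Set (Ordinal.{u} × K)} {h : ι → Ordinal.{u} → K}

theorem not_le_of_mem_tail (D : BranchData x le x' W B h) {w : ι} (hw : w ∈ W)
    {v : Ordinal.{u} × K} (hv : v ∈ branchTail x' B h w) : ¬ le v v := by
  obtain ⟨γ, η⟩ := v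
  obtain ⟨h1, h2, h3 : η = h w γ⟩ := hv
  rw [h3]
  exact D.fresh w hw γ h1 h2

theorem le_self_of_mem (D : BranchData x le x' W B h) {w : ι} (hw : w ∈ W)
    {v : Ordinal.{u} × K} (hv : v ∈ B w) : le v v :=
  (D.chain w hw v hv v hv).elim id id

theorem tail_unique (D : BranchData x le x' W B h) {w w' : ι} (hw : w ∈ W) (hw' : w' ∈ W)
    {v : Ordinal.{u} × K} (hv : v ∈ branchTail x' B h w) (hv' : v ∈ branchTail x' B h w') :
    w = w' :=
  D.inj w hw w' hw' v.1 hv.1 (hv.2.2.symm.trans hv'.2.2)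

/-- New nodes lie only on the tails of the branches, and a tail is recognised by its names. Since
each initial segment is closed downward, a level that it misses is above all of its nodes. -/
theorem isTree (D : BranchData x le x' W B h) : IsTree x' (branchLe le x' W B h) where
  lev_le := by
    rintro a b (hab | ⟨w, hw, hb, ha | ha⟩)
    · exact D.tree.lev_le hab
    · by_contra! hlt
      have haa := D.le_self_of_mem hw ha
      by_cases hx : b.1 ∈ x
      · obtain ⟨η, hη⟩ := D.tree.pred haa hx hlt.le
        exact hb.2.1 η (D.down w hw a ha _ hη)
      · exact absurd (D.above _ hb.1 hx _ (D.tree.lev_mem haa)) hlt.not_gt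
    · exact ha.2
  lev_mem := by
    rintro a (ha | ⟨w, hw, ha, -⟩)
    exacts [D.subset (D.tree.lev_mem ha), ha.1]
  left := by
    rintro a b (hab | ⟨w, hw, hb, ha | ha⟩)
    exacts [Or.inl (D.tree.left hab), Or.inl (D.le_self_of_mem hw ha),
      Or.inr ⟨w, hw, ha.1, Or.inr ⟨ha.1, le_rfl⟩⟩]
  right := by
    rintro a b (hab | ⟨w, hw, hb, -⟩)
    exacts [Or.inl (D.tree.right hab), Or.inr ⟨w, hw, hb, Or.inr ⟨hb, le_rfl⟩⟩]
  trans := by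
    rintro a b c (hab | ⟨w, hw, hb, ha⟩) (hbc | ⟨w', hw', hc, hb'⟩)
    · exact Or.inl (D.tree.trans hab hbc)
    · rcases hb' with hb' | hb'
      · exact Or.inr ⟨w', hw', hc, Or.inl (D.down w' hw' b hb' a hab)⟩
      · exact absurd (D.tree.right hab) (D.not_le_of_mem_tail hw' hb'.1)
    · exact absurd (D.tree.left hbc) (D.not_le_of_mem_tail hw hb)
    · rcases hb' with hb' | hb'
      · exact absurd (D.le_self_of_mem hw' hb') (D.not_le_of_mem_tail hw hb)
      · obtain rfl := D.tail_unique hw hw' hb hb'.1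
        exact Or.inr ⟨w, hw, hc, ha.imp id fun h => ⟨h.1, h.2.trans hb'.2⟩⟩
  pred := by
    rintro a γ (ha | ⟨w, hw, ha, -⟩) hγ hγa
    · have hγx : γ ∈ x := by
        by_contra hx
        exact absurd (D.above γ hγ hx _ (D.tree.lev_mem ha)) hγa.not_gt
      obtain ⟨η, hη⟩ := D.tree.pred ha hγx hγa
      exact ⟨η, Or.inl hη⟩
    · by_cases hB : ∃ η, (γ, η) ∈ B w
      · obtain ⟨η, hη⟩ := hB
        exact ⟨η, Or.inr ⟨w, hw, ha, Or.inl hη⟩⟩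
      · push Not at hB
        exact ⟨h w γ, Or.inr ⟨w, hw, ha, Or.inr ⟨⟨hγ, hB, rfl⟩, hγa⟩⟩⟩
  uniq := by
    rintro a γ η η' (ha | ⟨w, hw, ha, h1⟩) (ha' | ⟨w', hw', ha', h1'⟩)
    · exact D.tree.uniq ha ha'
    · exact absurd (D.tree.right ha) (D.not_le_of_mem_tail hw' ha')
    · exact absurd (D.tree.right ha') (D.not_le_of_mem_tail hw ha)
    · obtain rfl := D.tail_unique hw hw' ha ha'
      rcases h1 with h1 | ⟨h1, -⟩ <;> rcases h1' with h1' | ⟨h1', -⟩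
      · rcases D.chain w hw _ h1 _ h1' with hc | hc
        · exact congrArg Prod.snd (D.tree.eq_of_lev_eq hc rfl)
        · exact (congrArg Prod.snd (D.tree.eq_of_lev_eq hc rfl)).symm
      · exact absurd h1 (h1'.2.1 _)
      · exact absurd h1' (h1.2.1 _)
      · exact h1.2.2.trans h1'.2.2.symm

theorem few_nodes {L : Type u} [Infinite L]
    (hx' : Few L x') (hW : Few L W) (hn : Few L {a | le a a}) :
    Few L {a | branchLe le x' W B h a a} := by
  refine (hn.union ((hW.prod hx').image fun c => (c.2, h c.1 c.2))).mono ?_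
  rintro ⟨γ, η⟩ (ha | ⟨w, hw, ha, -⟩)
  · exact Or.inl ha
  · exact Or.inr ⟨(w, γ), ⟨hw, ha.1⟩, Prod.ext rfl ha.2.2.symm⟩

end BranchData

/-! ### Amalgamation of coloured trees -/

theorem IsColoured.mono {L K : Type u} {le le' : Ordinal.{u} × K → Ordinal.{u} × K → Prop}
    {R : Set (Colour L K)} (h : IsColoured le R) (hle : ∀ a b, le a b → le' a b) :
    IsColoured le' R where
  inj := h.inj
  above := fun hc i => hle _ _ (h.above hc i)
  compat := fun hc hc' => by
    obtain ⟨f⟩ := h.compat hc hc'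
    exact ⟨f.trans (embeddingOfSubset _ _ fun i hi => hi.imp (hle _ _) (hle _ _))⟩

/-- The least upper bound of the part of x below β is less than β; were it outside x, it would be an
accumulation point. -/
theorem ClosedInSup.exists_max {x : Set Ordinal.{u}} (h : ClosedInSup x) (hb : BddAbove x)
    {β γ ε : Ordinal.{u}} (hβ : β ∈ x) (hε : ε ∈ x) (hεβ : ε < β) (hγβ : γ < β)
    (hγ : ∀ δ ∈ x, δ < β → δ ≤ γ) : ∃ m ∈ x, m < β ∧ ∀ δ ∈ x, δ < β → δ ≤ m := by
  let A : Set Ordinal.{u} := {α | ∀ δ ∈ x, δ < β → δ ≤ α}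
  have hA : sInf A ∈ A := csInf_mem ⟨γ, hγ⟩
  have hlt : sInf A < β := (csInf_le' (show γ ∈ A from hγ)).trans_lt hγβ
  by_cases hx : sInf A ∈ x
  · exact ⟨_, hx, hlt, hA⟩
  refine absurd ((closedInSup_iff hb).1 h (sInf A) ?_ ⟨β, hβ, hlt.le⟩ fun a ha => ?_) hx
  · refine (zero_le (a := ε)).trans_lt (lt_of_le_of_ne (hA ε hε hεβ) ?_)
    rintro rfl
    exact hx hε
  · have : a ∉ A := fun h' => absurd (csInf_le' h') ha.not_ge
    simp only [A, mem_ofPred_eq, not_forall, not_le] at this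
    obtain ⟨δ, hδ, hδβ, hδa⟩ := this
    exact ⟨δ, hδ, hδa, lt_of_le_of_ne (hA δ hδ hδβ) fun h' => hx (h' ▸ hδ)⟩

namespace IsColouredTree

variable {L K : Type u} {p q r u : Pre (TreeDatum L K)} {α : Ordinal.{u}}

/-- Each node w of the top level receives a branch of q containing its old predecessors, prolonged
by fresh nodes. The branches are chosen so that sequences on level β meet all sequences of q with
the same colour. -/
theorem exists_top_level [Infinite L] (hK : #L < #K) (hp : IsColouredTree L p)
    (hpc : ClosedInSup p.dom) (hq : IsColouredTree L q) {β : Ordinal.{u}} (hβ : β ∈ p.dom)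
    (hpβ : p.dom ⊆ Iic β) (hqβ : q.dom ⊆ Iio β) (hqp : q ≤ p.cut β) :
    ∃ s, IsColouredTree L s ∧ s ≤ q ∧ s ≤ p ∧ s.dom = insert β q.dom := by
  classical
  let W : Set K := {w | p.Le (β, w) (β, w)}
  have hWf : Few L W := ((Pre.Few.nodes hp.wf).image Prod.snd).mono fun w hw => ⟨_, hw, rfl⟩
  have hpq : ∀ {a b}, p.Le a b → b.1 < β → q.Le a b := fun h h' => hqp.2 ⟨h, h'⟩
  have hpqc : ∀ {c}, c ∈ p.col → c.2.1 < β → c ∈ q.col := fun h h' => hqp.2 ⟨h, h'⟩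
  let B₀ : K → Set (Ordinal.{u} × K) := fun w => {a | ∃ v, p.Le v (β, w) ∧ v.1 < β ∧ q.Le a v}
  have hB₀c : ∀ w, ∀ a ∈ B₀ w, ∀ b ∈ B₀ w, q.Le a b ∨ q.Le b a := by
    rintro w a ⟨v, h1, h2, h3⟩ b ⟨v', h1', h2', h3'⟩
    exact hq.tree.comparable_mono
      ((hp.tree.comparable h1 h1').imp (hpq · h2') (hpq · h2)) h3 h3'
  have hB₀d : ∀ w, ∀ b ∈ B₀ w, ∀ a, q.Le a b → a ∈ B₀ w := by
    rintro w b ⟨v, h1, h2, h3⟩ a hab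
    exact ⟨v, h1, h2, hq.tree.trans hab h3⟩
  -- The demands: a colour of p on the top level and a colour of q that share ε, s and ζ.
  let J : Set (Colour L K × Colour L K) := {j | j.1 ∈ p.col ∧ j.2 ∈ q.col ∧ j.1.2.1 = β ∧
    j.1.1 = j.2.1 ∧ j.1.2.2.1 = j.2.2.2.1 ∧ j.1.2.2.2.2 = j.2.2.2.2.2}
  have hJf : Few L J := ((Pre.Few.col hp.wf).prod (Pre.Few.col hq.wf)).mono
    fun j hj => ⟨hj.1, hj.2.1⟩
  -- An index i at which the demand can be met: the node of q lies on the old part of the branch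
  -- below t(i), or that part can be prolonged through it.
  let good : Colour L K × Colour L K → L → Prop := fun j i =>
    (j.2.2.1, j.2.2.2.2.1 i) ∈ B₀ (j.1.2.2.2.1 i) ∨
      ∀ a ∈ B₀ (j.1.2.2.2.1 i), q.Le a (j.2.2.1, j.2.2.2.2.1 i)
  have htinj : ∀ {c}, c ∈ p.col → Function.Injective c.2.2.2.1 := by
    rintro ⟨ε, γ, s, t, ζ⟩ hc i i' hii
    refine hp.coloured.inj hc (hp.tree.uniq (hp.coloured.above hc i) ?_)
    rw [show t i = t i' from hii]
    exact hp.coloured.above hc i'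
  have hgood : ∀ j ∈ J, Nonempty (L ↪ {i | good j i}) := by
    rintro ⟨⟨ε, β', s, t, ζ⟩, ⟨ε', γ, s', t', ζ'⟩⟩ ⟨hc, hc', h1, h2, h3, h4⟩
    dsimp only at h1 h2 h3 h4
    subst h1 h2 h3 h4
    have hεp : ε ∈ p.dom := hp.wf.fst_mem _ hc
    have hεγ : ε ≤ γ := hq.wf.fst_le _ hc'
    have hγβ : γ < β' := hqβ (hq.wf.snd_mem _ hc')
    -- If p has a level between γ and β, then its relations already fix the branches up to γ, and
    -- compatibility in q applies on that level.
    by_cases hex : ∃ δ ∈ p.dom, γ ≤ δ ∧ δ < β'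
    · obtain ⟨δ, hδ, hγδ, hδβ⟩ := hex
      obtain ⟨t'', hc'', ht''⟩ := hp.exists_restrict hc hδ (hεγ.trans hγδ) hδβ.le
      obtain ⟨f⟩ := hq.coloured.compat hc' (hpqc hc'' hδβ)
      exact ⟨f.trans (embeddingOfSubset _ _ fun i hi =>
        Or.inl ⟨_, ht'' i, hδβ, hq.tree.le_of_comparable hi hγδ⟩)⟩
    · push Not at hex
      -- Otherwise closedness of the realm gives a last level m of p below β. All old predecessors
      -- lie at or below level m, so it suffices that the node of q extends the predecessor on m.
      obtain ⟨m, hm, hmβ, hmax⟩ := hpc.exists_max hp.wf.bdd hβ hεp (hεγ.trans_lt hγβ) hγβ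
        fun δ hδ hδβ => (lt_of_not_ge fun h => absurd hδβ (hex δ hδ h).not_gt).le
      have hmγ : m ≤ γ := (lt_of_not_ge fun h => absurd hmβ (hex m hm h).not_gt).le
      obtain ⟨t'', hc'', ht''⟩ := hp.exists_restrict hc hm (hmax ε hεp (hεγ.trans_lt hγβ)) hmβ.le
      obtain ⟨f⟩ := hq.coloured.compat (hpqc hc'' hmβ) hc'
      refine ⟨f.trans (embeddingOfSubset _ _ fun i hi => Or.inr ?_)⟩
      rintro a ⟨v, h1, h2, h3⟩
      have h4 : p.Le v (m, t'' i) :=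
        hp.tree.le_of_lev_le h1 (ht'' i) (hmax _ (hp.lev_mem_left h1) h2)
      exact hq.tree.trans h3 (hq.tree.trans (hpq h4 hmβ) (hq.tree.le_of_comparable hi hmγ))
  -- Each demand is repeated λ many times and distinct repetitions get distinct nodes. So a node
  -- serves at most one demand, and each demand is met at λ many indices.
  obtain ⟨f, hfi, hf⟩ := exists_injective_choice (L := L) (J := J × L) (W := K) (by
    refine ((hJf.prod (Few.range (id : L → L))).preimage
      (f := fun k : J × L => ((k.1 : Colour L K × Colour L K), k.2)) ?_).mono ?_
    · rintro ⟨a, b⟩ - ⟨a', b'⟩ - h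
      simp only [Prod.mk.injEq] at h
      exact Prod.ext (Subtype.ext h.1) h.2
    · rintro ⟨a, b⟩ -
      exact ⟨a.2, b, rfl⟩)
    (fun k => (k.1.1.1.2.2.2.1) '' {i | good k.1.1 i}) (by
      rintro ⟨⟨j, hj⟩, l⟩
      obtain ⟨g⟩ := hgood j hj
      exact ⟨⟨fun l => ⟨_, mem_image_of_mem _ (g l).2⟩, fun l l' h =>
        g.injective (Subtype.ext (htinj hj.1 (congrArg Subtype.val h)))⟩⟩)
  have hB : ∀ w, ∃ B : Set (Ordinal.{u} × K), (∀ a ∈ B, ∀ b ∈ B, q.Le a b ∨ q.Le b a) ∧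
      (∀ b ∈ B, ∀ a, q.Le a b → a ∈ B) ∧ B₀ w ⊆ B ∧
      ∀ k, f k = w → ∃ i, k.1.1.1.2.2.2.1 i = w ∧ (k.1.1.2.2.1, k.1.1.2.2.2.2.1 i) ∈ B := by
    intro w
    by_cases hw : ∃ k, f k = w
    · obtain ⟨k, hk⟩ := hw
      have huniq : ∀ k', f k' = w → k' = k := fun k' hk' => hfi (hk'.trans hk.symm)
      obtain ⟨i, hi, hiw⟩ := hf k
      have hi : good k.1.1 i := hi
      simp only [hk] at hiw
      simp only [good, hiw] at hi
      rcases hi with hi | hi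
      · exact ⟨B₀ w, hB₀c w, hB₀d w, subset_rfl, fun k' hk' => by
          rw [huniq k' hk']; exact ⟨i, hiw, hi⟩⟩
      · obtain ⟨⟨⟨c, c'⟩, hj⟩, l⟩ := k
        have hn : q.Le (c'.2.1, c'.2.2.2.1 i) (c'.2.1, c'.2.2.2.1 i) :=
          hq.tree.right (hq.coloured.above hj.2.1 i)
        exact ⟨{a | q.Le a (c'.2.1, c'.2.2.2.1 i)}, fun a ha b hb => hq.tree.comparable ha hb,
          fun b hb a hab => hq.tree.trans hab hb, hi, fun k' hk' => by
            rw [huniq k' hk']; exact ⟨i, hiw, hn⟩⟩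
    · exact ⟨B₀ w, hB₀c w, hB₀d w, subset_rfl, fun k hk => absurd ⟨k, hk⟩ hw⟩
  choose B hBc hBd hB₀ hBf using hB
  obtain ⟨g, hg, hgn⟩ := Few.exists_fresh hK ((Pre.Few.nodes hq.wf).image Prod.snd) hWf
  -- The top level keeps the names of p; on the levels of q that its branch does not reach, w has a
  -- fresh name of its own.
  let h : K → Ordinal.{u} → K := fun w γ => if γ = β then w else g w
  have hhβ : ∀ w, h w β = w := fun w => if_pos rfl
  have hqn : ∀ η, ¬ q.Le (β, η) (β, η) := fun η hη => lt_irrefl β (hqβ (hq.lev_mem_left hη))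
  have D : BranchData q.dom q.Le (insert β q.dom) W B h :=
    { tree := hq.tree
      subset := subset_insert _ _
      above := by
        rintro γ (rfl | hγ) hγq δ hδ
        exacts [hqβ hδ, absurd hγ hγq]
      chain := fun w _ => hBc w
      down := fun w _ => hBd w
      fresh := by
        intro w hw γ hγ _ hn
        by_cases hγβ : γ = β
        · subst hγβ
          exact hqn _ hn
        · rw [show h w γ = g w from if_neg hγβ] at hn
          exact hgn w ⟨_, hn, rfl⟩
      inj := by
        intro w hw w' hw' γ _ heq
        by_cases hγβ : γ = β
        · subst hγβ
          rwa [hhβ, hhβ] at heq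
        · rw [show h w γ = g w from if_neg hγβ, show h w' γ = g w' from if_neg hγβ] at heq
          exact hg hw hw' heq }
  have hTail : ∀ w, (β, w) ∈ branchTail (insert β q.dom) B h w := fun w =>
    ⟨mem_insert _ _, fun η hη => hqn η ((hBc w _ hη _ hη).elim id id), (hhβ w).symm⟩
  have hqle : ∀ a b, q.Le a b → branchLe q.Le (insert β q.dom) W B h a b := fun a b => Or.inl
  have hple : ∀ a b, p.Le a b → branchLe q.Le (insert β q.dom) W B h a b := by
    rintro a ⟨β', w⟩ hab
    rcases (mem_Iic.1 (hpβ (hp.lev_mem_right hab))).lt_or_eq with hlt | heq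
    · exact Or.inl (hpq hab hlt)
    · simp only at heq
      subst heq
      refine Or.inr ⟨w, hp.tree.right hab, hTail w, ?_⟩
      rcases (hp.tree.lev_le hab).lt_or_eq with hlt | heq
      · exact Or.inl (hB₀ w ⟨a, hab, hlt, hpq (hp.tree.left hab) hlt⟩)
      · rw [hp.tree.eq_of_lev_eq hab heq]
        exact Or.inr ⟨hTail w, le_rfl⟩
  have hCp := hp.coloured.mono hple
  have hCq := hq.coloured.mono hqle
  have hmixed : ∀ {ε γ s t t' ζ}, (ε, β, s, t, ζ) ∈ p.col → (ε, γ, s, t', ζ) ∈ q.col →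
      Nonempty (L ↪ {i | branchLe q.Le (insert β q.dom) W B h (γ, t' i) (β, t i)}) := by
    intro ε γ s t t' ζ hc hc'
    have hj : ((ε, β, s, t, ζ), (ε, γ, s, t', ζ)) ∈ J := ⟨hc, hc', rfl, rfl, rfl, rfl⟩
    choose i hi hi' using fun l => hBf (f (⟨_, hj⟩, l)) (⟨_, hj⟩, l) rfl
    refine ⟨⟨fun l => ⟨i l, ?_⟩, fun l l' hl => ?_⟩⟩
    · refine Or.inr ⟨t (i l), hp.tree.right (hp.coloured.above hc (i l)), hTail _, Or.inl ?_⟩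
      have h1 := hi' l
      rw [← hi l] at h1
      exact h1
    · have h1 : i l = i l' := congrArg Subtype.val hl
      have h2 := hfi ((hi l).symm.trans ((congrArg t h1).trans (hi l')))
      exact congrArg Prod.snd h2
  -- Colours of p below level β are colours of q already, so only those on the top level have to be
  -- added.
  have hC : IsColoured (branchLe q.Le (insert β q.dom) W B h)
      (q.col ∪ {c | c ∈ p.col ∧ c.2.1 = β}) :=
    { inj := by
        rintro ε γ s t ζ (hc | hc)
        exacts [hCq.inj hc, hCp.inj hc.1]
      above := by
        rintro ε γ s t ζ (hc | hc)
        exacts [hCq.above hc, hCp.above hc.1]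
      compat := by
        rintro ε γ γ' s t t' ζ (hc | ⟨hc, h1⟩) (hc' | ⟨hc', h2⟩)
        · exact hCq.compat hc hc'
        · simp only at h2
          subst h2
          obtain ⟨e⟩ := hmixed hc' hc
          exact ⟨e.trans (embeddingOfSubset _ _ fun i hi => Or.inl hi)⟩
        · simp only at h1
          subst h1
          obtain ⟨e⟩ := hmixed hc hc'
          exact ⟨e.trans (embeddingOfSubset _ _ fun i hi => Or.inr hi)⟩
        · exact hCp.compat hc hc' }
  have hsub := subset_downClosure D.isTree hC
  have hxf : Few L (insert β q.dom) := (Few.singleton β).union hq.wf.dom_few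
  refine ⟨_, isColouredTree_ofTree hxf (insert_subset (hp.wf.dom_lt hβ) hq.wf.dom_lt) D.isTree
    (BranchData.few_nodes hxf hWf (Pre.Few.nodes hq.wf))
    ((Pre.Few.col hq.wf).union ((Pre.Few.col hp.wf).mono fun c hc => hc.1)) hC,
    Pre.le_iff.2 ⟨subset_insert _ _, hqle, subset_union_left.trans hsub⟩,
    Pre.le_iff.2 ⟨fun γ hγ => ?_, hple, fun c hc => hsub ?_⟩, rfl⟩
  · rcases (mem_Iic.1 (hpβ hγ)).lt_or_eq with hlt | heq
    exacts [Or.inr (hqp.1 ⟨hγ, hlt⟩), Or.inl heq]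
  · rcases (mem_Iic.1 (hpβ (hp.wf.snd_mem _ hc))).lt_or_eq with hlt | heq
    exacts [Or.inl (hpqc hc hlt), Or.inr ⟨hc, heq⟩]

/-- Only the least level β of p at or above α requires work. With it placed on top of q, the rest of
p is spliced on, and β bounds all levels of the lower part. -/
theorem amalg [Infinite L] (hK : #L < #K) (hp : IsColouredTree L p) (hpc : ClosedInSup p.dom)
    (hq : IsColouredTree L q) (hle : q ≤ p.cut α) (hqα : q.dom ⊆ Iio α) :
    ∃ s, IsColouredTree L s ∧ s ≤ p ∧ s ≤ q ∧ s.dom = p.dom ∪ q.dom := by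
  by_cases hex : ∃ γ ∈ p.dom, α ≤ γ
  swap
  · push Not at hex
    have hpα : p.dom ⊆ Iio α := fun γ hγ => hex γ hγ
    rw [Pre.cut_eq_self hp.wf hpα] at hle
    exact ⟨q, hq, hle, le_rfl, (union_eq_right.2 hle.1).symm⟩
  obtain ⟨β, ⟨hβ, hαβ⟩, hmin⟩ : ∃ β, (β ∈ p.dom ∧ α ≤ β) ∧ ∀ γ ∈ p.dom, α ≤ γ → β ≤ γ :=
    ⟨sInf {γ | γ ∈ p.dom ∧ α ≤ γ}, csInf_mem (s := {γ | γ ∈ p.dom ∧ α ≤ γ}) hex,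
      fun γ h1 h2 => csInf_le' ⟨h1, h2⟩⟩
  have hqβ : q.dom ⊆ Iio β := hqα.trans (Iio_subset_Iio hαβ)
  have hlt : ∀ γ ∈ p.dom, γ < β → γ < α := fun γ h1 h2 =>
    lt_of_not_ge fun h => absurd h2 (hmin γ h1 h).not_gt
  have hqp : q ≤ (p.cut (Order.succ β)).cut β := by
    rw [Pre.cut_cut, min_eq_right (Order.le_succ β)]
    exact ⟨fun γ hγ => hle.1 ⟨hγ.1, hlt γ hγ.1 hγ.2⟩,
      fun f hf => hle.2 ⟨hf.1, hlt _ (hp.wf.snd_mem _ hf.1) hf.2⟩⟩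
  obtain ⟨r, hr, hrq, hrp, hrd⟩ := exists_top_level hK (hp.cut (Order.succ β))
    (hpc.inter_Iio hp.wf.bdd _) hq ⟨hβ, Order.lt_succ β⟩
    (fun γ hγ => mem_Iic.2 (Order.lt_succ_iff.1 hγ.2)) hqβ hqp
  obtain ⟨s, hs, hsp, hsd, hsr⟩ := hp.splice hr (α := Order.succ β) (by
      rw [hrd]
      exact insert_subset (Order.lt_succ β) fun γ hγ => (hqβ hγ).trans (Order.lt_succ β)) hrp
    fun γ hγ => ⟨β, hβ, by
      rw [hrd] at hγ
      rcases hγ with rfl | hγ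
      exacts [le_rfl, (hqβ hγ).le], Order.lt_succ β⟩
  refine ⟨s, hs, hsp, ?_, ?_⟩
  · rw [← hsr] at hrq
    exact Pre.le_cut.trans hrq
  · rw [hsd, hrd, union_insert]
    exact insert_eq_of_mem (mem_union_left _ hβ)

end IsColouredTree

/-- The class of coloured trees. -/
def treeClass (L K : Type u) [Infinite L] (hK : #L < #K) : FullClass L (TreeDatum L K) where
  Full := IsColouredTree L
  wf := IsColouredTree.wf
  trivial := IsColouredTree.trivial L K
  cut := IsColouredTree.cut
  move := fun h _ => h.move
  sup := fun _ _ hS hc h => IsColouredTree.sup hS hc h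
  extend := fun h _ => h.extend
  amalg := fun hp hpc hq _ => IsColouredTree.amalg hK hp hpc hq
  splice := fun hu hr _ => IsColouredTree.splice hu hr

/-! ### Density -/

namespace IsColouredTree

variable {L K : Type u} [Infinite L] {p q : Pre (TreeDatum L K)}

/-- Colours survive any enlargement of the order, so adding branches is a matter of the tree alone.
-/
theorem exists_branches (hq : IsColouredTree L q) {ι : Type v} {W : Set ι} (hW : Few L W)
    {B : ι → Set (Ordinal.{u} × K)} {h : ι → Ordinal.{u} → K}
    (D : BranchData q.dom q.Le q.dom W B h) :
    ∃ s, IsColouredTree L s ∧ s ≤ q ∧ s.dom = q.dom ∧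
      ∀ a b, branchLe q.Le q.dom W B h a b → s.Le a b := by
  have hle : ∀ a b, q.Le a b → branchLe q.Le q.dom W B h a b := fun a b => Or.inl
  have hC := hq.coloured.mono hle
  exact ⟨_, isColouredTree_ofTree hq.wf.dom_few hq.wf.dom_lt D.isTree
    (BranchData.few_nodes hq.wf.dom_few hW (Pre.Few.nodes hq.wf)) (Pre.Few.col hq.wf) hC,
    Pre.le_iff.2 ⟨subset_rfl, hle, subset_downClosure D.isTree hC⟩, rfl, fun a b h => h⟩

/-- Adding nodes. -/
theorem exists_nodes (hK : #L < #K) (hq : IsColouredTree L q) {Z : Set (Ordinal.{u} × K)}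
    (hZ : Few L Z) (hZq : ∀ a ∈ Z, a.1 ∈ q.dom) :
    ∃ s, IsColouredTree L s ∧ s ≤ q ∧ s.dom = q.dom ∧ ∀ a ∈ Z, s.Le a a := by
  classical
  let W : Set (Ordinal.{u} × K) := {a | a ∈ Z ∧ ¬ q.Le a a}
  have hW : Few L W := hZ.mono fun a ha => ha.1
  -- The fresh names avoid also those occurring in Z; otherwise the branch of one new node could run
  -- through another.
  obtain ⟨g, hg, hgn⟩ := Few.exists_fresh hK
    (((Pre.Few.nodes hq.wf).union hZ).image Prod.snd) hW
  let h : Ordinal.{u} × K → Ordinal.{u} → K := fun a γ => if γ = a.1 then a.2 else g a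
  have h1 : ∀ a, h a a.1 = a.2 := fun a => if_pos rfl
  have h2 : ∀ a γ, γ ≠ a.1 → h a γ = g a := fun a γ hγ => if_neg hγ
  have D : BranchData q.dom q.Le q.dom W (fun _ => ∅) h :=
    { tree := hq.tree
      subset := subset_rfl
      above := fun γ h h' => absurd h h'
      chain := fun w _ a ha => ha.elim
      down := fun w _ a ha => ha.elim
      fresh := by
        intro w hw γ hγ _ hn
        by_cases hγw : γ = w.1
        · subst hγw
          rw [h1] at hn
          exact hw.2 hn
        · rw [h2 w γ hγw] at hn
          exact hgn w ⟨_, Or.inl hn, rfl⟩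
      inj := by
        intro w hw w' hw' γ _ heq
        by_cases e : γ = w.1 <;> by_cases e' : γ = w'.1
        · refine Prod.ext (e.symm.trans e') ?_
          rw [← h1 w, ← h1 w', ← e, ← e', heq]
        · rw [h2 w' γ e', e, h1] at heq
          exact absurd ⟨w, Or.inr hw.1, heq⟩ (hgn w')
        · rw [h2 w γ e, e', h1] at heq
          exact absurd ⟨w', Or.inr hw'.1, heq.symm⟩ (hgn w)
        · rw [h2 w γ e, h2 w' γ e'] at heq
          exact hg hw hw' heq }
  obtain ⟨s, hs, hsq, hsd, hsb⟩ := hq.exists_branches hW D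
  refine ⟨s, hs, hsq, hsd, fun a ha => ?_⟩
  by_cases hn : q.Le a a
  · exact hsb _ _ (Or.inl hn)
  · have ht : a ∈ branchTail q.dom (fun _ => ∅) h a :=
      ⟨hZq a ha, fun η hη => hη.elim, (h1 a).symm⟩
    exact hsb _ _ (Or.inr ⟨a, ⟨ha, hn⟩, ht, Or.inr ⟨ht, le_rfl⟩⟩)

/-- Adding two branches above a chain, bounded by a level. -/
theorem exists_two_above (hK : #L < #K) (hq : IsColouredTree L q) {C : Set (Ordinal.{u} × K)}
    {β : Ordinal.{u}} (hβ : β ∈ q.dom) (hC : ∀ a ∈ C, ∀ b ∈ C, q.Le a b ∨ q.Le b a)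
    (hCβ : ∀ a ∈ C, a.1 < β) :
    ∃ s, IsColouredTree L s ∧ s ≤ q ∧ s.dom = q.dom ∧ ∃ η η', η ≠ η' ∧
      ∀ a ∈ C, s.Le a (β, η) ∧ s.Le a (β, η') := by
  have : Nonempty L := inferInstance
  obtain ⟨g, hg, hgn⟩ := Few.exists_fresh hK ((Pre.Few.nodes hq.wf).image Prod.snd)
    ((Few.singleton (L := L) true).union (Few.singleton false))
  -- Both branches have the downward closure of C as their initial segment and separate from there
  -- on, each with a single fresh name.
  let B : Set (Ordinal.{u} × K) := {a | ∃ b ∈ C, q.Le a b}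
  have D : BranchData q.dom q.Le q.dom ({true} ∪ {false}) (fun _ => B) fun w _ => g w :=
    { tree := hq.tree
      subset := subset_rfl
      above := fun γ h h' => absurd h h'
      chain := by
        rintro w - a ⟨b, hb, hab⟩ a' ⟨b', hb', hab'⟩
        exact hq.tree.comparable_mono (hC b hb b' hb') hab hab'
      down := by
        rintro w - b ⟨c, hc, hbc⟩ a hab
        exact ⟨c, hc, hq.tree.trans hab hbc⟩
      fresh := fun w _ γ _ _ hn => hgn w ⟨_, hn, rfl⟩
      inj := fun w hw w' hw' γ _ heq => hg hw hw' heq }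
  obtain ⟨s, hs, hsq, hsd, hsb⟩ := hq.exists_branches
    ((Few.singleton true).union (Few.singleton false)) D
  have ht : ∀ w, (β, g w) ∈ branchTail q.dom (fun _ => B) (fun w _ => g w) w := by
    refine fun w => ⟨hβ, ?_, rfl⟩
    rintro η ⟨b, hb, hle⟩
    exact absurd (hq.tree.lev_le hle) (hCβ b hb).not_ge
  have hle : ∀ w ∈ ({true} ∪ {false} : Set Bool), ∀ a ∈ C, s.Le a (β, g w) := fun w hw a ha =>
    hsb _ _ (Or.inr ⟨w, hw, ht w, Or.inl ⟨a, ha, (hC a ha a ha).elim id id⟩⟩)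
  exact ⟨s, hs, hsq, hsd, g true, g false,
    fun h => Bool.noConfusion (hg (Or.inl rfl) (Or.inr rfl) h),
    fun a ha => ⟨hle _ (Or.inl rfl) a ha, hle _ (Or.inr rfl) a ha⟩⟩

/-- Adding a colour. -/
theorem exists_colour (hK : #L < #K) (hq : IsColouredTree L q) {α β : Ordinal.{u}} {s t : L → K}
    (hs : Function.Injective s) (hle : ∀ i, q.Le (α, s i) (β, t i)) :
    ∃ r, IsColouredTree L r ∧ r ≤ q ∧ r.dom = q.dom ∧ ∃ ζ, (α, β, s, t, ζ) ∈ r.col := by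
  -- With an unused ζ, the new colour has to be compatible only with itself, which holds at all
  -- indices.
  obtain ⟨ζ, hζ⟩ := Few.exists_notMem hK ((Pre.Few.col hq.wf).image fun c => c.2.2.2.2)
  have hnew : ∀ {ε γ s t}, (ε, γ, s, t, ζ) ∉ q.col := fun h => hζ ⟨_, h, rfl⟩
  have : Nonempty L := inferInstance
  have hC : IsColoured q.Le (q.col ∪ {(α, β, s, t, ζ)}) :=
    { inj := by
        rintro ε γ s' t' ζ' (hc | hc)
        · exact hq.coloured.inj hc
        · obtain ⟨rfl, rfl, rfl, rfl, rfl⟩ := hc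
          exact hs
      above := by
        rintro ε γ s' t' ζ' (hc | hc)
        · exact hq.coloured.above hc
        · obtain ⟨rfl, rfl, rfl, rfl, rfl⟩ := hc
          exact hle
      compat := by
        rintro ε γ γ' s' t' t'' ζ' (hc | hc) (hc' | hc')
        · exact hq.coloured.compat hc hc'
        · obtain ⟨rfl, rfl, rfl, rfl, rfl⟩ := hc'
          exact absurd hc hnew
        · obtain ⟨rfl, rfl, rfl, rfl, rfl⟩ := hc
          exact absurd hc' hnew
        · obtain ⟨rfl, rfl, rfl, rfl, rfl⟩ := hc
          obtain ⟨-, rfl, -, rfl, -⟩ := hc'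
          exact ⟨⟨fun i => ⟨i, Or.inl (hq.tree.right (hle i))⟩, fun i j h =>
            congrArg Subtype.val h⟩⟩ }
  have hsub := subset_downClosure hq.tree hC
  exact ⟨_, isColouredTree_ofTree hq.wf.dom_few hq.wf.dom_lt hq.tree (Pre.Few.nodes hq.wf)
    ((Pre.Few.col hq.wf).union (Few.singleton _)) hC,
    Pre.le_iff.2 ⟨subset_rfl, fun a b h => h, subset_union_left.trans hsub⟩, rfl, ζ,
    hsub (Or.inr rfl)⟩

end IsColouredTree

/-! ### Dense systems -/

section Systems

variable {L K : Type u} [Infinite L]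

theorem two_lt_ord (L : Type u) [Infinite L] : 2 < (Order.succ #L).ord := by
  rw [Cardinal.lt_ord]
  have : Ordinal.card 2 = 2 := by simp
  rw [this]
  exact (Cardinal.natCast_lt_aleph0 (n := 2)).trans_le
    ((Cardinal.aleph0_le_mk L).trans (Order.le_succ _))

/-- The dense systems for normal and splitting trees. -/
def splitSystem (hK : #L < #K) (ξ : K) : (treeClass L K hK).DenseSystem where
  θ := 2
  Φ e p := (∃ η η', η ≠ η' ∧ p.Le (e 0, ξ) (e 1, η) ∧ p.Le (e 0, ξ) (e 1, η')) ∧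
    p.Le (e 0, ξ) (e 0, ξ) ∧ ∃ η, p.Le (e 0, η) (e 1, ξ)
  θ_lt := two_lt_ord L
  congr e e' p he h := by
    rwa [← he (mem_Iio.2 two_pos), ← he (mem_Iio.2 one_lt_two)]
  move e p π hp he hπ := by
    have h0 := he (mem_Iio.2 two_pos)
    have h1 := he (mem_Iio.2 one_lt_two)
    simp only [Function.comp_apply, IsColouredTree.Le_move_iff' hp hπ.injOn h0 h1,
      IsColouredTree.Le_move_iff' hp hπ.injOn h0 h0]
  dense := by
    intro e q (hq : IsColouredTree L q) _ he hm
    have h0 := hm (mem_Iio.2 two_pos)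
    have h1 := hm (mem_Iio.2 one_lt_two)
    have hlt : e 0 < e 1 := he (mem_Iio.2 two_pos) (mem_Iio.2 one_lt_two) one_pos
    have : Nonempty L := inferInstance
    -- All facts are recorded explicitly, including a predecessor of (e 1, ξ), because members of
    -- the generic set need not be complete.
    obtain ⟨r, hr, hrq, hrd, hrn⟩ := hq.exists_nodes hK (Z := {(e 0, ξ)} ∪ {(e 1, ξ)})
      ((Few.singleton _).union (Few.singleton _)) (by
        rintro a (rfl | rfl)
        exacts [h0, h1])
    have hn0 := hrn _ (Or.inl rfl)
    obtain ⟨η₀, hη₀⟩ := hr.tree.pred (hrn (e 1, ξ) (Or.inr rfl)) (hrd ▸ h0) hlt.le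
    obtain ⟨s, hs, hsr, hsd, η, η', hne, hη⟩ := hr.exists_two_above hK (C := {(e 0, ξ)})
      (hrd ▸ h1) (by rintro _ rfl _ rfl; exact Or.inl hn0) (by rintro _ rfl; exact hlt)
    exact ⟨s, hs, hsr.trans hrq, hsd.trans hrd, ⟨η, η', hne, hη _ rfl⟩, hsr.2 hn0, η₀, hsr.2 hη₀⟩

/-- The dense systems for the colouring. -/
def colourSystem (hK : #L < #K) {s : L → K} (hs : Function.Injective s) (t : L → K) :
    (treeClass L K hK).DenseSystem where
  θ := 2
  Φ e p := (∀ i, ∃ η, p.Le (e 0, η) (e 1, t i)) ∧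
    ((∃ i η, η ≠ s i ∧ p.Le (e 0, η) (e 1, t i)) ∨ ∃ ζ, (e 0, e 1, s, t, ζ) ∈ p.col)
  θ_lt := two_lt_ord L
  congr e e' p he h := by
    rwa [← he (mem_Iio.2 two_pos), ← he (mem_Iio.2 one_lt_two)]
  move e p π hp he hπ := by
    have h0 := he (mem_Iio.2 two_pos)
    have h1 := he (mem_Iio.2 one_lt_two)
    simp only [Function.comp_apply, IsColouredTree.Le_move_iff' hp hπ.injOn h0 h1,
      IsColouredTree.mem_col_move_iff' hp hπ.injOn h0 h1]
  dense := by
    intro e q (hq : IsColouredTree L q) _ he hm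
    have h0 := hm (mem_Iio.2 two_pos)
    have h1 := hm (mem_Iio.2 one_lt_two)
    have hlt : e 0 < e 1 := he (mem_Iio.2 two_pos) (mem_Iio.2 one_lt_two) one_pos
    obtain ⟨r, hr, hrq, hrd, hrn⟩ := hq.exists_nodes hK (Z := Set.range fun i => (e 1, t i))
      (Few.range _) (by rintro _ ⟨i, rfl⟩; exact h1)
    have hpred : ∀ i, ∃ η, r.Le (e 0, η) (e 1, t i) := fun i =>
      hr.tree.pred (hrn (e 1, t i) ⟨i, rfl⟩) (hrd ▸ h0) hlt.le
    -- Either a predecessor different from s i is already recorded, which rules the pair (s, t) out,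
    -- or t lies above s and a colour can be added.
    by_cases hex : ∃ i η, η ≠ s i ∧ r.Le (e 0, η) (e 1, t i)
    · exact ⟨r, hr, hrq, hrd, hpred, Or.inl hex⟩
    · push Not at hex
      have hle : ∀ i, r.Le (e 0, s i) (e 1, t i) := by
        intro i
        obtain ⟨η, hη⟩ := hpred i
        by_cases h : η = s i
        · rwa [← h]
        · exact absurd hη (hex i η h)
      obtain ⟨s, h1, h2, h3, h4⟩ := hr.exists_colour hK hs hle
      exact ⟨s, h1, h2.trans hrq, h3.trans hrd,
        fun i => (hpred i).imp fun η hη => h2.2 hη, Or.inr h4⟩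

/-- The dense systems for complete trees. -/
def boundSystem (hK : #L < #K) {μ : Ordinal.{u}} (hμ : μ < (Order.succ #L).ord)
    (g : Ordinal.{u} → K) : (treeClass L K hK).DenseSystem where
  θ := Order.succ μ
  Φ e p := (∃ a b η, a < b ∧ b < μ ∧ η ≠ g a ∧ p.Le (e a, η) (e b, g b)) ∨
    ∃ η, ∀ a < μ, p.Le (e a, g a) (e μ, η)
  θ_lt := (Cardinal.isSuccLimit_ord
    ((Cardinal.aleph0_le_mk L).trans (Order.le_succ _))).succ_lt hμ
  congr := by
    intro e e' p he h
    have he' : ∀ a ≤ μ, e a = e' a := fun a ha => he (Order.lt_succ_iff.2 ha)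
    rcases h with ⟨a, b, η, hab, hb, h1, h2⟩ | ⟨η, h⟩
    · exact Or.inl ⟨a, b, η, hab, hb, h1, by rwa [← he' a (hab.trans hb).le, ← he' b hb.le]⟩
    · exact Or.inr ⟨η, fun a ha => by rw [← he' a ha.le, ← he' μ le_rfl]; exact h a ha⟩
  move := by
    intro e p π hp he hπ
    have he' : ∀ a ≤ μ, e a ∈ p.dom := fun a ha => he (Order.lt_succ_iff.2 ha)
    refine or_congr ?_ ?_
    · refine exists_congr fun a => exists_congr fun b => exists_congr fun η =>
        and_congr_right fun hab => and_congr_right fun hb => and_congr_right fun _ => ?_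
      exact IsColouredTree.Le_move_iff' hp hπ.injOn (he' a (hab.trans hb).le) (he' b hb.le)
    · refine exists_congr fun η => forall_congr' fun a => imp_congr_right fun ha => ?_
      exact IsColouredTree.Le_move_iff' hp hπ.injOn (he' a ha.le) (he' μ le_rfl)
  dense := by
    intro e q (hq : IsColouredTree L q) _ he hm
    have hm' : ∀ a ≤ μ, e a ∈ q.dom := fun a ha => hm (Order.lt_succ_iff.2 ha)
    have he' : ∀ a b, a < b → b ≤ μ → e a < e b := fun a b hab hb =>
      he (Order.lt_succ_iff.2 (hab.le.trans hb)) (Order.lt_succ_iff.2 hb) hab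
    obtain ⟨r, hr, hrq, hrd, hrn⟩ := hq.exists_nodes hK (Z := (fun a => (e a, g a)) '' Iio μ)
      ((few_Iio_iff.2 hμ).image _) (by
        rintro _ ⟨a, ha, rfl⟩
        exact hm' a (le_of_lt ha))
    -- Either the tree witnesses that the nodes (e a, g a) do not form a chain, or they form one and
    -- a branch above it is added up to level e μ.
    by_cases hex : ∃ a b η, a < b ∧ b < μ ∧ η ≠ g a ∧ r.Le (e a, η) (e b, g b)
    · exact ⟨r, hr, hrq, hrd, Or.inl hex⟩
    · push Not at hex
      have hle : ∀ a b, a ≤ b → b < μ → r.Le (e a, g a) (e b, g b) := by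
        intro a b hab hb
        rcases hab.eq_or_lt with rfl | hab
        · exact hrn _ ⟨a, hb, rfl⟩
        obtain ⟨η, hη⟩ := hr.tree.pred (hrn (e b, g b) ⟨b, hb, rfl⟩)
          (hrd ▸ hm' a (hab.trans hb).le) (he' a b hab hb.le).le
        by_cases h : η = g a
        · rwa [← h]
        · exact absurd hη (hex a b η hab hb h)
      obtain ⟨s, h1, h2, h3, η, _, _, h4⟩ := hr.exists_two_above hK
        (C := (fun a => (e a, g a)) '' Iio μ) (hrd ▸ hm' μ le_rfl) (by
          rintro _ ⟨a, ha, rfl⟩ _ ⟨b, hb, rfl⟩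
          exact (le_total a b).imp (hle a b · hb) (hle b a · ha)) (by
          rintro _ ⟨a, ha, rfl⟩
          exact he' a μ ha le_rfl)
      exact ⟨s, h1, h2.trans hrq, h3.trans hrd, Or.inr ⟨η, fun a ha => (h4 _ ⟨a, ha, rfl⟩).1⟩⟩

end Systems

/-! ### The generic tree -/

theorem isCoi_pair {μ : Ordinal.{u}} {α β : Ordinal.{u}} (hμ : 2 < μ) (hαβ : α < β) (hβ : β < μ) :
    IsCoi μ (Iio 2) fun o => if o = 0 then α else β := by
  have h01 : ∀ o : Ordinal.{u}, o < 2 → o = 0 ∨ o = 1 := by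
    intro o ho
    have h2 : (2 : Ordinal.{u}) = Order.succ 1 := by rw [Order.succ_eq_add_one, one_add_one_eq_two]
    rw [h2, Order.lt_succ_iff, Order.le_one_iff] at ho
    exact ho
  refine ⟨fun o ho => lt_trans ho hμ, closedInSup_Iio _, fun o ho => ?_, ?_, ?_⟩
  · split_ifs
    exacts [hαβ.trans hβ, hβ]
  · intro a ha b hb hab
    rcases h01 a ha with rfl | rfl <;> rcases h01 b hb with rfl | rfl
    · exact absurd hab (lt_irrefl _)
    · simpa using hαβ
    · exact absurd hab (not_lt.2 zero_le_one)
    · exact absurd hab (lt_irrefl _)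
  · intro δ hδ h0 hs
    rw [sSup_inter_eq_iff h0] at hs
    obtain ⟨γ, hγ, h1, h2⟩ := hs 0 h0
    rcases h01 γ hγ with rfl | rfl
    · exact absurd h1 (lt_irrefl _)
    · rcases h01 δ hδ with rfl | rfl
      · exact absurd h0 (lt_irrefl _)
      · exact absurd h2 (lt_irrefl _)

section Generic

variable {L K : Type u} [Infinite L]

/-- Since λ⁺ ≤ 2^λ, there are at most (2^λ)^λ = 2^λ sequences. This is the point where the
consequence of the axiom for cardinal arithmetic is used. -/
theorem mk_treeDatum_le (hK : #K = Order.succ #L) (hL : 2 ^ #L ≤ Order.succ #L) :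
    #(L → K) ≤ Order.succ #L ∧ #(TreeDatum L K) ≤ Order.succ #L := by
  have h0 := Cardinal.aleph0_le_mk L
  have h0' : ℵ₀ ≤ Order.succ #L := h0.trans (Order.le_succ _)
  have h1 : #(L → K) ≤ Order.succ #L := by
    have h2 : Order.succ #L ≤ 2 ^ #L := Order.succ_le_of_lt (Cardinal.cantor _)
    calc #(L → K) = #K ^ #L := by simp
      _ ≤ (2 ^ #L) ^ #L := Cardinal.power_le_power_right (hK.trans_le h2)
      _ = 2 ^ #L := by rw [← Cardinal.power_mul, Cardinal.mul_eq_self h0]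
      _ ≤ _ := hL
  have hm : ∀ {a b : Cardinal.{u}}, a ≤ Order.succ #L → b ≤ Order.succ #L →
      a * b ≤ Order.succ #L := Cardinal.mul_le_of_le h0'
  refine ⟨h1, ?_⟩
  simp only [TreeDatum, Cardinal.mk_sum, Cardinal.mk_prod, Cardinal.lift_id]
  exact Cardinal.add_le_of_le h0' (hm hK.le hK.le) (hm h1 (hm h1 hK.le))

/-- The generic tree, with nodes `(γ, ξ)` for `γ < (#L)⁺⁺` and `ξ : K`, and its colours. -/
theorem exists_generic_tree (hK : #K = Order.succ #L) (hFA : ForcingAxiom (Order.succ #L)) :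
    ∃ (le : Ordinal.{u} × K → Ordinal.{u} × K → Prop) (R : Set (Colour L K)),
      IsTree (Iio (succOrd (Order.succ #L))) le ∧
      (∀ α ξ, α < succOrd (Order.succ #L) → le (α, ξ) (α, ξ)) ∧
      (∀ α β ξ, α < β → β < succOrd (Order.succ #L) →
        ∃ η η', η ≠ η' ∧ le (α, ξ) (β, η) ∧ le (α, ξ) (β, η')) ∧
      (∀ ε γ γ' s t t' ζ, (ε, γ, s, t, ζ) ∈ R → (ε, γ', s, t', ζ) ∈ R →
        ∃ i, le (γ, t i) (γ', t' i) ∨ le (γ', t' i) (γ, t i)) ∧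
      (∀ α β s t, α < β → β < succOrd (Order.succ #L) → Function.Injective s →
        (∀ i, le (α, s i) (β, t i)) → ∃ ζ, (α, β, s, t, ζ) ∈ R) ∧
      ∀ μ < (Order.succ #L).ord, ∀ e, IsCoi (succOrd (Order.succ #L)) (Iio (Order.succ μ)) e →
        ∀ g : Ordinal.{u} → K, (∀ a b, a < b → b < μ → le (e a, g a) (e b, g b)) →
        ∃ η, ∀ a < μ, le (e a, g a) (e μ, η) := by
  have hLK : #L < #K := hK ▸ Order.lt_succ _
  have h0 := Cardinal.aleph0_le_mk L
  have h0' : ℵ₀ ≤ Order.succ #L := h0.trans (Order.le_succ _)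
  have : Nonempty L := inferInstance
  have : Nonempty K := Cardinal.mk_ne_zero_iff.1 (hLK.ne_bot)
  obtain ⟨hLK', hD⟩ := mk_treeDatum_le hK (two_power_le_of_forcingAxiom hFA)
  have hfew : ∀ μ : Iio (Order.succ #L).ord, Few L (Iio μ.1) := fun μ => few_Iio_iff.2 μ.2
  let f := fun μ : (Order.succ #L).ord.ToType => (hfew (Ordinal.ToType.mk.symm μ)).some
  classical
  -- Functions on μ are given by functions on `L`, along an injection of μ into `L`, so that κ many
  -- indices suffice.
  let ext : (μ : (Order.succ #L).ord.ToType) → (L → K) → Ordinal.{u} → K := fun μ g a =>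
    if h : a < (Ordinal.ToType.mk.symm μ).1 then g (f μ ⟨a, h⟩) else Classical.arbitrary K
  have hext : ∀ μ (g : Ordinal.{u} → K), ∃ g', ∀ a < (Ordinal.ToType.mk.symm μ).1,
      ext μ g' a = g a := fun μ g =>
    ⟨Function.extend (f μ) (fun a => g a.1) fun _ => Classical.arbitrary K, fun a ha => by
      simp only [ext, dif_pos ha, (f μ).injective.extend_apply]⟩
  let I := K ⊕ ({s : L → K // Function.Injective s} × (L → K)) ⊕
    ((Order.succ #L).ord.ToType × (L → K))
  have hI : #I ≤ Order.succ #L := by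
    have hm : ∀ {a b : Cardinal.{u}}, a ≤ Order.succ #L → b ≤ Order.succ #L →
      a * b ≤ Order.succ #L := Cardinal.mul_le_of_le h0'
    simp only [I, Cardinal.mk_sum, Cardinal.mk_prod, Cardinal.lift_id, Cardinal.mk_ord_toType]
    exact Cardinal.add_le_of_le h0' hK.le (Cardinal.add_le_of_le h0'
      (hm ((Cardinal.mk_subtype_le _).trans hLK') hLK') (hm le_rfl hLK'))
  let E : I → (treeClass L K hLK).DenseSystem := Sum.elim (splitSystem hLK)
    (Sum.elim (fun c => colourSystem hLK c.1.2 c.2)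
      fun c => boundSystem hLK (mem_Iio.1 (Ordinal.ToType.mk.symm c.1).2) (ext c.1 c.2))
  obtain ⟨G, hdir, hfull, hG⟩ := (treeClass L K hLK).exists_generic hFA hD hI E
  -- Members of G need not be complete, and their completions need not be in G. So relations are
  -- compared in a completion, while their presence in G comes from dense systems, the two being
  -- matched by uniqueness of predecessors.
  have hful : ∀ p ∈ G, ∀ q ∈ G, ∃ t, IsColouredTree L t ∧ t ≤ p ∧ t ≤ q := by
    intro p hp q hq
    obtain ⟨r, hr, h1, h2⟩ := hdir p hp q hq
    obtain ⟨t, ht, htr⟩ := hfull r hr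
    exact ⟨t, ht, htr.trans h1, htr.trans h2⟩
  have h2μ : 2 < succOrd (Order.succ #L) :=
    (two_lt_ord L).trans (Cardinal.ord_lt_ord.2 (Order.lt_succ _))
  have h01 : ∀ α β : Ordinal.{u}, (if (1 : Ordinal.{u}) = 0 then α else β) = β :=
    fun α β => if_neg one_ne_zero
  let le : Ordinal.{u} × K → Ordinal.{u} × K → Prop := fun a b => ∃ p ∈ G, p.Le a b
  have hsplit : ∀ α β ξ, α < β → β < succOrd (Order.succ #L) →
      (∃ η η', η ≠ η' ∧ le (α, ξ) (β, η) ∧ le (α, ξ) (β, η')) ∧ le (α, ξ) (α, ξ) ∧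
      ∃ η, le (α, η) (β, ξ) := by
    intro α β ξ hαβ hβ
    obtain ⟨p, hp, -, ⟨η, η', hne, h1, h2⟩, h4, η₀, h3⟩ := hG (Sum.inl ξ) _ (isCoi_pair h2μ hαβ hβ)
    simp only [h01] at h1 h2 h3 h4
    exact ⟨⟨η, η', hne, ⟨p, hp, h1⟩, ⟨p, hp, h2⟩⟩, ⟨p, hp, h4⟩, η₀, p, hp, h3⟩
  have hrefl : ∀ a : Ordinal.{u} × K, a.1 < succOrd (Order.succ #L) → le a a := fun a ha =>
    (hsplit a.1 (Order.succ a.1) a.2 (Order.lt_succ _) ((Cardinal.isSuccLimit_ord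
      (h0'.trans (Order.le_succ _))).succ_lt ha)).2.1
  have hlt : ∀ {a b}, le a b → a.1 ≤ b.1 ∧ b.1 < succOrd (Order.succ #L) := by
    rintro a b ⟨p, hp, hab⟩
    obtain ⟨t, ht, htp, -⟩ := hful p hp p hp
    exact ⟨ht.tree.lev_le (htp.2 hab), ht.wf.dom_lt (ht.lev_mem_right (htp.2 hab))⟩
  have hpred : ∀ (a : Ordinal.{u} × K) (γ : Ordinal.{u}), a.1 < succOrd (Order.succ #L) →
      γ ≤ a.1 → ∃ η, le (γ, η) a := by
    rintro ⟨α, ξ⟩ γ ha hγ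
    rcases hγ.eq_or_lt with rfl | hγ
    exacts [⟨ξ, hrefl _ ha⟩, (hsplit γ α ξ hγ ha).2.2]
  have huniq : ∀ {a : Ordinal.{u} × K} {γ η η'}, le (γ, η) a → le (γ, η') a → η = η' := by
    rintro a γ η η' ⟨p, hp, h1⟩ ⟨q, hq, h2⟩
    obtain ⟨t, ht, htp, htq⟩ := hful p hp q hq
    exact ht.tree.uniq (htp.2 h1) (htq.2 h2)
  refine ⟨le, {c | ∃ p ∈ G, c ∈ p.col},
    { lev_le := fun h => (hlt h).1
      lev_mem := fun h => (hlt h).2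
      left := fun h => hrefl _ ((hlt h).1.trans_lt (hlt h).2)
      right := fun h => hrefl _ (hlt h).2
      trans := ?_
      pred := fun h _ hle => hpred _ _ (hlt h).2 hle
      uniq := huniq }, fun α ξ h => hrefl _ h, fun α β ξ h h' => (hsplit α β ξ h h').1, ?_, ?_, ?_⟩
  · intro a b c hab hbc
    -- A member of G names the predecessor of c on the level of a; a completion shows that it is a.
    obtain ⟨η, r, hr, hη⟩ := hpred c a.1 (hlt hbc).2 ((hlt hab).1.trans (hlt hbc).1)
    obtain ⟨p, hp, hab⟩ := hab
    obtain ⟨q, hq, hbc⟩ := hbc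
    obtain ⟨p', hp', h1, h2⟩ := hdir p hp q hq
    obtain ⟨t, ht, h3, h4⟩ := hful p' hp' r hr
    have h5 := ht.tree.trans ((h3.trans h1).2 hab) ((h3.trans h2).2 hbc)
    have h6 : η = a.2 := ht.tree.uniq (h4.2 hη) h5
    subst h6
    exact ⟨r, hr, hη⟩
  · have key : ∀ ε γ γ' s t t' ζ, γ ≤ γ' → (∃ p ∈ G, (ε, γ, s, t, ζ) ∈ p.col) →
        (∃ p ∈ G, (ε, γ', s, t', ζ) ∈ p.col) → ∃ i, le (γ, t i) (γ', t' i) := by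
      rintro ε γ γ' s t t' ζ hγγ ⟨p, hp, h1⟩ ⟨q, hq, h2⟩
      obtain ⟨p', hp', h3, h4⟩ := hdir p hp q hq
      obtain ⟨r, hr, hrp, -⟩ := hful p' hp' p' hp'
      have h1' : (ε, γ, s, t, ζ) ∈ r.col := (hrp.trans h3).2 h1
      have hγ' : γ' < succOrd (Order.succ #L) :=
        hr.wf.dom_lt (hr.wf.snd_mem _ ((hrp.trans h4).2 h2))
      rcases hγγ.eq_or_lt with rfl | hlt'
      · obtain ⟨k⟩ := hr.coloured.compat h1' ((hrp.trans h4).2 h2)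
        obtain ⟨i, hi⟩ := k (Classical.arbitrary L)
        have hi : r.Le (γ, t i) (γ, t' i) := hr.tree.le_of_comparable hi le_rfl
        refine ⟨i, ?_⟩
        rw [hr.tree.eq_of_lev_eq hi rfl]
        exact hrefl _ hγ'
      -- Only the first clause of this system is needed: it makes a member of G name the
      -- predecessors of t' on level γ. The second clause refers to level γ as well but is ignored.
      · obtain ⟨q', hq', -, h5, -⟩ := hG (Sum.inr (Sum.inl (⟨s, hr.coloured.inj h1'⟩, t'))) _
          (isCoi_pair h2μ hlt' hγ')
        simp only [h01] at h5
        obtain ⟨u, hu, hup, huq⟩ := hful p' hp' q' hq'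
        obtain ⟨k⟩ := hu.coloured.compat (show (ε, γ, s, t, ζ) ∈ u.col from (hup.trans h3).2 h1)
          ((hup.trans h4).2 h2)
        obtain ⟨i, hi⟩ := k (Classical.arbitrary L)
        have hi : u.Le (γ, t i) (γ', t' i) := hu.tree.le_of_comparable hi hγγ
        obtain ⟨η, hη⟩ := h5 i
        have : η = t i := hu.tree.uniq (huq.2 hη) hi
        subst this
        exact ⟨i, q', hq', hη⟩
    intro ε γ γ' s t t' ζ h1 h2
    rcases le_total γ γ' with h | h
    · obtain ⟨i, hi⟩ := key _ _ _ _ _ _ _ h h1 h2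
      exact ⟨i, Or.inl hi⟩
    · obtain ⟨i, hi⟩ := key _ _ _ _ _ _ _ h h2 h1
      exact ⟨i, Or.inr hi⟩
  · intro α β s t hαβ hβ hs hle
    obtain ⟨p, hp, -, -, ⟨i, η, hne, h⟩ | ⟨ζ, h⟩⟩ :=
      hG (Sum.inr (Sum.inl (⟨s, hs⟩, t))) _ (isCoi_pair h2μ hαβ hβ)
    · simp only [h01] at h
      exact absurd (huniq ⟨p, hp, h⟩ (hle i)) hne
    · simp only [h01] at h
      exact ⟨ζ, p, hp, h⟩
  · intro μ hμ e he g hg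
    obtain ⟨m, rfl⟩ : ∃ m : (Order.succ #L).ord.ToType, (Ordinal.ToType.mk.symm m).1 = μ :=
      ⟨Ordinal.ToType.mk ⟨μ, hμ⟩, by simp⟩
    obtain ⟨g', hg'⟩ := hext m g
    obtain ⟨p, hp, -, ⟨a, b, η, hab, hb, hne, h⟩ | ⟨η, h⟩⟩ := hG (Sum.inr (Sum.inr (m, g'))) e he
    · rw [hg' a (hab.trans hb)] at hne
      rw [hg' b hb] at h
      exact absurd (huniq ⟨p, hp, h⟩ (hg a b hab hb)) hne
    · refine ⟨η, fun a ha => ⟨p, hp, ?_⟩⟩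
      have := h a ha
      rwa [hg' a ha] at this

end Generic

/-! ### Covering the levels of a chain by a closed copy -/

/-- A set of at most `#L` ordinals below `(#L)⁺⁺` is covered by a proper initial part of a closed
copy of a successor ordinal. -/
theorem exists_isCoi_cover {L : Type u} [Infinite L] {A : Set Ordinal.{u}} (hA : Few L A)
    (hAμ : A ⊆ Iio (succOrd (Order.succ #L))) :
    ∃ μ < (Order.succ #L).ord, ∃ e, IsCoi (succOrd (Order.succ #L)) (Iio (Order.succ μ)) e ∧
      A ⊆ e '' Iio μ ∧ ∀ a < μ, ∃ γ ∈ A, e a ≤ γ := by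
  have hb := bddAbove_of_subset_Iio hAμ
  have hδμ : ssup A < succOrd (Order.succ #L) := by
    obtain ⟨K, hK⟩ : ∃ K : Type u, #K = Order.succ #L := ⟨(Order.succ #L).out, Cardinal.mk_out _⟩
    obtain ⟨f⟩ := Cardinal.le_def _ _ |>.1 (hK ▸ Order.le_succ #L : #L ≤ #K)
    have : Infinite K := Infinite.of_injective f f.injective
    rw [succOrd, ← hK] at hAμ ⊢
    exact few_Iio_iff.1 (few_Iio_ssup (hA.map fun g => g.trans f) hAμ)
  -- Everything from the strict supremum on is added to make S unbounded, so that `Ordinal.enumOrd`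
  -- applies; the copy ends at the position μ of that supremum.
  let S : Set Ordinal.{u} := ordCl A ∪ Ici (ssup A)
  have hS : ¬ BddAbove S := fun h => not_bddAbove_Ici (ssup A) (h.mono subset_union_right)
  let e := Ordinal.enumOrd S
  have he : StrictMono e := Ordinal.enumOrd_strictMono hS
  have hr : Set.range e = S := Ordinal.range_enumOrd hS
  obtain ⟨μ, hμ⟩ : ssup A ∈ Set.range e := by
    rw [hr]; exact Or.inr (mem_Ici.2 le_rfl)
  have hcl : ∀ a, e a < ssup A → e a ∈ ordCl A := fun a ha => by
    have : e a ∈ S := hr ▸ mem_range_self a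
    exact this.resolve_right (not_le.2 ha)
  have hlt : ∀ a < μ, e a < ssup A := fun a ha => hμ ▸ he ha
  have hμf : μ < (Order.succ #L).ord := by
    refine few_Iio_iff.1 (((hA.ordCl hb).preimage (f := e) he.injective.injOn).mono ?_)
    exact fun a ha => hcl a (hlt a ha)
  refine ⟨μ, hμf, e, ⟨fun a ha => ?_, closedInSup_Iio _, fun a ha => ?_, he.strictMonoOn _, ?_⟩,
    ?_, fun a ha => exists_ge_of_mem_ordCl hb (hcl a (hlt a ha))⟩
  · exact (Order.lt_succ_iff.1 ha).trans_lt (hμf.trans (Cardinal.ord_lt_ord.2 (Order.lt_succ _)))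
  · exact ((he.monotone (Order.lt_succ_iff.1 ha)).trans_eq hμ).trans_lt hδμ
  · intro δ hδ h0 hs
    rw [sSup_inter_eq_iff h0] at hs
    have hub : ∀ a ∈ e '' (Iio (Order.succ μ) ∩ Iio δ), a ≤ e δ := by
      rintro _ ⟨a, ha, rfl⟩
      exact (he ha.2).le
    have hle : ∀ a < δ, e a ≤ sSup (e '' (Iio (Order.succ μ) ∩ Iio δ)) := fun a ha =>
      le_csSup ⟨_, hub⟩ ⟨a, ⟨lt_trans ha hδ, ha⟩, rfl⟩
    have hlt' : ∀ a < δ, e a < sSup (e '' (Iio (Order.succ μ) ∩ Iio δ)) := fun a ha => by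
      obtain ⟨γ, -, h1, h2⟩ := hs a ha
      exact (he h1).trans_le (hle γ h2)
    refine le_antisymm ?_ (csSup_le' hub)
    generalize hσ : sSup (e '' (Iio (Order.succ μ) ∩ Iio δ)) = σ at hle hlt'
    -- The supremum of the earlier values belongs to S by closedness, so it is a value of e;
    -- exceeding all earlier values, it is at least e δ.
    have hmem : σ ∈ S := by
      rcases le_or_gt (ssup A) σ with h | h
      · exact Or.inr h
      obtain ⟨γ, hγ, hle'⟩ := (lt_ssup_iff hb).1 h
      refine Or.inl ((closedInSup_iff (bddAbove_ordCl hb)).1 (closedInSup_ordCl hb) σ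
        ((zero_le (a := e 0)).trans_lt (hlt' 0 h0)) ⟨γ, subset_ordCl A hγ, hle'⟩ fun β hβ => ?_)
      rw [← hσ] at hβ
      obtain ⟨_, ⟨a, ha, rfl⟩, h1⟩ := exists_lt_of_lt_csSup
        (s := e '' (Iio (Order.succ μ) ∩ Iio δ)) ⟨e 0, 0, ⟨lt_trans h0 hδ, h0⟩, rfl⟩ hβ
      exact ⟨e a, hcl a ((hlt' a ha.2).trans h), h1, hlt' a ha.2⟩
    rw [← hr] at hmem
    obtain ⟨a, rfl⟩ := hmem
    exact he.monotone (le_of_not_gt fun h => lt_irrefl _ (hlt' a h))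
  · intro γ hγ
    obtain ⟨a, rfl⟩ : γ ∈ Set.range e := hr ▸ Or.inl (subset_ordCl A hγ)
    exact ⟨a, he.lt_iff_lt.1 (((lt_ssup_iff hb).2 ⟨_, hγ, le_rfl⟩).trans_eq hμ.symm), rfl⟩

/-! ### From level functions to tree orders -/

section Levels

variable {T : Type u} [PartialOrder T] {lev : T → Ordinal.{u}}

/-- The predecessors of a node are enumerated by their levels. -/
noncomputable def levelIso (hlev : ∀ x y, x < y → lev x < lev y)
    (hcomp : ∀ x y z, y < x → z < x → lev y ≤ lev z → y ≤ z)
    (hsurj : ∀ x, ∀ γ < lev x, ∃ y < x, lev y = γ) (x : T) :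
    (fun a b : Iio x => a < b) ≃r (fun a b : Iio (lev x) => a < b) where
  toEquiv := Equiv.ofBijective (fun y => ⟨lev y.1, hlev _ _ y.2⟩) <| by
    refine ⟨fun y z h => ?_, fun γ => ?_⟩
    · have h : lev y.1 = lev z.1 := congrArg Subtype.val h
      exact Subtype.ext (le_antisymm (hcomp x _ _ y.2 z.2 h.le) (hcomp x _ _ z.2 y.2 h.ge))
    · obtain ⟨y, hy, h⟩ := hsurj x γ.1 γ.2
      exact ⟨⟨y, hy⟩, Subtype.ext h⟩
  map_rel_iff' := by
    rintro y z
    refine ⟨fun h => ?_, fun h => hlev _ _ h⟩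
    have h : lev y.1 < lev z.1 := h
    exact lt_of_le_of_ne (hcomp x _ _ y.2 z.2 h.le) fun e => by simp [e] at h

theorem isTreeOrder_of_levels (hlev : ∀ x y, x < y → lev x < lev y)
    (hcomp : ∀ x y z, y < x → z < x → lev y ≤ lev z → y ≤ z)
    (hsurj : ∀ x, ∀ γ < lev x, ∃ y < x, lev y = γ) : IsTreeOrder T :=
  ⟨fun x => (levelIso hlev hcomp hsurj x).toRelEmbedding.isWellOrder⟩

theorem treeHeight_eq_of_levels [IsTreeOrder T] (hlev : ∀ x y, x < y → lev x < lev y)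
    (hcomp : ∀ x y z, y < x → z < x → lev y ≤ lev z → y ≤ z)
    (hsurj : ∀ x, ∀ γ < lev x, ∃ y < x, lev y = γ) (x : T) : treeHeight x = lev x := by
  have := IsTreeOrder.wo x
  rw [← Ordinal.type_toType (lev x)]
  exact Ordinal.type_eq.2 ⟨(levelIso hlev hcomp hsurj x).trans
    (Ordinal.ToType.mk (o := lev x)).toRelIsoLT⟩

end Levels

/-- All pairs with level below μ are nodes, so `μ.ToType × K` carries the order. Having exactly one
predecessor on each lower level makes the height equal to the level. -/
theorem IsTree.exists_treeOrder {K : Type u} {μ : Ordinal.{u}}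
    {le : Ordinal.{u} × K → Ordinal.{u} × K → Prop} (hT : IsTree (Iio μ) le)
    (hr : ∀ α ξ, α < μ → le (α, ξ) (α, ξ)) :
    ∃ (T : Type u) (_ : PartialOrder T) (_ : IsTreeOrder T) (N : T → Ordinal.{u} × K),
      Function.Injective N ∧ Set.range N = {a | a.1 < μ} ∧ (∀ x y, x ≤ y ↔ le (N x) (N y)) ∧
      (∀ x y, x < y ↔ le (N x) (N y) ∧ (N x).1 < (N y).1) ∧ ∀ x, treeHeight x = (N x).1 := by
  let N : μ.ToType × K → Ordinal.{u} × K := fun x => ((Ordinal.ToType.mk.symm x.1).1, x.2)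
  have hlt : ∀ x, (N x).1 < μ := fun x => (Ordinal.ToType.mk.symm x.1).2
  have hN : Function.Injective N := by
    rintro ⟨x, ξ⟩ ⟨y, η⟩ h
    simp only [N, Prod.mk.injEq] at h
    exact Prod.ext (Ordinal.ToType.mk.symm.injective (Subtype.ext h.1)) h.2
  have hrange : ∀ a : Ordinal.{u} × K, a.1 < μ → ∃ x, N x = a := fun a ha =>
    ⟨(Ordinal.ToType.mk ⟨a.1, ha⟩, a.2), by simp [N]⟩
  let _ : PartialOrder (μ.ToType × K) :=
    { le := fun x y => le (N x) (N y)
      le_refl := fun x => hr _ _ (hlt x)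
      le_trans := fun x y z h h' => hT.trans h h'
      le_antisymm := fun x y h h' =>
        hN (hT.eq_of_lev_eq h (le_antisymm (hT.lev_le h) (hT.lev_le h'))) }
  have hle : ∀ x y : μ.ToType × K, x ≤ y ↔ le (N x) (N y) := fun x y => Iff.rfl
  have hlt' : ∀ x y : μ.ToType × K, x < y ↔ le (N x) (N y) ∧ (N x).1 < (N y).1 := by
    intro x y
    rw [lt_iff_le_and_ne, hle]
    refine and_congr_right fun h => ⟨fun hne => ?_, fun h' e => by simp [e] at h'⟩
    exact lt_of_le_of_ne (hT.lev_le h) fun e => hne (hN (hT.eq_of_lev_eq h e))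
  have h1 : ∀ x y : μ.ToType × K, x < y → (N x).1 < (N y).1 := fun x y h => ((hlt' x y).1 h).2
  have h2 : ∀ x y z : μ.ToType × K, y < x → z < x → (N y).1 ≤ (N z).1 → y ≤ z :=
    fun x y z hy hz h => hT.le_of_lev_le ((hlt' _ _).1 hy).1 ((hlt' _ _).1 hz).1 h
  have h3 : ∀ x : μ.ToType × K, ∀ γ < (N x).1, ∃ y < x, (N y).1 = γ := by
    intro x γ hγ
    obtain ⟨η, hη⟩ := hT.pred (hr _ _ (hlt x)) (hγ.trans (hlt x)) hγ.le
    obtain ⟨y, hy⟩ := hrange (γ, η) (hγ.trans (hlt x))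
    refine ⟨y, (hlt' _ _).2 ?_, by rw [hy]⟩
    rw [hy]
    exact ⟨hη, hγ⟩
  have := isTreeOrder_of_levels h1 h2 h3
  refine ⟨μ.ToType × K, inferInstance, this, N, hN, ?_, hle, hlt',
    treeHeight_eq_of_levels h1 h2 h3⟩
  ext a
  exact ⟨by rintro ⟨x, rfl⟩; exact hlt x, hrange a⟩

/-! ### The super-Souslin tree -/

theorem theoremC (lam : Cardinal.{u}) (hlam : ℵ₀ ≤ lam)
    (hFA : ForcingAxiom (Order.succ lam)) :
    ∃ (T : Type u) (_ : PartialOrder T) (_ : IsTreeOrder T),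
      IsSuperSouslin T lam ∧ IsCompleteTree T (Order.succ lam) := by
  classical
  obtain ⟨L, rfl⟩ : ∃ L : Type u, #L = lam := ⟨lam.out, Cardinal.mk_out _⟩
  obtain ⟨K, hK⟩ : ∃ K : Type u, #K = Order.succ #L := ⟨(Order.succ #L).out, Cardinal.mk_out _⟩
  have : Infinite L := Cardinal.infinite_iff.2 hlam
  have : Nonempty L := inferInstance
  have : Nonempty K := Cardinal.mk_ne_zero_iff.1 (hK ▸ (Cardinal.succ_ne_zero _))
  obtain ⟨le, R, hT, hr, hsplit, hcompat, hcol, hbound⟩ := exists_generic_tree hK hFA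
  obtain ⟨T, _, _, N, hN, hrange, hle, hlt, hht⟩ := hT.exists_treeOrder hr
  have hNlt : ∀ x, (N x).1 < succOrd (Order.succ #L) := fun x => by
    have : N x ∈ Set.range N := mem_range_self x
    rwa [hrange] at this
  have hNex : ∀ α ξ, α < succOrd (Order.succ #L) → ∃ x, N x = (α, ξ) := fun α ξ h => by
    have : (α, ξ) ∈ Set.range N := hrange ▸ h
    exact this
  have hlevel : ∀ x α, x ∈ treeLevel T α ↔ (N x).1 = α := fun x α => by
    rw [treeLevel, mem_ofPred_eq, hht]
  have hlim : Order.IsSuccLimit (succOrd (Order.succ #L)) := Cardinal.isSuccLimit_ord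
    (hlam.trans ((Order.le_succ _).trans (Order.le_succ _)))
  obtain ⟨ι, hι, hιr⟩ := exists_enum_ord L
  obtain ⟨code, hcode, hcoder⟩ := exists_enum_ord K
  let j : L → Iio (#L).ord := fun l => ⟨ι l, hιr.subset ⟨l, rfl⟩⟩
  have hj : Function.Injective j := fun a b h => hι (congrArg Subtype.val h)
  -- A level sequence lies on one level, so any index may be used to read it off.
  let lv : (Iio (#L).ord → T) → Ordinal.{u} := fun a => (N (a (j (Classical.arbitrary L)))).1
  let sq : (Iio (#L).ord → T) → L → K := fun a l => (N (a (j l))).2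
  let Q : (Iio (#L).ord → T) → (Iio (#L).ord → T) → K → Prop := fun a b ζ =>
    (lv a, lv b, sq a, sq b, ζ) ∈ R
  -- The default 0 is never taken when a < b are level sequences, since such a pair has a colour.
  let F : (Iio (#L).ord → T) → (Iio (#L).ord → T) → Ordinal.{u} := fun a b =>
    if h : ∃ ζ, Q a b ζ then code h.choose else 0
  have hseq : ∀ a ∈ LevelSeq T (Order.succ (Order.succ #L)) #L,
      ∀ l, N (a (j l)) = (lv a, sq a l) := by
    rintro a ⟨-, α, -, ha⟩ l
    exact Prod.ext (((hlevel _ _).1 (ha (j l))).trans ((hlevel _ _).1 (ha _)).symm) rfl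
  have hQ : ∀ a ∈ LevelSeq T (Order.succ (Order.succ #L)) #L,
      ∀ b ∈ LevelSeq T (Order.succ (Order.succ #L)) #L, (∀ i, a i < b i) →
      ∃ ζ, Q a b ζ ∧ F a b = code ζ := by
    intro a ha b hb hab
    have h : ∃ ζ, Q a b ζ := by
      refine hcol _ _ _ _ ((hlt _ _).1 (hab _)).2 (hNlt _) (fun l l' h => ?_) fun l => ?_
      · refine hj (ha.1 (hN ?_))
        rw [hseq a ha, hseq a ha, h]
      · rw [← hseq a ha, ← hseq b hb]
        exact ((hlt _ _).1 (hab _)).1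
    exact ⟨h.choose, h.choose_spec, dif_pos h⟩
  refine ⟨T, inferInstance, inferInstance, ⟨⟨fun α hα => ⟨?_, ?_⟩, ?_⟩, ?_, ?_, F, ?_, ?_⟩, ?_⟩
  · obtain ⟨x, hx⟩ := hNex α (Classical.arbitrary K) hα
    exact ⟨x, (hlevel _ _).2 (by rw [hx])⟩
  · rw [Order.lt_succ_iff, ← hK]
    refine Cardinal.mk_le_of_injective (f := fun x : treeLevel T α => (N x.1).2) fun x y h => ?_
    exact Subtype.ext (hN (Prod.ext (((hlevel _ _).1 x.2).trans ((hlevel _ _).1 y.2).symm) h))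
  · refine eq_empty_of_forall_notMem fun x hx => ?_
    exact absurd ((hlevel _ _).1 hx) (hNlt x).ne
  · intro α β hαβ hβ a ha
    obtain rfl := (hlevel _ _).1 ha
    obtain ⟨η, -, -, hη, -⟩ := hsplit (N a).1 β (N a).2 hαβ hβ
    obtain ⟨b, hb⟩ := hNex β η hβ
    refine ⟨b, (hlevel _ _).2 (by rw [hb]), (hlt _ _).2 ?_⟩
    rw [hb]
    exact ⟨hη, hαβ⟩
  · intro a
    have hs := hlim.succ_lt (hNlt a)
    obtain ⟨η, η', hne, h1, h2⟩ := hsplit (N a).1 _ (N a).2 (Order.lt_succ _) hs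
    obtain ⟨b, hb⟩ := hNex _ η hs
    obtain ⟨c, hc⟩ := hNex _ η' hs
    have hcov : ∀ b, (N b).1 = Order.succ (N a).1 → le (N a) (N b) → a ⋖ b := by
      refine fun b hb h => ⟨(hlt _ _).2 ⟨h, hb ▸ Order.lt_succ _⟩, fun c hac hcb => ?_⟩
      have h1 := ((hlt _ _).1 hcb).2
      rw [hb, Order.lt_succ_iff] at h1
      exact absurd ((hlt _ _).1 hac).2 h1.not_gt
    refine ⟨b, c, fun h => hne ?_, hcov b (by rw [hb]) (hb ▸ h1), hcov c (by rw [hc]) (hc ▸ h2)⟩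
    have := hb.symm.trans ((congrArg N h).trans hc)
    exact congrArg Prod.snd this
  · intro a ha b hb hab
    obtain ⟨ζ, -, h⟩ := hQ a ha b hb hab
    rw [h, ← hK]
    exact hcoder.subset ⟨ζ, rfl⟩
  · intro a ha b hb c hc hab hac hF
    obtain ⟨ζ, h1, h2⟩ := hQ a ha b hb hab
    obtain ⟨ζ', h3, h4⟩ := hQ a ha c hc hac
    obtain rfl : ζ = ζ' := hcode (h2.symm.trans (hF.trans h4))
    obtain ⟨l, hl⟩ := hcompat _ _ _ _ _ _ _ h1 h3
    rw [← hseq b hb, ← hseq c hc, ← hle, ← hle] at hl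
    exact ⟨j l, hl⟩
  · intro C hC hCL
    have hCf : Few L C := Few.iff_lt_succ'.2 hCL
    obtain ⟨μ, hμ, e, he, hcover, hge⟩ := exists_isCoi_cover (hCf.image fun x => (N x).1) (by
      rintro _ ⟨x, -, rfl⟩
      exact hNlt x)
    -- Each level of the cover is at or below the level of a member of C, so C singles out a node on
    -- it; these nodes form a chain.
    have hg : ∀ a < μ, ∃ ξ, ∃ c ∈ C, le (e a, ξ) (N c) := by
      intro a ha
      obtain ⟨_, ⟨c, hc, rfl⟩, h⟩ := hge a ha
      obtain ⟨ξ, hξ⟩ := hT.pred ((hle c c).1 le_rfl) (he.mapsTo (lt_trans ha (Order.lt_succ _))) h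
      exact ⟨ξ, c, hc, hξ⟩
    choose! g k hkC hgk using hg
    have hchain : ∀ x ∈ C, ∀ y ∈ C, ∃ z ∈ C, x ≤ z ∧ y ≤ z := fun x hx y hy =>
      (hC.total hx hy).elim (fun h => ⟨y, hy, h, le_rfl⟩) fun h => ⟨x, hx, le_rfl, h⟩
    obtain ⟨η, hη⟩ := hbound μ hμ e he g fun a b hab hb => by
      obtain ⟨z, -, h1, h2⟩ := hchain _ (hkC a (hab.trans hb)) _ (hkC b hb)
      exact hT.le_of_lev_le (hT.trans (hgk a (hab.trans hb)) ((hle _ _).1 h1))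
        (hT.trans (hgk b hb) ((hle _ _).1 h2))
        (he.strictMonoOn (lt_trans (hab.trans hb) (Order.lt_succ _))
          (lt_trans hb (Order.lt_succ _)) hab).le
    obtain ⟨x, hx⟩ := hNex (e μ) η (he.mapsTo (Order.lt_succ μ))
    refine ⟨x, fun c hc => (hle _ _).2 ?_⟩
    obtain ⟨a, ha, hac⟩ := hcover ⟨c, hc, rfl⟩
    obtain ⟨z, -, h1, h2⟩ := hchain _ (hkC a ha) c hc
    -- On the level of c itself the node singled out is c, so the bound of the enlarged chain bounds
    -- C.
    have h3 : N c = (e a, g a) := by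
      have h4 := hT.le_of_lev_le (hT.trans (hgk a ha) ((hle _ _).1 h1)) ((hle _ _).1 h2) hac.le
      exact (hT.eq_of_lev_eq h4 hac).symm
    rw [hx, h3]
    exact hη a ha
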